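/- \textbf{Setting.} Let $\mathbb T=\mathbb R/2\pi\mathbb Z$, $\zeta>0$ and $\kappa<1$. Let $f:\mathbb T\to\mathbb T$ have a lift $\hat f:\mathbb R\to\mathbb R$ which is a homeomorphism and whose inverse $v=\hat f^{-1}$ extends analytically to the strip $\mathbb R_\zeta=\mathbb R+i[-\zeta,\zeta]$, with $|v'|\le\kappa$ there. Suppose that $v'$ has no zero in $\mathbb R_\zeta$ and that a branch of $\log v'$ is $\alpha$-Hölder on $\mathbb R_\zeta$ with constant $D$, for some $\alpha>0$ and $D\le\frac{\pi}{3}\zeta^{-\alpha}$. Let $\mu=h\,\mathrm dx$ be a measure on $\mathbb T$ with positive density $h$ which extends analytically to $\mathbb T_\zeta=\{z\in\mathbb C/2\pi\mathbb Z:|\operatorname{Im}z|<\zeta\}$, with $M^{-1}\le|h|\le M$ on $\mathbb T_\zeta$ for some constant $M$. For $s\ge 0$ put $\sigma_s(k)=\sqrt{\cosh 2ks}$ and $\sigma_{-s}(k)=\sigma_s(k)^{-1}$, $k\in\mathbb Z$. For real $s$ let $\mathcal H^2_s$ be the Hilbert space of formal Fourier series $\varphi=\sum_k\hat\varphi(k)e^{ikx}$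 with $\|\varphi\|_{\mathcal H^2_s}=\|\sigma_s\hat\varphi\|_{\ell^2(\mathbb Z)}<\infty$: for $s>0$ it is the Hardy space of the strip $\mathbb T_s$, and $\mathcal H^2_{-s}\supset L^2(\mathbb T)$ is its dual, a space of hyperdistributions. Suppose that the sequence $\sigma_\zeta(k)\,\widehat{(\log h)'}(k)$ is in $\ell^q(\mathbb Z)$ for some $q\in[1,\infty)$. Let $\mathcal K\varphi=\varphi\circ f$ be the Koopman operator, $\mathcal P_K$ the $L^2(\mu)$-orthogonal projection onto $\operatorname{span}\{e^{ikx}:|k|<K\}$, and $\mathcal K_K=\mathcal P_K\mathcal K\mathcal P_K$. For closed subspaces $E,F$ of a normed space let $$d(E,F)=\max\Big\{\sup_{e\in E,\|e\|=1}\operatorname{dist}(e,F),\ \sup_{g\in F,\|g\|=1}\operatorname{dist}(g,E)\Big\}.$$ A left generalised eigenfunction of an operator $\mathcal A$ for $\nu$ is a function $a$ such that, for some $j$, $\int a\,(\mathcal A-\nu)^j\varphi\,\mathrm d\mu=0$ for all $\varphi\in L^2(\mu)$. \textbf{Statement.} For $0<t\le\zeta$ the operators $\mathcal K$ and $\mathcal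 P_K$ extend from $L^2(\mu)$ to bounded operators on $\mathcal H^2_{-t}$. Let $\lambda\ne0$ be an eigenvalue of $\mathcal K$ on $\mathcal H^2_{-\zeta}$, with algebraic multiplicity $m$. Then $m$ is finite, and there is $r>0$ such that $\lambda$ is the only point of the spectrum of $\mathcal K$ on $\mathcal H^2_{-\zeta}$ in $B=\{\nu:|\nu-\lambda|\le r\}$ and the following holds as $K\to\infty$. 1. For all large $K$, $\mathcal K_K$ has exactly $m$ eigenvalues in $B$, counted with algebraic multiplicity, and each of these eigenvalues $\nu$ satisfies $|\nu-\lambda|=\mathcal O(e^{-(1-\kappa)\zeta K/m})$, uniformly over them. 2. For every $t\in(0,\zeta]$, the generalised eigenspace $E$ of $\mathcal K$ for $\lambda$ in $\mathcal H^2_{-t}$ has dimension $m$, and if $E_K$ is the sum of the generalised eigenspaces of $\mathcal K_K$ in $\mathcal H^2_{-t}$ for the eigenvalues in $B$, then $d(E,E_K)=\mathcal O(e^{-(1-\kappa)tK})$ in the norm of $\mathcal H^2_{-t}$. 3. For every $t\in(0,\zeta]$, if $E'$ is the space of left generalised eigenfunctions of $\mathcal K$ for $\lambda$ in $\mathcal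 H^2_{\kappa t}$ and $E'_K$ is the sum of the spaces of left generalised eigenfunctions of $\mathcal K_K$ in $\mathcal H^2_{\kappa t}$ for the eigenvalues in $B$, then $d(E',E'_K)=\mathcal O(e^{-(1-\kappa)tK})$ in the norm of $\mathcal H^2_{\kappa t}$. -/

import Mathlib

open MeasureTheory Filter Topology Asymptotics
open scoped ENNReal

noncomputable section

namespace EDMD

instance factTwoPiPos : Fact (0 < 2 * Real.pi) := ⟨Real.two_pi_pos⟩

/-- The circle `ℝ / 2πℤ`. -/
abbrev Torus : Type := AddCircle (2 * Real.pi)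

/-! ### The scale of spaces `H²_s`, `s ∈ ℝ` -/

/-- The Fourier weight of `H²_s`: `σ_s(k) = √(cosh 2ks)` for `s ≥ 0`, and `σ_{|s|}(k)⁻¹`
for `s < 0`. -/
def weight (s : ℝ) (k : ℤ) : ℝ :=
  if 0 ≤ s then √(Real.cosh (2 * k * s)) else (√(Real.cosh (2 * k * s)))⁻¹

lemma weight_pos (s : ℝ) (k : ℤ) : 0 < weight s k := by
  have h : 0 < √(Real.cosh (2 * k * s)) := Real.sqrt_pos.2 (Real.cosh_pos _)
  unfold weight
  split_ifs
  · exact h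
  · exact inv_pos.2 h

/-- The sequences of Fourier coefficients `c : ℤ → ℂ` with `σ_s c ∈ ℓ²(ℤ)`. -/
def hardySubmodule (s : ℝ) : Submodule ℂ (ℤ → ℂ) where
  carrier := {c | Memℓp (fun k => (weight s k : ℂ) * c k) 2}
  add_mem' {a b} ha hb := by
    have := Memℓp.add ha hb
    simp only [Set.mem_ofPred_eq, Pi.add_apply, mul_add]
    exact this
  zero_mem' := by
    simp only [Set.mem_ofPred_eq, Pi.zero_apply, mul_zero]
    exact zero_mem_ℓp'
  smul_mem' r a ha := by
    have := Memℓp.const_smul (𝕜 := ℂ) ha r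
    simp only [Set.mem_ofPred_eq, Pi.smul_apply, smul_eq_mul, mul_left_comm _ r]
    exact this

/-- The space `H²_s`, each (generalised) function being represented by its sequence of Fourier
coefficients. It is the Hardy space of the strip `|Im z| < s` for `s > 0`, `L²` for `s = 0` and the
dual of `H²_{-s}`, a space of hyperdistributions, for `s < 0`. (A separate type, since it carries
the topology of its norm and not that of pointwise convergence.) -/
def Hardy (s : ℝ) : Type := hardySubmodule s

instance (s : ℝ) : AddCommGroup (Hardy s) := inferInstanceAs (AddCommGroup (hardySubmodule s))

instance (s : ℝ) : Module ℂ (Hardy s) := inferInstanceAs (Module ℂ (hardySubmodule s))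

/-- The Fourier coefficients of an element of `H²_s`. -/
def Hardy.coeff {s : ℝ} (c : Hardy s) : ℤ → ℂ := c.1

/-- The element of `H²_s` with given Fourier coefficients. -/
def Hardy.mk {s : ℝ} (c : ℤ → ℂ) (hc : c ∈ hardySubmodule s) : Hardy s := ⟨c, hc⟩

/-- The map `φ ↦ σ_s φ̂` from `H²_s` to `ℓ²(ℤ)`. -/
def Hardy.toEll2 (s : ℝ) : Hardy s →ₗ[ℂ] lp (fun _ : ℤ => ℂ) 2 where
  toFun c := ⟨fun k => (weight s k : ℂ) * c.coeff k, c.2⟩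
  map_add' a b := by
    ext k
    exact mul_add _ _ _
  map_smul' r a := by
    ext k
    exact mul_left_comm _ _ _

lemma Hardy.toEll2_injective (s : ℝ) : Function.Injective (Hardy.toEll2 s) := by
  intro a b hab
  apply Subtype.ext
  funext k
  have h1 : (weight s k : ℂ) * a.coeff k = (weight s k : ℂ) * b.coeff k :=
    congrFun (congrArg Subtype.val hab) k
  exact mul_left_cancel₀ (by exact_mod_cast (weight_pos s k).ne') h1

/-- The norm `‖φ‖ = ‖σ_s φ̂‖_{ℓ²}` of `H²_s`. -/
instance (s : ℝ) : NormedAddCommGroup (Hardy s) :=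
  NormedAddCommGroup.induced (Hardy s) (lp (fun _ : ℤ => ℂ) 2) (Hardy.toEll2 s)
    (Hardy.toEll2_injective s)

instance (s : ℝ) : NormedSpace ℂ (Hardy s) :=
  NormedSpace.induced ℂ (Hardy s) (lp (fun _ : ℤ => ℂ) 2) (Hardy.toEll2 s)

/-- The function on the circle with the given Fourier coefficients (for `s > 0` the series
converges absolutely). -/
def Hardy.eval {s : ℝ} (c : Hardy s) (x : Torus) : ℂ := ∑' k : ℤ, c.coeff k * fourier k x

/-- The gap between two closed subspaces of a normed space. -/
def gap {X : Type*} [NormedAddCommGroup X] [NormedSpace ℂ X] (E F : Submodule ℂ X) : ℝ :=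
  max (sSup ((fun e => Metric.infDist e (F : Set X)) '' {e | e ∈ E ∧ ‖e‖ = 1}))
    (sSup ((fun e => Metric.infDist e (E : Set X)) '' {e | e ∈ F ∧ ‖e‖ = 1}))

/-! ### The assumptions on the map and on the sampling measure -/

/-- The closed strip `ℝ + i[-ζ, ζ]`. -/
def closedStrip (ζ : ℝ) : Set ℂ := {z | |z.im| ≤ ζ}

/-- The open strip `|Im z| < ζ`. -/
def openStrip (ζ : ℝ) : Set ℂ := {z | |z.im| < ζ}

/-- The circle map `f` has a lift `F` to `ℝ` whose inverse extends to a function `v` analytic on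
the closed strip, with `|v'| ≤ κ` there, and the branches of `log v'` are `α`-Hölder with constant
`D` on the strip. -/
def IsAnalyticExpanding (f : Torus → Torus) (ζ κ α D : ℝ) : Prop :=
  ∃ (F : ℝ ≃ₜ ℝ) (v : ℂ → ℂ),
    (∀ x : ℝ, ((F x : ℝ) : Torus) = f (x : Torus)) ∧
    (∀ x : ℝ, v x = (F.symm x : ℝ)) ∧
    AnalyticOnNhd ℂ v (closedStrip ζ) ∧
    (∀ z ∈ closedStrip ζ, ‖deriv v z‖ ≤ κ) ∧
    ∃ g : ℂ → ℂ, (∀ z ∈ closedStrip ζ, Complex.exp (g z) = deriv v z) ∧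
      ∀ z ∈ closedStrip ζ, ∀ z' ∈ closedStrip ζ, ‖g z - g z'‖ ≤ D * ‖z - z'‖ ^ α

/-- The positive density `h` extends to an analytic function `H` on the open strip modulo `2π`, with
`M⁻¹ ≤ |H| ≤ M` there, and the Fourier coefficients of `(log h)'`, multiplied by the weight
of `H²_ζ`, are in `ℓ^q`. -/
def IsAnalyticDensity (h : C(Torus, ℝ)) (ζ M : ℝ) (q : ℝ≥0∞) : Prop :=
  (∀ x, 0 < h x) ∧
  (∃ H : ℂ → ℂ, (∀ x : ℝ, H x = (h (x : Torus) : ℝ)) ∧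
    AnalyticOnNhd ℂ H (openStrip ζ) ∧
    (∀ z ∈ openStrip ζ, H (z + 2 * Real.pi) = H z) ∧
    ∀ z ∈ openStrip ζ, M⁻¹ ≤ ‖H z‖ ∧ ‖H z‖ ≤ M) ∧
  Memℓp (fun k : ℤ => (weight ζ k : ℂ) * fourierCoeffOn Real.two_pi_pos
    (fun x : ℝ => ((deriv (fun y : ℝ => Real.log (h (y : Torus))) x : ℝ) : ℂ)) k) q

/-! ### The operators on `L²(μ)` -/

/-- The sampling measure `dμ = h dx`. -/
def sampling (h : C(Torus, ℝ)) : Measure Torus :=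
  (volume : Measure Torus).withDensity fun x => ENNReal.ofReal (h x)

instance (h : C(Torus, ℝ)) : IsFiniteMeasure (sampling h) :=
  isFiniteMeasure_withDensity_ofReal
    (h.continuous.integrable_of_hasCompactSupport (HasCompactSupport.of_compactSpace _)).2

/-- The space `L²(μ)`. -/
abbrev L2 (h : C(Torus, ℝ)) : Type := Lp ℂ 2 (sampling h)

/-- The dictionary: the span of `e^{ikx}`, `|k| < n`. -/
def trigPoly (h : C(Torus, ℝ)) (n : ℕ) : Submodule ℂ (L2 h) :=
  Submodule.span ℂ (Set.range fun k : Finset.Ioo (-(n : ℤ)) n =>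
    ContinuousMap.toLp 2 (sampling h) ℂ (fourier (k : ℤ) : C(Torus, ℂ)))

instance (h : C(Torus, ℝ)) (n : ℕ) : FiniteDimensional ℂ (trigPoly h n) :=
  FiniteDimensional.span_of_finite ℂ (Set.finite_range _)

/-- The `L²(μ)`-orthogonal projection onto the dictionary. -/
def projL2 (h : C(Torus, ℝ)) (n : ℕ) (φ : L2 h) : L2 h := (trigPoly h n).starProjection φ

open Classical in
/-- The Koopman operator `φ ↦ φ ∘ f` on `L²(μ)` (under the assumptions on `f` and `h`, composition
with `f` always preserves `L²(μ)`). -/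
def koopmanL2 (h : C(Torus, ℝ)) (f : Torus → Torus) (φ : L2 h) : L2 h :=
  if hφ : MemLp (fun x => φ (f x)) 2 (sampling h) then hφ.toLp else 0

/-- The EDMD operator `P_n K P_n` on `L²(μ)`. -/
def edmdL2 (h : C(Torus, ℝ)) (f : Torus → Torus) (n : ℕ) (φ : L2 h) : L2 h :=
  projL2 h n (koopmanL2 h f (projL2 h n φ))

/-! ### The operators on `H²_s`, `s ≤ 0` -/

/-- The bounded operator `A` on `H²_s` extends the map `R` of `L²(μ)`. -/
def IsExtension (h : C(Torus, ℝ)) (s : ℝ) (R : L2 h → L2 h) (A : Hardy s →L[ℂ] Hardy s) : Prop :=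
  ∀ φ : L2 h, ∃ hφ : fourierCoeff (φ : Torus → ℂ) ∈ hardySubmodule s,
    (A (Hardy.mk _ hφ)).coeff = fourierCoeff (R φ : Torus → ℂ)

open Classical in
/-- The bounded operator on `H²_s` which extends `R` (unique for `s ≤ 0`, because `L²` is then
dense in `H²_s`), and `0` if there is none. -/
def extension (h : C(Torus, ℝ)) (s : ℝ) (R : L2 h → L2 h) : Hardy s →L[ℂ] Hardy s :=
  if hA : ∃ A, IsExtension h s R A then hA.choose else 0

/-- The projection `P_n` on `H²_s`. -/
def proj (h : C(Torus, ℝ)) (n : ℕ) (s : ℝ) : Hardy s →L[ℂ] Hardy s := extension h s (projL2 h n)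

/-- The Koopman operator on `H²_s`. -/
def koopman (h : C(Torus, ℝ)) (f : Torus → Torus) (s : ℝ) : Hardy s →L[ℂ] Hardy s :=
  extension h s (koopmanL2 h f)

/-- The EDMD operator `P_n K P_n` on `H²_s`. -/
def edmd (h : C(Torus, ℝ)) (f : Torus → Torus) (n : ℕ) (s : ℝ) : Hardy s →L[ℂ] Hardy s :=
  proj h n s ∘L koopman h f s ∘L proj h n s

/-! ### Generalised eigenspaces -/

/-- The sum of the right generalised eigenspaces of `A` for the eigenvalues in the set `S`. Its
dimension is the number of eigenvalues in `S`, counted with algebraic multiplicity. -/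
def rightSpace {s : ℝ} (A : Hardy s →L[ℂ] Hardy s) (S : Set ℂ) : Submodule ℂ (Hardy s) :=
  ⨆ ν ∈ S, Module.End.maxGenEigenspace (A : Module.End ℂ (Hardy s)) ν

/-- The sum, in `H²_s`, of the left generalised eigenspaces of a linear operator `R` for the
eigenvalues in the set `S`: a left generalised eigenfunction for `ν` is an `a ∈ H²_s` such
that the functional `φ ↦ ∫ a φ dμ` vanishes on the range of `(R - ν)^j` for some `j`. -/
def leftSpace (h : C(Torus, ℝ)) (s : ℝ) (R : L2 h → L2 h) (S : Set ℂ) : Submodule ℂ (Hardy s) :=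
  ⨆ ν ∈ S, Submodule.span ℂ {a : Hardy s | ∃ j : ℕ, ∀ φ : L2 h,
    ∫ x, a.eval x * ((fun ψ : L2 h => R ψ - ν • ψ)^[j] φ : L2 h) x ∂(sampling h) = 0}

end EDMD

end

/-! The map expands, so the inverse `v` of its lift contracts: it is real on the real line and |v'|
≤ κ, hence |Im v(z)| ≤ κ|Im z|. The transpose of the Koopman operator for dx is the transfer
operator, the sum of |v'|·(p ∘ v) over the inverse branches. Composition with `v` turns a function
on the strip of half-width κt into one on the strip of half-width t, so the transfer operator maps
H²_{κt} boundedly to H²_t. Dually, K maps H²_{-t} into the smaller space H²_{-κt}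
(`exists_koopman_extension`).

That no width is lost in this step is due to subordination (`IsStripLift.integral_sq_le`). A
polynomial in e^{iz} or in e^{-iz} has a square with a harmonic majorant whose mean is the sum of
the squared coefficients. After composition with `v`, the mean of the majorant over a horizontal
line can be moved to the real axis, where the substitution x = v(y) costs only a lower bound of
|v'|. Bounds on all lines inside the strip then give the weighted bound on Fourier coefficients
(`sum_weight_le_of_strip`).

The projections P_n are orthogonal for μ, not for dx. On H²_s with s ≥ 0 they are bounded uniformly
in n because they fix low frequencies, while on high frequencies the gain σ_s(n)⁻¹ in L² pays for
the factor σ_s(n) lost in returning to H²_s (`exists_proj_restriction`). On H²_{-s} they are bounded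
by duality, since multiplication by h and by 1/h preserves H²_s (`exists_proj_extension`). As P_n
fixes trigonometric polynomials of degree below n, the error ‖P_n K − K‖ on H²_{-t} is governed by
the truncation error of the inclusion H²_{-κt} ⊆ H²_{-t}, a ratio of weights at most √2 e^{-(1-κ)tn}
(`weight_neg_le`, `approximates_of_factor`).

The rest is perturbation theory for compact operators. For nonzero ν the operators P_n K P_n and P_n
K have the same generalised eigenvectors, so it suffices to compare the Riesz projections of P_n K
and K. Their distance is O(‖P_n K − K‖), which bounds the gap (`gap_isBigO`) and forces equal ranks
(`eventually_finrank_eq`). Since (K − λ)^m annihilates the range of the projection for λ, the m-th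
power of the eigenvalue error has the same order (`eigenvalue_bound`).

Generalised eigenvectors for nonzero eigenvalues lie in the range of the smoothing operator, so they
belong to every H²_{-t}, and multiplicities do not depend on t (`exists_preimage`). Left generalised
eigenfunctions are the generalised eigenvectors of the transpose h⁻¹Kᵀh with respect to μ, which
maps H²_{κt} to H²_t and is approximated at the same rate (`exists_left_approximation`). -/

noncomputable section

namespace EDMD

section

/-! ### Riesz projections -/

section BanachAlgebra

variable {𝔸 : Type*} [NormedRing 𝔸] [NormedAlgebra ℂ 𝔸]

/-- The Riesz projection of `a` for the part of the spectrum inside the circle. -/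
def rieszProj (a : 𝔸) (c : ℂ) (r : ℝ) : 𝔸 :=
  (2 * Real.pi * Complex.I : ℂ)⁻¹ • ∮ z in C(c, r), resolvent a z

/-- The closed annulus `r ≤ |z - c| ≤ R`. -/
def annulus (c : ℂ) (r R : ℝ) : Set ℂ := Metric.closedBall c R \ Metric.ball c r

lemma isCompact_annulus (c : ℂ) (r R : ℝ) : IsCompact (annulus c r R) :=
  (isCompact_closedBall c R).diff Metric.isOpen_ball

lemma sphere_subset_annulus {c : ℂ} {r R : ℝ} (h : r ≤ R) : Metric.sphere c r ⊆ annulus c r R :=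
  fun z hz => ⟨by simpa [Metric.mem_sphere.1 hz] using h, by simp [Metric.mem_sphere.1 hz]⟩

lemma sphere_subset_annulus' {c : ℂ} {r R : ℝ} (h : r ≤ R) : Metric.sphere c R ⊆ annulus c r R :=
  fun z hz => ⟨by simp [Metric.mem_sphere.1 hz], by simpa [Metric.mem_sphere.1 hz] using h⟩

lemma two_pi_I_ne_zero : (2 * Real.pi * Complex.I : ℂ) ≠ 0 := by
  simp [Real.pi_ne_zero]

lemma resolvent_mul_resolvent {a : 𝔸} {z w : ℂ} (hz : z ∈ resolventSet ℂ a)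
    (hw : w ∈ resolventSet ℂ a) :
    resolvent a z - resolvent a w = (w - z) • (resolvent a w * resolvent a z) := by
  have h1 : resolvent a w * (algebraMap ℂ 𝔸 w - a) = 1 := Ring.inverse_mul_cancel _ hw
  have h2 : (algebraMap ℂ 𝔸 z - a) * resolvent a z = 1 := Ring.mul_inverse_cancel _ hz
  calc resolvent a z - resolvent a w
      = (resolvent a w * (algebraMap ℂ 𝔸 w - a)) * resolvent a z
        - resolvent a w * ((algebraMap ℂ 𝔸 z - a) * resolvent a z) := by
          rw [h1, h2, one_mul, mul_one]
    _ = resolvent a w * (algebraMap ℂ 𝔸 (w - z)) * resolvent a z := by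
          rw [map_sub]; noncomm_ring
    _ = _ := by
          rw [← Algebra.commutes, mul_assoc, ← Algebra.smul_def]

lemma circleIntegral_comp_swap {f : ℂ → ℂ → 𝔸} {c : ℂ} {r R : ℝ} (hr : 0 ≤ r) (hR : 0 ≤ R)
    (hf : ContinuousOn (Function.uncurry f) (Metric.sphere c r ×ˢ Metric.sphere c R)) :
    (∮ z in C(c, r), ∮ w in C(c, R), f z w) = ∮ w in C(c, R), ∮ z in C(c, r), f z w := by
  have hcont : Continuous fun p : ℝ × ℝ => f (circleMap c r p.1) (circleMap c R p.2) := by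
    refine hf.comp_continuous (f := fun p : ℝ × ℝ => (circleMap c r p.1, circleMap c R p.2))
      (by fun_prop) fun p => ⟨?_, ?_⟩
    · exact circleMap_mem_sphere c hr _
    · exact circleMap_mem_sphere c hR _
  have hd : ∀ ρ : ℝ, Continuous fun θ => deriv (circleMap c ρ) θ := fun ρ => by
    simp only [deriv_circleMap]
    fun_prop
  simp only [circleIntegral]
  simp_rw [← intervalIntegral.integral_smul]
  rw [intervalIntegral_intervalIntegral_swap]
  · refine intervalIntegral.integral_congr fun θ _ => ?_
    refine intervalIntegral.integral_congr fun φ _ => ?_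
    exact smul_comm _ _ _
  · have hc : Continuous (Function.uncurry fun θ x => deriv (circleMap c r) θ •
        deriv (circleMap c R) x • f (circleMap c r θ) (circleMap c R x)) :=
      ((hd r).comp continuous_fst).smul (((hd R).comp continuous_snd).smul hcont)
    exact (hc.continuousOn.integrableOn_compact (isCompact_uIcc.prod isCompact_uIcc)).mono_set
      (Set.prod_mono Set.uIoc_subset_uIcc Set.uIoc_subset_uIcc)

variable [CompleteSpace 𝔸]

lemma continuousOn_resolvent (a : 𝔸) : ContinuousOn (resolvent a) (resolventSet ℂ a) :=
  fun _ hz => (spectrum.hasDerivAt_resolvent_const_left hz).continuousAt.continuousWithinAt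

variable {a : 𝔸} {c : ℂ} {r R : ℝ}

lemma rieszProj_eq_of_annulus (hr : 0 < r) (hrR : r ≤ R)
    (ha : annulus c r R ⊆ resolventSet ℂ a) : rieszProj a c R = rieszProj a c r := by
  unfold rieszProj
  rw [Complex.circleIntegral_eq_of_differentiable_on_annulus_off_countable hr hrR
    Set.countable_empty ((continuousOn_resolvent a).mono ha)]
  intro z hz
  refine (spectrum.hasDerivAt_resolvent_const_left (ha ?_)).differentiableAt
  exact ⟨Metric.ball_subset_closedBall hz.1.1, fun h => hz.1.2 (Metric.ball_subset_closedBall h)⟩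

lemma circleIntegral_mul_left (b : 𝔸) {f : ℂ → 𝔸} (hf : CircleIntegrable f c r) :
    b * (∮ z in C(c, r), f z) = ∮ z in C(c, r), b * f z := by
  have h := (ContinuousLinearMap.mul ℂ 𝔸 b).intervalIntegral_comp_comm hf.out
  simp only [ContinuousLinearMap.mul_apply'] at h
  simp only [circleIntegral]
  rw [← h]
  simp only [mul_smul_comm]

lemma circleIntegral_mul_right (b : 𝔸) {f : ℂ → 𝔸} (hf : CircleIntegrable f c r) :
    (∮ z in C(c, r), f z) * b = ∮ z in C(c, r), f z * b := by
  have h := ((ContinuousLinearMap.mul ℂ 𝔸).flip b).intervalIntegral_comp_comm hf.out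
  simp only [ContinuousLinearMap.flip_apply, ContinuousLinearMap.mul_apply'] at h
  simp only [circleIntegral]
  rw [← h]
  simp only [smul_mul_assoc]

lemma circleIntegrable_resolvent (hr : 0 ≤ r) (ha : Metric.sphere c r ⊆ resolventSet ℂ a) :
    CircleIntegrable (resolvent a) c r :=
  ((continuousOn_resolvent a).mono ha).circleIntegrable hr

/-- The resolvent identity splits the integrand into a multiple of `resolvent a z` and a multiple of
the constant `resolvent a w`. The second part carries the scalar integral of (w − z)⁻¹, which
vanishes by Cauchy's theorem because w lies outside the disc. -/
lemma resolvent_mul_rieszProj (hr : 0 ≤ r) (ha : Metric.sphere c r ⊆ resolventSet ℂ a)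
    {w : ℂ} (hw : w ∈ resolventSet ℂ a) (hwr : r < dist w c) :
    resolvent a w * rieszProj a c r =
      (2 * Real.pi * Complex.I : ℂ)⁻¹ • ∮ z in C(c, r), (w - z)⁻¹ • resolvent a z := by
  have hne : ∀ z ∈ Metric.closedBall c r, w - z ≠ 0 := by
    intro z hz h
    rw [sub_eq_zero] at h
    subst h
    exact absurd (Metric.mem_closedBall.1 hz) (not_le.2 hwr)
  have hcont : ContinuousOn (fun z : ℂ => (w - z)⁻¹) (Metric.closedBall c r) :=
    (continuousOn_const.sub continuousOn_id).inv₀ hne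
  have hz0 : (∮ z in C(c, r), (w - z)⁻¹) = 0 := by
    refine Complex.circleIntegral_eq_zero_of_differentiable_on_off_countable hr
      Set.countable_empty hcont fun z hz => ?_
    exact ((differentiableAt_const _).sub differentiableAt_id).inv
      (hne z (Metric.ball_subset_closedBall hz.1))
  rw [rieszProj, mul_smul_comm, circleIntegral_mul_left _ (circleIntegrable_resolvent hr ha)]
  congr 1
  have h1 : ∀ z ∈ Metric.sphere c r, resolvent a w * resolvent a z =
      (w - z)⁻¹ • resolvent a z - (w - z)⁻¹ • resolvent a w := by
    intro z hz
    rw [← smul_sub, resolvent_mul_resolvent (ha hz) hw, smul_smul,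
      inv_mul_cancel₀ (hne z (Metric.sphere_subset_closedBall hz)), one_smul]
  rw [circleIntegral.integral_congr hr h1, circleIntegral.integral_sub,
    circleIntegral.integral_smul_const, hz0, zero_smul, sub_zero]
  · exact ((hcont.mono Metric.sphere_subset_closedBall).smul
      ((continuousOn_resolvent a).mono ha)).circleIntegrable hr
  · exact ((hcont.mono Metric.sphere_subset_closedBall).smul continuousOn_const).circleIntegrable hr

/-- Write one factor over the larger circle. After exchanging the two integrals, the integral of (w
− z)⁻¹ over the larger circle is 2πi for each z on the smaller one, which leaves a single
projection. -/
lemma rieszProj_mul_self (hr : 0 < r) (hrR : r < R)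
    (ha : annulus c r R ⊆ resolventSet ℂ a) :
    rieszProj a c r * rieszProj a c r = rieszProj a c r := by
  have hs := (sphere_subset_annulus (c := c) hrR.le).trans ha
  have hS := (sphere_subset_annulus' (c := c) hrR.le).trans ha
  have hR := hr.trans hrR
  have hne : ∀ z ∈ Metric.sphere c r, ∀ w ∈ Metric.sphere c R, w - z ≠ 0 := by
    intro z hz w hw h
    rw [sub_eq_zero] at h
    subst h
    rw [Metric.mem_sphere] at hz hw
    linarith
  have h1 : rieszProj a c R * rieszProj a c r = (2 * Real.pi * Complex.I : ℂ)⁻¹ •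
      ∮ w in C(c, R), (2 * Real.pi * Complex.I : ℂ)⁻¹ •
        ∮ z in C(c, r), (w - z)⁻¹ • resolvent a z := by
    conv_lhs => rw [rieszProj]
    rw [smul_mul_assoc, circleIntegral_mul_right _ (circleIntegrable_resolvent hR.le hS)]
    congr 1
    refine circleIntegral.integral_congr hR.le fun w hw => ?_
    exact resolvent_mul_rieszProj hr.le hs (hS hw) (by rw [Metric.mem_sphere.1 hw]; exact hrR)
  rw [rieszProj_eq_of_annulus hr hrR.le ha] at h1
  rw [h1, circleIntegral.integral_smul, ← circleIntegral_comp_swap hr.le hR.le]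
  · rw [rieszProj, ← circleIntegral.integral_smul]
    congr 1
    refine circleIntegral.integral_congr hr.le fun z hz => ?_
    rw [circleIntegral.integral_smul_const, circleIntegral.integral_sub_inv_of_mem_ball, smul_smul,
      inv_mul_cancel₀ two_pi_I_ne_zero, one_smul]
    rw [Metric.mem_ball, Metric.mem_sphere.1 hz]
    exact hrR
  · refine ContinuousOn.smul (ContinuousOn.inv₀ (by fun_prop) fun p hp => hne _ hp.1 _ hp.2) ?_
    exact ((continuousOn_resolvent a).mono hs).comp continuousOn_fst fun p hp => hp.1

lemma commute_rieszProj (hr : 0 ≤ r) (ha : Metric.sphere c r ⊆ resolventSet ℂ a) :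
    a * rieszProj a c r = rieszProj a c r * a := by
  rw [rieszProj, mul_smul_comm, smul_mul_assoc,
    circleIntegral_mul_left _ (circleIntegrable_resolvent hr ha),
    circleIntegral_mul_right _ (circleIntegrable_resolvent hr ha)]
  congr 1
  refine circleIntegral.integral_congr hr fun z hz => ?_
  have h1 : resolvent a z * (algebraMap ℂ 𝔸 z - a) = 1 := Ring.inverse_mul_cancel _ (ha hz)
  have h2 : (algebraMap ℂ 𝔸 z - a) * resolvent a z = 1 := Ring.mul_inverse_cancel _ (ha hz)
  have h3 : algebraMap ℂ 𝔸 z * resolvent a z = resolvent a z * algebraMap ℂ 𝔸 z :=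
    Algebra.commutes _ _
  rw [sub_mul] at h2
  rw [mul_sub] at h1
  have h4 : a * resolvent a z = algebraMap ℂ 𝔸 z * resolvent a z - 1 := by rw [← h2]; abel
  have h5 : resolvent a z * a = resolvent a z * algebraMap ℂ 𝔸 z - 1 := by rw [← h1]; abel
  simp only [h4, h5, h3]

lemma exists_resolvent_bound {K : Set ℂ} (hK : IsCompact K) (ha : K ⊆ resolventSet ℂ a) :
    ∃ C > 0, ∀ b : 𝔸, ‖b - a‖ * C ≤ 1 → ∀ z ∈ K,
      z ∈ resolventSet ℂ b ∧ ‖resolvent b z - resolvent a z‖ ≤ C ^ 2 * ‖b - a‖ := by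
  obtain ⟨C, hC⟩ := hK.exists_bound_of_continuousOn ((continuousOn_resolvent a).mono ha)
  -- The factor 2 makes the Neumann series of `1 - resolvent a z * (b - a)` converge with ratio at
  -- most 1/2, so the perturbed resolvent is at most twice as large; the maximum with 1 keeps the
  -- constant positive.
  refine ⟨2 * max C 1, by positivity, fun b hb z hz => ?_⟩
  have hC1 : ‖resolvent a z‖ ≤ max C 1 := (hC z hz).trans (le_max_left _ _)
  have hM : 0 < max C 1 := by positivity
  have hsmall : ‖resolvent a z * (b - a)‖ < 1 := by
    refine (norm_mul_le _ _).trans_lt ?_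
    calc ‖resolvent a z‖ * ‖b - a‖ ≤ max C 1 * ‖b - a‖ := by gcongr
      _ < 1 := by nlinarith [norm_nonneg (b - a)]
  have h2 : (algebraMap ℂ 𝔸 z - a) * resolvent a z = 1 := Ring.mul_inverse_cancel _ (ha hz)
  have hzb : z ∈ resolventSet ℂ b := by
    have hu : IsUnit (1 - resolvent a z * (b - a)) := isUnit_one_sub_of_norm_lt_one hsmall
    have := (spectrum.mem_resolventSet_iff.1 (ha hz)).mul hu
    rw [spectrum.mem_resolventSet_iff]
    convert this using 1
    rw [mul_sub, ← mul_assoc, h2]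
    noncomm_ring
  refine ⟨hzb, ?_⟩
  have hid : resolvent b z - resolvent a z = resolvent a z * (b - a) * resolvent b z := by
    have h3 : resolvent a z * (algebraMap ℂ 𝔸 z - a) = 1 := Ring.inverse_mul_cancel _ (ha hz)
    have h4 : (algebraMap ℂ 𝔸 z - b) * resolvent b z = 1 := Ring.mul_inverse_cancel _ hzb
    calc resolvent b z - resolvent a z
        = (resolvent a z * (algebraMap ℂ 𝔸 z - a)) * resolvent b z
          - resolvent a z * ((algebraMap ℂ 𝔸 z - b) * resolvent b z) := by
            rw [h3, h4, one_mul, mul_one]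
      _ = _ := by noncomm_ring
  have hle : ‖resolvent b z - resolvent a z‖ ≤ max C 1 * ‖b - a‖ * ‖resolvent b z‖ := by
    rw [hid]
    refine (norm_mul_le _ _).trans ?_
    gcongr
    refine (norm_mul_le _ _).trans ?_
    gcongr
  have hb2 : ‖resolvent b z‖ ≤ 2 * max C 1 := by
    have h5 : ‖resolvent b z‖ ≤ ‖resolvent b z - resolvent a z‖ + ‖resolvent a z‖ :=
      norm_le_norm_sub_add _ _
    nlinarith [norm_nonneg (resolvent b z), norm_nonneg (b - a)]
  calc _ ≤ max C 1 * ‖b - a‖ * ‖resolvent b z‖ := hle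
    _ ≤ max C 1 * ‖b - a‖ * (2 * max C 1) := by gcongr
    _ ≤ _ := by nlinarith [norm_nonneg (b - a), mul_nonneg (sq_nonneg (max C 1)) (norm_nonneg (b - a))]

lemma norm_rieszProj_sub_le {b : 𝔸} (hr : 0 ≤ r) (ha : Metric.sphere c r ⊆ resolventSet ℂ a)
    (hb : Metric.sphere c r ⊆ resolventSet ℂ b) {C : ℝ}
    (hC : ∀ z ∈ Metric.sphere c r, ‖resolvent b z - resolvent a z‖ ≤ C) :
    ‖rieszProj b c r - rieszProj a c r‖ ≤ r * C := by
  unfold rieszProj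
  rw [← smul_sub, ← circleIntegral.integral_sub (circleIntegrable_resolvent hr hb)
    (circleIntegrable_resolvent hr ha)]
  exact circleIntegral.norm_two_pi_i_inv_smul_integral_le_of_norm_le_const hr hC

end BanachAlgebra

end

section

set_option linter.unusedSectionVars false

/-! ### Spectral projections of compact operators -/

section Operators

variable {X : Type*} [NormedAddCommGroup X] [NormedSpace ℂ X]

open Module End

/-- For a compact operator only finitely many eigenvalues are bounded away from zero. -/
lemma finite_eigenvalues_of_compact {A : X →L[ℂ] X} (hA : IsCompactOperator A) {ε : ℝ}
    (hε : 0 < ε) : {ν : ℂ | HasEigenvalue (A : End ℂ X) ν ∧ ε ≤ ‖ν‖}.Finite := by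
  by_contra hinf
  let e := Set.Infinite.natEmbedding _ hinf
  have hev : ∀ n, HasEigenvalue (A : End ℂ X) (e n : ℂ) := fun n => (e n).2.1
  have hne : ∀ n, ε ≤ ‖(e n : ℂ)‖ := fun n => (e n).2.2
  have he : Function.Injective fun n => (e n : ℂ) := Subtype.val_injective.comp e.injective
  choose x hx using fun n => (hev n).exists_hasEigenvector
  have hlin : LinearIndependent ℂ x := eigenvectors_linearIndependent' _ _ he x hx
  let V (n : ℕ) : Submodule ℂ X := Submodule.span ℂ (x '' Set.Iio n)
  have hVmono : ∀ {m n}, m ≤ n → V m ≤ V n := fun {m n} h =>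
    Submodule.span_mono (Set.image_mono (Set.Iio_subset_Iio h))
  have hVfin : ∀ n, FiniteDimensional ℂ (V n) := fun n =>
    FiniteDimensional.span_of_finite ℂ ((Set.finite_Iio n).image x)
  have hxV : ∀ n, x n ∈ V (n + 1) := fun n => Submodule.subset_span ⟨n, by simp, rfl⟩
  have hxV' : ∀ n, x n ∉ V n := fun n => hlin.notMem_span_image (by simp)
  have hAx : ∀ n, A (x n) = (e n : ℂ) • x n := fun n => (hx n).apply_eq_smul
  have hVA : ∀ n, ∀ y ∈ V n, A y ∈ V n := by
    intro n y hy
    refine Submodule.span_induction (p := fun y _ => A y ∈ V n) ?_ ?_ ?_ ?_ hy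
    · rintro _ ⟨i, hi, rfl⟩
      rw [hAx]
      exact Submodule.smul_mem _ _ (Submodule.subset_span ⟨i, hi, rfl⟩)
    · simp
    · intro y z _ _ h1 h2
      rw [map_add]; exact Submodule.add_mem _ h1 h2
    · intro a y _ h1
      rw [map_smul]; exact Submodule.smul_mem _ _ h1
  have hVA' : ∀ n, ∀ y ∈ V (n + 1), A y - (e n : ℂ) • y ∈ V n := by
    intro n y hy
    refine Submodule.span_induction (p := fun y _ => A y - (e n : ℂ) • y ∈ V n) ?_ ?_ ?_ ?_ hy
    · rintro _ ⟨i, hi, rfl⟩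
      rcases (Nat.lt_succ_iff_lt_or_eq.1 hi) with h | rfl
      · have : x i ∈ V n := Submodule.subset_span ⟨i, h, rfl⟩
        exact Submodule.sub_mem _ (hVA _ _ this) (Submodule.smul_mem _ _ this)
      · rw [hAx, sub_self]; exact Submodule.zero_mem _
    · simp
    · intro y z _ _ h1 h2
      have := Submodule.add_mem _ h1 h2
      convert this using 1
      rw [map_add, smul_add]; abel
    · intro a y _ h1
      have := Submodule.smul_mem _ a h1
      convert this using 1
      rw [map_smul, smul_sub, smul_comm]
  -- Riesz's lemma in the flag spanned by the eigenvectors: nearly orthogonal bounded vectors, one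
  -- for each step of the flag.
  have key : ∀ n, ∃ y ∈ V (n + 1), ‖y‖ ≤ 3 ∧ ∀ w ∈ V n, 1 ≤ ‖y - w‖ := by
    intro n
    have h₁ : IsClosed ((V n).comap (V (n + 1)).subtype : Set (V (n + 1))) := by
      have := hVfin n
      exact (Submodule.closed_of_finiteDimensional (V n)).preimage continuous_subtype_val
    obtain ⟨⟨y, hy⟩, hyn, hyw⟩ := riesz_lemma_of_norm_lt (c := (2 : ℂ)) (R := 3) (by simp)
      (by simp; norm_num) h₁ ⟨⟨x n, hxV n⟩, by simpa using hxV' n⟩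
    exact ⟨y, hy, hyn, fun w hw => hyw ⟨w, hVmono (Nat.le_succ n) hw⟩ hw⟩
  choose y hyV hy3 hyd using key
  obtain ⟨K, hK, hK'⟩ := hA.image_closedBall_subset_compact (3 : ℝ)
  obtain ⟨z, _, ψ, hψ, hψz⟩ := hK.tendsto_subseq (x := fun n => A (y n))
    fun n => hK' ⟨y n, by simpa using hy3 n, rfl⟩
  -- Modulo `V n`, the image of `y n` is `e n • y n` and the image of `y m` is zero, so the images
  -- stay at distance at least ε and have no convergent subsequence.
  have hsep : ∀ m n, m < n → ε ≤ ‖A (y n) - A (y m)‖ := by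
    intro m n hmn
    have hν : (e n : ℂ) ≠ 0 := norm_pos_iff.1 (hε.trans_le (hne n))
    have hw : A (y m) - (A (y n) - (e n : ℂ) • y n) ∈ V n :=
      Submodule.sub_mem _ (hVmono hmn (hVA _ _ (hyV m))) (hVA' n _ (hyV n))
    have h1 := hyd n _ (Submodule.smul_mem _ (e n : ℂ)⁻¹ hw)
    have h2 : A (y n) - A (y m) = (e n : ℂ) • (y n - (e n : ℂ)⁻¹ •
        (A (y m) - (A (y n) - (e n : ℂ) • y n))) := by
      rw [smul_sub, smul_inv_smul₀ hν]; abel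
    rw [h2, norm_smul]
    calc ε ≤ ‖(e n : ℂ)‖ * 1 := by rw [mul_one]; exact hne n
      _ ≤ _ := by gcongr
  obtain ⟨N, hN⟩ := Metric.cauchySeq_iff'.1 hψz.cauchySeq ε hε
  have := hN (N + 1) (Nat.le_succ N)
  rw [dist_eq_norm] at this
  exact absurd this (not_lt.2 (hsep _ _ (hψ (Nat.lt_succ_self N))))

/-- The sum of the generalised eigenspaces for the eigenvalues in `S`. -/
def genSpace (A : X →L[ℂ] X) (S : Set ℂ) : Submodule ℂ X :=
  ⨆ ν ∈ S, maxGenEigenspace (A : End ℂ X) ν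

lemma genSpace_singleton (A : X →L[ℂ] X) (ν : ℂ) :
    genSpace A {ν} = maxGenEigenspace (A : End ℂ X) ν := by
  simp [genSpace]

variable [CompleteSpace X]

/-- Nonzero points of the spectrum of a compact operator are isolated. -/
lemma exists_isolating_radius {A : X →L[ℂ] X} (hA : IsCompactOperator A) {lam : ℂ}
    (hlam : lam ≠ 0) : ∃ R > 0, R < ‖lam‖ ∧
      ∀ z ∈ Metric.closedBall lam R, z ∈ spectrum ℂ A → z = lam := by
  have hfin := (finite_eigenvalues_of_compact hA (half_pos (norm_pos_iff.2 hlam))).subset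
    (Set.sdiff_subset (t := {lam}))
  have hopen := hfin.isClosed.isOpen_compl.mem_nhds (x := lam) (by simp)
  obtain ⟨δ, hδ, hball⟩ := Metric.mem_nhds_iff.1 hopen
  refine ⟨min (δ / 2) (‖lam‖ / 2), by positivity, ?_, fun z hz hs => ?_⟩
  · exact (min_le_right _ _).trans_lt (half_lt_self (norm_pos_iff.2 hlam))
  · rw [Metric.mem_closedBall] at hz
    have h1 : dist z lam < δ := by linarith [min_le_left (δ / 2) (‖lam‖ / 2)]
    have h2 : ‖lam‖ / 2 ≤ ‖z‖ := by
      have := norm_sub_norm_le lam z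
      rw [← dist_eq_norm, dist_comm] at this
      linarith [min_le_right (δ / 2) (‖lam‖ / 2)]
    have hz0 : z ≠ 0 := norm_pos_iff.1 ((half_pos (norm_pos_iff.2 hlam)).trans_le h2)
    by_contra hne
    exact hball h1 ⟨⟨(hA.hasEigenvalue_iff_mem_spectrum hz0).2 hs, h2⟩, hne⟩

/-- The circle `|z - c| = r` isolates a part of the nonzero spectrum of the compact operator `A`. -/
structure Isolates (A : X →L[ℂ] X) (c : ℂ) (r R : ℝ) : Prop where
  compact : IsCompactOperator A
  pos : 0 < r
  lt : r < R
  zero_notMem : (0 : ℂ) ∉ Metric.closedBall c r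
  subset : annulus c r R ⊆ resolventSet ℂ A

variable {A : X →L[ℂ] X} {c : ℂ} {r R : ℝ}

namespace Isolates

lemma sphere_subset (h : Isolates A c r R) : Metric.sphere c r ⊆ resolventSet ℂ A :=
  (sphere_subset_annulus h.lt.le).trans h.subset

lemma proj_proj (h : Isolates A c r R) (x : X) :
    rieszProj A c r (rieszProj A c r x) = rieszProj A c r x :=
  congrArg (fun B : X →L[ℂ] X => B x) (rieszProj_mul_self h.pos h.lt h.subset)

lemma proj_comm (h : Isolates A c r R) (x : X) :
    A (rieszProj A c r x) = rieszProj A c r (A x) :=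
  congrArg (fun B : X →L[ℂ] X => B x) (commute_rieszProj h.pos.le h.sphere_subset)

lemma resolvent_apply_eigenvector {z ν : ℂ} {u : X} (hz : z ∈ resolventSet ℂ A)
    (hu : A u = ν • u) (hzν : z ≠ ν) : resolvent A z u = (z - ν)⁻¹ • u := by
  have h1 : resolvent A z * (algebraMap ℂ (X →L[ℂ] X) z - A) = 1 :=
    Ring.inverse_mul_cancel _ hz
  have h2 : resolvent A z ((algebraMap ℂ (X →L[ℂ] X) z - A) u) = u :=
    congrArg (fun B : X →L[ℂ] X => B u) h1
  have h3 : (algebraMap ℂ (X →L[ℂ] X) z - A) u = (z - ν) • u := by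
    rw [sub_smul, ← hu, Algebra.algebraMap_eq_smul_one]
    rfl
  rw [h3, map_smul] at h2
  rw [← h2, smul_smul, inv_mul_cancel₀ (sub_ne_zero.2 hzν), one_smul, h2]

lemma eigenvalue_notMem {ν : ℂ} {u : X} (hν : ν ∈ resolventSet ℂ A) (hu : A u = ν • u) :
    u = 0 := by
  have h1 : resolvent A ν * (algebraMap ℂ (X →L[ℂ] X) ν - A) = 1 :=
    Ring.inverse_mul_cancel _ hν
  have h2 : resolvent A ν ((algebraMap ℂ (X →L[ℂ] X) ν - A) u) = u :=
    congrArg (fun B : X →L[ℂ] X => B u) h1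
  have h3 : (algebraMap ℂ (X →L[ℂ] X) ν - A) u = 0 := by
    rw [sub_apply, hu, Algebra.algebraMap_eq_smul_one]
    simp
  rw [← h2, h3, map_zero]

lemma circleIntegral_apply {f : ℂ → X →L[ℂ] X} (hf : CircleIntegrable f c r) (u : X) :
    (∮ z in C(c, r), f z) u = ∮ z in C(c, r), f z u := by
  simp only [circleIntegral]
  rw [ContinuousLinearMap.intervalIntegral_apply hf.out]
  rfl

/-- The resolvent acts on an eigenvector as the scalar (z − ν)⁻¹, so the projection multiplies it by
the winding number of the circle about ν; this is 1 inside and 0 outside. -/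
lemma proj_eigenvector (h : Isolates A c r R) {ν : ℂ} {u : X} (hu : A u = ν • u)
    (hν : ν ∉ Metric.sphere c r) :
    rieszProj A c r u = ((2 * Real.pi * Complex.I : ℂ)⁻¹ * ∮ z in C(c, r), (z - ν)⁻¹) • u := by
  rw [rieszProj, smul_apply,
    circleIntegral_apply (circleIntegrable_resolvent h.pos.le h.sphere_subset), mul_smul,
    ← circleIntegral.integral_smul_const]
  congr 1
  refine circleIntegral.integral_congr h.pos.le fun z hz => ?_
  refine resolvent_apply_eigenvector (h.sphere_subset hz) hu ?_
  rintro rfl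
  exact hν hz

lemma proj_eigenvector_of_mem (h : Isolates A c r R) {ν : ℂ} {u : X} (hu : A u = ν • u)
    (hν : ν ∈ Metric.closedBall c r) : rieszProj A c r u = u := by
  by_cases hs : ν ∈ Metric.sphere c r
  · rw [eigenvalue_notMem (h.sphere_subset hs) hu, map_zero]
  · have hb : ν ∈ Metric.ball c r := by
      rw [Metric.mem_ball]
      exact lt_of_le_of_ne hν hs
    rw [h.proj_eigenvector hu hs, circleIntegral.integral_sub_inv_of_mem_ball hb,
      inv_mul_cancel₀ two_pi_I_ne_zero, one_smul]

lemma proj_eigenvector_of_notMem (h : Isolates A c r R) {ν : ℂ} {u : X} (hu : A u = ν • u)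
    (hν : ν ∉ Metric.closedBall c r) : rieszProj A c r u = 0 := by
  rw [h.proj_eigenvector hu fun hs => hν (Metric.sphere_subset_closedBall hs)]
  have hne : ∀ z ∈ Metric.closedBall c r, z - ν ≠ 0 := by
    intro z hz h0
    rw [sub_eq_zero] at h0
    exact hν (h0 ▸ hz)
  have hz0 : (∮ z in C(c, r), (z - ν)⁻¹) = 0 :=
    Complex.circleIntegral_eq_zero_of_differentiable_on_off_countable h.pos.le
      Set.countable_empty ((continuousOn_id.sub continuousOn_const).inv₀ hne) fun z hz =>
      ((differentiableAt_id).sub (differentiableAt_const _)).inv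
        (hne z (Metric.ball_subset_closedBall hz.1))
  rw [hz0, mul_zero, zero_smul]

lemma proj_pow_comm (h : Isolates A c r R) (ν : ℂ) (k : ℕ) (x : X) :
    (((A : End ℂ X) - ν • (1 : End ℂ X)) ^ k) (rieszProj A c r x) =
      rieszProj A c r ((((A : End ℂ X) - ν • (1 : End ℂ X)) ^ k) x) := by
  induction k generalizing x with
  | zero => simp
  | succ k ih =>
    rw [pow_succ, End.mul_apply, End.mul_apply, ← ih]
    congr 1
    simp [h.proj_comm]

/-- The defect d = u − Pu is annihilated by P and by some power of A − ν. The last nonzero iterate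
of A − ν on d would be an eigenvector, hence fixed by P; but P commutes with A and kills d, so there
is no such iterate. -/
lemma proj_of_mem_maxGenEigenspace (h : Isolates A c r R) {ν : ℂ}
    (hν : ν ∈ Metric.closedBall c r) {u : X} (hu : u ∈ maxGenEigenspace (A : End ℂ X) ν) :
    rieszProj A c r u = u := by
  rw [mem_maxGenEigenspace] at hu
  obtain ⟨k, hk⟩ := hu
  have main : ∀ k, (((A : End ℂ X) - ν • (1 : End ℂ X)) ^ k) (u - rieszProj A c r u) = 0 →
      u - rieszProj A c r u = 0 := by
    intro k
    induction k with
    | zero => simp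
    | succ k ih =>
      intro hk
      refine ih ?_
      set w := (((A : End ℂ X) - ν • (1 : End ℂ X)) ^ k) (u - rieszProj A c r u) with hw
      have h1 : A w = ν • w := by
        rw [pow_succ', End.mul_apply, ← hw] at hk
        simpa [sub_eq_zero] using hk
      rw [← h.proj_eigenvector_of_mem h1 hν, hw, ← h.proj_pow_comm, map_sub, h.proj_proj,
        sub_self, map_zero]
  refine (sub_eq_zero.1 (main k ?_)).symm
  rw [map_sub, h.proj_pow_comm, hk, map_zero, sub_zero]

/-- Integrate R(z) = z⁻¹ + A z⁻¹R(z): the first term gives zero because 0 is outside the disc. The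
resulting factor A transfers compactness to the projection. -/
lemma proj_eq_comp (h : Isolates A c r R) :
    rieszProj A c r = A ∘L ((2 * Real.pi * Complex.I : ℂ)⁻¹ •
      ∮ z in C(c, r), z⁻¹ • resolvent A z) := by
  have hne : ∀ z ∈ Metric.closedBall c r, z ≠ 0 := fun z hz h0 => h.zero_notMem (h0 ▸ hz)
  have hcont : ContinuousOn (fun z : ℂ => z⁻¹) (Metric.closedBall c r) :=
    continuousOn_id.inv₀ hne
  have hcont' := hcont.mono (Metric.sphere_subset_closedBall (x := c) (ε := r))
  have hz0 : (∮ z in C(c, r), z⁻¹) = 0 :=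
    Complex.circleIntegral_eq_zero_of_differentiable_on_off_countable h.pos.le
      Set.countable_empty hcont fun z hz =>
      differentiableAt_id.inv (hne z (Metric.ball_subset_closedBall hz.1))
  have hint : CircleIntegrable (fun z => z⁻¹ • resolvent A z) c r :=
    (hcont'.smul ((continuousOn_resolvent A).mono h.sphere_subset)).circleIntegrable h.pos.le
  change _ = A * _
  rw [mul_smul_comm, circleIntegral_mul_left _ hint, rieszProj]
  congr 1
  have h1 : ∀ z ∈ Metric.sphere c r, resolvent A z =
      z⁻¹ • (1 : X →L[ℂ] X) + A * (z⁻¹ • resolvent A z) := by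
    intro z hz
    have h2 : (algebraMap ℂ (X →L[ℂ] X) z - A) * resolvent A z = 1 :=
      Ring.mul_inverse_cancel _ (h.sphere_subset hz)
    rw [sub_mul, Algebra.algebraMap_eq_smul_one, smul_mul_assoc, one_mul] at h2
    rw [mul_smul_comm, ← smul_add, ← h2, sub_add_cancel, smul_smul,
      inv_mul_cancel₀ (hne z (Metric.sphere_subset_closedBall hz)), one_smul]
  rw [circleIntegral.integral_congr h.pos.le h1, circleIntegral.integral_add,
    circleIntegral.integral_smul_const, hz0, zero_smul, zero_add]
  · exact (hcont'.smul continuousOn_const).circleIntegrable h.pos.le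
  · exact (continuousOn_const.mul
      (hcont'.smul ((continuousOn_resolvent A).mono h.sphere_subset))).circleIntegrable h.pos.le

lemma mem_range_iff (h : Isolates A c r R) {x : X} :
    x ∈ (rieszProj A c r).range ↔ rieszProj A c r x = x := by
  constructor
  · rintro ⟨y, rfl⟩
    exact h.proj_proj y
  · exact fun hx => ⟨x, hx⟩

/-- On its closed range the compact projection is the identity, and a space with compact identity is
finite-dimensional. -/
lemma finiteDimensional_range (h : Isolates A c r R) :
    FiniteDimensional ℂ (rieszProj A c r).range := by
  have hclosed : IsClosed ((rieszProj A c r).range : Set X) := by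
    have : ((rieszProj A c r).range : Set X) = {x | rieszProj A c r x = x} := by
      ext x; exact h.mem_range_iff
    rw [this]
    exact isClosed_eq (rieszProj A c r).continuous continuous_id
  have hcomp : IsCompactOperator (rieszProj A c r : X →L[ℂ] X) := by
    rw [h.proj_eq_comp]
    exact h.compact.comp_clm _
  have hcomp' := hcomp.comp_clm (rieszProj A c r).range.subtypeL
  have := hcomp'.codRestrict (V := (rieszProj A c r).range) (fun x => ⟨x, rfl⟩) hclosed
  refine FiniteDimensional.of_isCompactOperator_id (𝕜 := ℂ) ?_
  have heq : Set.codRestrict ((rieszProj A c r : X →L[ℂ] X) ∘ (rieszProj A c r).range.subtypeL)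
      (rieszProj A c r).range (fun x => ⟨x, rfl⟩) = id :=
    funext fun x => Subtype.ext ((h.mem_range_iff).1 x.2)
  exact heq ▸ this

/-- The range is invariant and finite-dimensional, so it is the sum of the generalised eigenspaces
of the restriction of A. Eigenvalues outside the disc do not contribute, because the projection
would kill an eigenvector that it should fix. -/
lemma genSpace_eq (h : Isolates A c r R) :
    genSpace A (Metric.closedBall c r) = (rieszProj A c r).range := by
  apply le_antisymm
  · refine iSup₂_le fun ν hν x hx => ?_
    exact h.mem_range_iff.2 (h.proj_of_mem_maxGenEigenspace hν hx)
  · have hfin := h.finiteDimensional_range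
    have hinv : ∀ x ∈ (rieszProj A c r).range, (A : End ℂ X) x ∈ (rieszProj A c r).range := by
      rintro _ ⟨y, rfl⟩
      exact ⟨A y, (h.proj_comm y).symm⟩
    let B : End ℂ (rieszProj A c r).range := (A : End ℂ X).restrict hinv
    have htop := Module.End.iSup_maxGenEigenspace_eq_top B
    have hmap : ∀ ν, (maxGenEigenspace B ν).map (rieszProj A c r).range.subtype ≤
        genSpace A (Metric.closedBall c r) := by
      intro ν
      by_cases hν : ν ∈ Metric.closedBall c r
      · refine le_trans ?_ (le_iSup₂_of_le ν hν le_rfl)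
        rintro _ ⟨x, hx, rfl⟩
        have := Module.End.genEigenspace_restrict (A : End ℂ X) (rieszProj A c r).range ⊤ ν hinv
        change x ∈ genEigenspace B ν ⊤ at hx
        rw [this] at hx
        exact hx
      · have : maxGenEigenspace B ν = ⊥ := by
          by_contra hne
          have hev : HasEigenvalue B ν :=
            (hasUnifEigenvalue_iff_hasUnifEigenvalue_one (k := ⊤) (by simp)).1 hne
          obtain ⟨⟨x, hxU⟩, hx⟩ := hev.exists_hasEigenvector
          have h1 : A x = ν • x := congrArg Subtype.val hx.apply_eq_smul
          apply hx.2
          have h2 := h.proj_eigenvector_of_notMem h1 hν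
          rw [h.mem_range_iff.1 hxU] at h2
          exact Subtype.ext h2
        rw [this, Submodule.map_bot]
        exact bot_le
    calc (rieszProj A c r).range = (⊤ : Submodule ℂ (rieszProj A c r).range).map
          (rieszProj A c r).range.subtype := by simp
      _ ≤ _ := by
        rw [← htop, Submodule.map_iSup]
        exact iSup_le hmap

end Isolates

end Operators

end

/-! ### Perturbation of isolated eigenvalues by finite rank projections -/

section

set_option linter.unusedSectionVars false

section Perturbation

variable {X : Type*} [NormedAddCommGroup X] [NormedSpace ℂ X]

open Module End

lemma infDist_le_of_mem {F : Submodule ℂ X} {x y : X} (hy : y ∈ F) :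
    Metric.infDist x (F : Set X) ≤ ‖x - y‖ := by
  rw [← dist_eq_norm]
  exact Metric.infDist_le_dist_of_mem hy

/-- The gap of two subspaces is at most the distance of two projections onto them. -/
lemma gap_le_of_proj {E F : Submodule ℂ X} {P Q : X →L[ℂ] X} (hP : ∀ x ∈ E, P x = x)
    (hP' : ∀ x, P x ∈ E) (hQ : ∀ x ∈ F, Q x = x) (hQ' : ∀ x, Q x ∈ F) :
    gap E F ≤ ‖Q - P‖ := by
  refine max_le (Real.sSup_le ?_ (norm_nonneg _)) (Real.sSup_le ?_ (norm_nonneg _))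
  · rintro _ ⟨e, ⟨he, h1⟩, rfl⟩
    refine (infDist_le_of_mem (hQ' e)).trans ?_
    calc ‖e - Q e‖ = ‖(Q - P) e‖ := by rw [sub_apply, hP e he, norm_sub_rev]
      _ ≤ ‖Q - P‖ * ‖e‖ := (Q - P).le_opNorm e
      _ = _ := by rw [h1, mul_one]
  · rintro _ ⟨e, ⟨he, h1⟩, rfl⟩
    refine (infDist_le_of_mem (hP' e)).trans ?_
    calc ‖e - P e‖ = ‖(Q - P) e‖ := by rw [sub_apply, hQ e he]
      _ ≤ ‖Q - P‖ * ‖e‖ := (Q - P).le_opNorm e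
      _ = _ := by rw [h1, mul_one]

lemma gap_nonneg (E F : Submodule ℂ X) : 0 ≤ gap E F := by
  refine le_max_of_le_left (Real.sSup_nonneg ?_)
  rintro _ ⟨e, _, rfl⟩
  exact Metric.infDist_nonneg

/-- Q is injective on E: if Qx = 0 for some x in E, then ‖x‖ = ‖(Q − P)x‖, which is smaller than ‖x‖
unless x = 0. -/
lemma finrank_le_of_proj {E F : Submodule ℂ X} [FiniteDimensional ℂ F] {P Q : X →L[ℂ] X}
    (hP : ∀ x ∈ E, P x = x) (hQ' : ∀ x, Q x ∈ F) (h : ‖Q - P‖ < 1) :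
    finrank ℂ E ≤ finrank ℂ F := by
  let T : E →ₗ[ℂ] F := ((Q : X →ₗ[ℂ] X).comp E.subtype).codRestrict F fun x => hQ' x
  refine LinearMap.finrank_le_finrank_of_injective (f := T) ?_
  rw [← LinearMap.ker_eq_bot, LinearMap.ker_eq_bot']
  rintro ⟨x, hx⟩ hT
  have h0 : Q x = 0 := congrArg Subtype.val hT
  have h1 : ‖x‖ ≤ ‖Q - P‖ * ‖x‖ := by
    calc ‖x‖ = ‖(Q - P) x‖ := by rw [sub_apply, h0, hP x hx, zero_sub, norm_neg]
      _ ≤ _ := (Q - P).le_opNorm x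
  have : ‖x‖ = 0 := by
    by_contra hne
    have : 0 < ‖x‖ := lt_of_le_of_ne (norm_nonneg _) (Ne.symm hne)
    nlinarith
  exact Subtype.ext (norm_eq_zero.1 this)

/-- For a nonzero `ν` the compression `Q A Q` and `Q A` have the same generalised eigenvectors. -/
lemma maxGenEigenspace_compression {A Q : X →L[ℂ] X} (hQ : Q * Q = Q) {ν : ℂ} (hν : ν ≠ 0) :
    maxGenEigenspace ((Q * A * Q : X →L[ℂ] X) : End ℂ X) ν =
      maxGenEigenspace ((Q * A : X →L[ℂ] X) : End ℂ X) ν := by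
  have hQx : ∀ x, Q (Q x) = Q x := fun x => congrArg (fun B : X →L[ℂ] X => B x) hQ
  -- Generalised eigenvectors for nonzero ν lie in the range of Q: if Q fixes (QB − ν)x, then it
  -- fixes νx, because it fixes QBx.
  have mem : ∀ (B : X →L[ℂ] X), ∀ k x,
      ((((Q * B : X →L[ℂ] X) : End ℂ X) - ν • (1 : End ℂ X)) ^ k) x = 0 → Q x = x := by
    intro B k
    induction k with
    | zero => intro x hx; simp at hx; simp [hx]
    | succ k ih =>
      intro x hx
      rw [pow_succ, End.mul_apply] at hx
      have h1 := ih _ hx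
      simp only [LinearMap.sub_apply, ContinuousLinearMap.coe_coe, LinearMap.smul_apply,
        End.one_apply, mul_apply_eq_comp, map_sub, map_smul, hQx] at h1
      have h2 : ν • (Q x - x) = 0 := by
        rw [smul_sub, sub_eq_zero]
        exact sub_right_injective h1
      rcases smul_eq_zero.1 h2 with h | h
      · exact absurd h hν
      · exact sub_eq_zero.1 h
  have pow_eq : ∀ k x, Q x = x →
      ((((Q * A * Q : X →L[ℂ] X) : End ℂ X) - ν • (1 : End ℂ X)) ^ k) x =
        ((((Q * A : X →L[ℂ] X) : End ℂ X) - ν • (1 : End ℂ X)) ^ k) x := by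
    intro k
    induction k with
    | zero => simp
    | succ k ih =>
      intro x hx
      rw [pow_succ, End.mul_apply, pow_succ, End.mul_apply]
      have h1 : (((Q * A * Q : X →L[ℂ] X) : End ℂ X) - ν • (1 : End ℂ X)) x =
          (((Q * A : X →L[ℂ] X) : End ℂ X) - ν • (1 : End ℂ X)) x := by
        simp [hx]
      rw [h1]
      refine ih _ ?_
      simp [hQx, hx]
  ext x
  simp only [mem_maxGenEigenspace]
  constructor
  · rintro ⟨k, hk⟩
    exact ⟨k, by rw [← pow_eq k x (mem (A * Q) k x (by rw [← mul_assoc]; exact hk))]; exact hk⟩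
  · rintro ⟨k, hk⟩
    exact ⟨k, by rw [pow_eq k x (mem A k x hk)]; exact hk⟩

lemma genSpace_compression {A Q : X →L[ℂ] X} (hQ : Q * Q = Q) {S : Set ℂ} (hS : (0 : ℂ) ∉ S) :
    genSpace (Q * A * Q) S = genSpace (Q * A) S := by
  unfold genSpace
  refine iSup_congr fun ν => iSup_congr fun hν => maxGenEigenspace_compression hQ ?_
  rintro rfl
  exact hS hν

variable [CompleteSpace X]

lemma exists_norm_pow_sub_le (A : X →L[ℂ] X) (lam : ℂ) (m : ℕ) :
    ∃ C > 0, ∀ B : X →L[ℂ] X, ‖B - A‖ ≤ 1 →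
      ‖(B - lam • 1) ^ m - (A - lam • 1) ^ m‖ ≤ C * ‖B - A‖ := by
  induction m with
  | zero => exact ⟨1, one_pos, fun B _ => by simp⟩
  | succ m ih =>
    obtain ⟨C, hC, h⟩ := ih
    refine ⟨C * (‖A - lam • 1‖ + 1) + ‖(A - lam • 1) ^ m‖, by positivity, fun B hB => ?_⟩
    have h1 : (B - lam • 1) ^ (m + 1) - (A - lam • 1) ^ (m + 1) =
        ((B - lam • 1) ^ m - (A - lam • 1) ^ m) * (B - lam • 1) +
          (A - lam • 1) ^ m * (B - A) := by
      rw [← sub_sub_sub_cancel_right B A (lam • 1), pow_succ, pow_succ]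
      generalize B - lam • 1 = b
      generalize A - lam • 1 = a
      noncomm_ring
    have h2 : ‖B - lam • 1‖ ≤ ‖A - lam • 1‖ + 1 := by
      calc ‖B - lam • 1‖ = ‖(A - lam • 1) + (B - A)‖ := by congr 1; abel
        _ ≤ _ := (norm_add_le _ _).trans (by gcongr)
    rw [h1]
    calc _ ≤ ‖(B - lam • 1) ^ m - (A - lam • 1) ^ m‖ * ‖B - lam • 1‖ +
          ‖(A - lam • 1) ^ m‖ * ‖B - A‖ :=
          (norm_add_le _ _).trans (add_le_add (norm_mul_le _ _) (norm_mul_le _ _))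
      _ ≤ (C * ‖B - A‖) * (‖A - lam • 1‖ + 1) + ‖(A - lam • 1) ^ m‖ * ‖B - A‖ := by
          gcongr
          exact h B hB
      _ = _ := by ring

/-- A compact operator `A` and finite rank projections `Q n` such that `Q n A` approximates `A` with
error `O(ε n)`. -/
structure Approximates (A : X →L[ℂ] X) (Q : ℕ → X →L[ℂ] X) (ε : ℕ → ℝ) : Prop where
  idem : ∀ n, Q n * Q n = Q n
  finite : ∀ n, FiniteDimensional ℂ (Q n).range
  bound : ∃ C, ∀ n, ‖Q n * A - A‖ ≤ C * ε n
  tendsto : Tendsto ε atTop (𝓝 0)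

namespace Approximates

variable {A : X →L[ℂ] X} {Q : ℕ → X →L[ℂ] X} {ε : ℕ → ℝ}

lemma isCompactOperator_of_finite_range {B : X →L[ℂ] X} (hB : FiniteDimensional ℂ B.range)
    (A : X →L[ℂ] X) : IsCompactOperator (B * A : X →L[ℂ] X) := by
  have : ProperSpace B.range := FiniteDimensional.proper ℂ _
  have h1 : IsCompactOperator (B.range.subtypeL) :=
    isCompactOperator_of_locallyCompactSpace_rng _
  have h2 := h1.comp_clm ((B ∘L A).codRestrict B.range fun x => ⟨A x, rfl⟩)
  exact h2

lemma compact_mul (h : Approximates A Q ε) (n : ℕ) : IsCompactOperator (Q n * A : X →L[ℂ] X) :=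
  isCompactOperator_of_finite_range (h.finite n) A

lemma tendsto_norm (h : Approximates A Q ε) : Tendsto (fun n => ‖Q n * A - A‖) atTop (𝓝 0) := by
  obtain ⟨C, hC⟩ := h.bound
  refine squeeze_zero (fun n => norm_nonneg _) hC ?_
  simpa using h.tendsto.const_mul C

lemma compact (h : Approximates A Q ε) : IsCompactOperator A :=
  isCompactOperator_of_tendsto (tendsto_iff_norm_sub_tendsto_zero.2 h.tendsto_norm)
    (Eventually.of_forall h.compact_mul)

variable {lam : ℂ} {r R : ℝ}

/-- On the compact annulus the resolvents converge uniformly. Hence the annulus stays free of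
spectrum with the same radii, and integration over the circle compares the projections. -/
lemma eventually_isolates (h : Approximates A Q ε) (hI : Isolates A lam r R) :
    ∃ C, ∀ᶠ n in atTop, Isolates (Q n * A) lam r R ∧
      ‖rieszProj (Q n * A) lam r - rieszProj A lam r‖ ≤ C * ‖Q n * A - A‖ := by
  obtain ⟨C, hC, hb⟩ := exists_resolvent_bound (isCompact_annulus lam r R) hI.subset
  refine ⟨r * C ^ 2, ?_⟩
  have hev : ∀ᶠ n in atTop, ‖Q n * A - A‖ * C < 1 :=
    (h.tendsto_norm.mul_const C).eventually_lt_const (by simp)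
  filter_upwards [hev] with n hn
  have hIn : Isolates (Q n * A) lam r R :=
    ⟨h.compact_mul n, hI.pos, hI.lt, hI.zero_notMem, fun z hz => (hb _ hn.le z hz).1⟩
  refine ⟨hIn, ?_⟩
  rw [mul_assoc]
  exact norm_rieszProj_sub_le hI.pos.le hI.sphere_subset hIn.sphere_subset
    fun z hz => (hb _ hn.le z (sphere_subset_annulus hI.lt.le hz)).2

/-- Projections at distance less than 1 have the same rank. The disc avoids 0, so passing from Q A Q
to Q A does not change the generalised eigenspaces. -/
lemma eventually_finrank_eq (h : Approximates A Q ε) (hI : Isolates A lam r R) :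
    ∀ᶠ n in atTop, finrank ℂ (genSpace (Q n * A * Q n) (Metric.closedBall lam r)) =
      finrank ℂ (genSpace A (Metric.closedBall lam r)) := by
  obtain ⟨C, hC⟩ := h.eventually_isolates hI
  have hev : ∀ᶠ n in atTop, C * ‖Q n * A - A‖ < 1 :=
    (h.tendsto_norm.const_mul C).eventually_lt_const (by simp)
  filter_upwards [hC, hev] with n hn hn1
  have h1 := hn.2.trans_lt hn1
  rw [genSpace_compression (h.idem n) hI.zero_notMem, hn.1.genSpace_eq, hI.genSpace_eq]
  have := hI.finiteDimensional_range
  have := hn.1.finiteDimensional_range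
  refine le_antisymm ?_ ?_
  · refine finrank_le_of_proj (P := rieszProj (Q n * A) lam r) (Q := rieszProj A lam r)
      (fun x hx => hn.1.mem_range_iff.1 hx) (fun x => ⟨x, rfl⟩) ?_
    rwa [norm_sub_rev]
  · exact finrank_le_of_proj (P := rieszProj A lam r) (Q := rieszProj (Q n * A) lam r)
      (fun x hx => hI.mem_range_iff.1 hx) (fun x => ⟨x, rfl⟩) h1

lemma gap_isBigO (h : Approximates A Q ε) (hI : Isolates A lam r R) :
    (fun n => gap (genSpace A (Metric.closedBall lam r))
      (genSpace (Q n * A * Q n) (Metric.closedBall lam r))) =O[atTop] ε := by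
  obtain ⟨C, hC⟩ := h.eventually_isolates hI
  obtain ⟨C', hC'⟩ := h.bound
  refine IsBigO.of_bound (|C| * |C'|) ?_
  filter_upwards [hC] with n hn
  rw [genSpace_compression (h.idem n) hI.zero_notMem, hn.1.genSpace_eq, hI.genSpace_eq,
    Real.norm_of_nonneg (gap_nonneg _ _)]
  refine (gap_le_of_proj (fun x hx => hI.mem_range_iff.1 hx) (fun x => ⟨x, rfl⟩)
    (fun x hx => hn.1.mem_range_iff.1 hx) (fun x => ⟨x, rfl⟩)).trans (hn.2.trans ?_)
  calc C * ‖Q n * A - A‖ ≤ |C| * ‖Q n * A - A‖ := by gcongr; exact le_abs_self C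
    _ ≤ |C| * |C' * ε n| := by gcongr; exact (hC' n).trans (le_abs_self _)
    _ = _ := by rw [abs_mul, Real.norm_eq_abs]; ring

/-- The range of the projection is the generalised eigenspace for a single eigenvalue, and a
nilpotent endomorphism of a space of dimension m has vanishing m-th power. -/
lemma pow_sub_apply_eq_zero (hI : Isolates A lam r R)
    (hlam : genSpace A (Metric.closedBall lam r) = genSpace A {lam}) (x : X) :
    ((A - lam • 1) ^ finrank ℂ (genSpace A {lam}) : X →L[ℂ] X) (rieszProj A lam r x) = 0 := by
  have hfin : FiniteDimensional ℂ (genSpace A {lam}) := by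
    rw [← hlam, hI.genSpace_eq]; exact hI.finiteDimensional_range
  have hmem : rieszProj A lam r x ∈ genSpace A {lam} := by
    rw [← hlam, hI.genSpace_eq]; exact ⟨x, rfl⟩
  set U := genSpace A {lam} with hU
  have hinv : ∀ y ∈ U, (A : End ℂ X) y ∈ U := by
    rw [hU, genSpace_singleton]
    exact mapsTo_maxGenEigenspace_of_comm (Commute.refl _) lam
  let B : End ℂ U := (A : End ℂ X).restrict hinv
  have h1 : (⟨_, hmem⟩ : U) ∈ maxGenEigenspace B lam := by
    change _ ∈ genEigenspace B lam ⊤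
    rw [Module.End.genEigenspace_restrict (A : End ℂ X) U ⊤ lam hinv]
    have := hmem
    rw [hU, genSpace_singleton] at this
    exact this
  rw [maxGenEigenspace_eq_genEigenspace_finrank, mem_genEigenspace_nat, LinearMap.mem_ker] at h1
  have hpow : ∀ k (y : U), (((B - lam • (1 : End ℂ U)) ^ k) y : X) =
      ((A - lam • 1) ^ k : X →L[ℂ] X) y := by
    intro k
    induction k with
    | zero => intro y; simp
    | succ k ih =>
      intro y
      rw [pow_succ, End.mul_apply, ih, pow_succ, mul_apply_eq_comp]
      congr 1
  rw [← hpow _ ⟨_, hmem⟩, h1]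
  rfl

/-- An eigenvector x of the compression is also an eigenvector of Q A and is fixed by the Riesz
projection of Q A. Applying (Q A − λ)^m to it produces (ν − λ)^m x, whereas (A − λ)^m annihilates
the range of the unperturbed projection; the comparison costs only a multiple of ‖Q A − A‖. -/
lemma eigenvalue_bound (h : Approximates A Q ε) (hI : Isolates A lam r R)
    (hlam : genSpace A (Metric.closedBall lam r) = genSpace A {lam}) :
    ∃ C, ∀ᶠ n in atTop, ∀ ν ∈ Metric.closedBall lam r,
      HasEigenvalue ((Q n * A * Q n : X →L[ℂ] X) : End ℂ X) ν →
        ‖ν - lam‖ ^ finrank ℂ (genSpace A {lam}) ≤ C * ε n := by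
  obtain ⟨C, hC⟩ := h.eventually_isolates hI
  obtain ⟨C', hC'⟩ := h.bound
  set m := finrank ℂ (genSpace A {lam})
  obtain ⟨C₁, hC₁, hpow⟩ := exists_norm_pow_sub_le A lam m
  have hev : ∀ᶠ n in atTop, ‖Q n * A - A‖ < 1 := h.tendsto_norm.eventually_lt_const (by simp)
  refine ⟨(C₁ + ‖(A - lam • 1) ^ m‖ * |C|) * C', ?_⟩
  filter_upwards [hC, hev] with n hn hn1 ν hν hevν
  have hν0 : ν ≠ 0 := by rintro rfl; exact hI.zero_notMem hν
  obtain ⟨x, hx⟩ := hevν.exists_hasEigenvector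
  have hxmem : x ∈ genSpace (Q n * A) (Metric.closedBall lam r) := by
    rw [← genSpace_compression (h.idem n) hI.zero_notMem]
    exact (le_iSup₂_of_le (f := fun ν (_ : ν ∈ Metric.closedBall lam r) =>
      maxGenEigenspace ((Q n * A * Q n : X →L[ℂ] X) : End ℂ X) ν) ν hν le_rfl)
      (eigenspace_le_maxGenEigenspace hx.1)
  have hPx : rieszProj (Q n * A) lam r x = x := by
    rw [hn.1.genSpace_eq] at hxmem
    exact hn.1.mem_range_iff.1 hxmem
  have hQAQ : Q n (A (Q n x)) = ν • x := hx.apply_eq_smul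
  have hQQ : ∀ y, Q n (Q n y) = Q n y := fun y =>
    congrArg (fun B : X →L[ℂ] X => B y) (h.idem n)
  have hQx : Q n x = x := by
    have h1 : ν • Q n x = ν • x := by
      rw [← map_smul, ← hQAQ, hQQ]
    exact smul_right_injective _ hν0 h1
  have hAx : (Q n * A : X →L[ℂ] X) x = ν • x := by
    rw [← hQAQ, hQx]; rfl
  have hpx : ∀ k, ((Q n * A - lam • 1) ^ k : X →L[ℂ] X) x = (ν - lam) ^ k • x := by
    intro k
    induction k with
    | zero => simp
    | succ k ih =>
      have h2 : (Q n * A - lam • 1 : X →L[ℂ] X) x = (ν - lam) • x := by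
        rw [sub_apply, hAx, sub_smul]; rfl
      rw [pow_succ, mul_apply_eq_comp, h2, map_smul, ih, smul_smul, pow_succ']
  have hx0 : 0 < ‖x‖ := norm_pos_iff.2 hx.2
  have hmain : ‖ν - lam‖ ^ m * ‖x‖ ≤ (C₁ + ‖(A - lam • 1) ^ m‖ * |C|) * ‖Q n * A - A‖ * ‖x‖ := by
    -- The term (A − λ)^m Px is zero and may be subtracted, which leaves one difference of powers
    -- and one difference of projections.
    have h3 : (ν - lam) ^ m • x = ((Q n * A - lam • 1) ^ m - (A - lam • 1) ^ m) x +
        ((A - lam • 1 : X →L[ℂ] X) ^ m *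
          (rieszProj (Q n * A) lam r - rieszProj A lam r)) x := by
      rw [← hpx, mul_apply_eq_comp, sub_apply, sub_apply, hPx, map_sub,
        pow_sub_apply_eq_zero hI hlam]
      abel
    calc ‖ν - lam‖ ^ m * ‖x‖ = ‖(ν - lam) ^ m • x‖ := by rw [norm_smul, norm_pow]
      _ ≤ ‖(Q n * A - lam • 1) ^ m - (A - lam • 1) ^ m‖ * ‖x‖ +
          ‖(A - lam • 1 : X →L[ℂ] X) ^ m *
            (rieszProj (Q n * A) lam r - rieszProj A lam r)‖ * ‖x‖ := by
          rw [h3]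
          exact (norm_add_le _ _).trans (add_le_add (ContinuousLinearMap.le_opNorm _ _)
            (ContinuousLinearMap.le_opNorm _ _))
      _ ≤ (C₁ * ‖Q n * A - A‖) * ‖x‖ +
          (‖(A - lam • 1) ^ m‖ * (|C| * ‖Q n * A - A‖)) * ‖x‖ := by
          gcongr
          · exact hpow _ hn1.le
          · refine (norm_mul_le _ _).trans ?_
            gcongr
            exact hn.2.trans (by gcongr; exact le_abs_self C)
      _ = _ := by ring
  have h4 := le_of_mul_le_mul_right hmain hx0
  calc _ ≤ _ := h4
    _ ≤ (C₁ + ‖(A - lam • 1) ^ m‖ * |C|) * (C' * ε n) := by gcongr; exact hC' n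
    _ = _ := by ring

lemma genSpace_eq_singleton {S : Set ℂ}
    (hlam : ∀ z ∈ S, z ∈ spectrum ℂ A → z = lam) (hS : lam ∈ S) :
    genSpace A S = genSpace A {lam} := by
  apply le_antisymm
  · refine iSup₂_le fun ν hν => ?_
    by_cases h : ν = lam
    · subst h
      rw [genSpace_singleton]
    · have : maxGenEigenspace (A : End ℂ X) ν = ⊥ := by
        by_contra hne
        have hev : HasEigenvalue (A : End ℂ X) ν :=
          (hasUnifEigenvalue_iff_hasUnifEigenvalue_one (k := ⊤) (by simp)).1 hne
        refine h (hlam ν hν ?_)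
        rw [ContinuousLinearMap.spectrum_eq]
        exact hev.mem_spectrum
      rw [this]
      exact bot_le
  · rw [genSpace_singleton]
    exact le_iSup₂_of_le lam hS le_rfl

end Approximates

end Perturbation

end

section

/-! ### The spaces `H²_s` as sequence spaces -/

lemma weight_neg (s : ℝ) (k : ℤ) : weight (-s) k = (weight s k)⁻¹ := by
  have hc : Real.cosh (2 * k * -s) = Real.cosh (2 * k * s) := by
    rw [mul_neg, Real.cosh_neg]
  rcases lt_trichotomy s 0 with h | rfl | h
  · rw [weight, weight, if_pos (by linarith), if_neg (not_le.2 h), hc, inv_inv]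
  · simp [weight]
  · rw [weight, weight, if_neg (by linarith), if_pos h.le, hc]

lemma weight_neg_int (s : ℝ) (k : ℤ) : weight s (-k) = weight s k := by
  have hc : Real.cosh (2 * ((-k : ℤ) : ℝ) * s) = Real.cosh (2 * k * s) := by
    rw [Int.cast_neg, mul_neg, neg_mul, Real.cosh_neg]
  rw [weight, weight, hc]

lemma weight_zero (k : ℤ) : weight 0 k = 1 := by simp [weight]

lemma weight_of_nonneg {s : ℝ} (hs : 0 ≤ s) (k : ℤ) :
    weight s k = √(Real.cosh (2 * k * s)) := if_pos hs

lemma weight_sq_of_nonneg {s : ℝ} (hs : 0 ≤ s) (k : ℤ) :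
    weight s k ^ 2 = Real.cosh (2 * k * s) := by
  rw [weight_of_nonneg hs, Real.sq_sqrt (Real.cosh_pos _).le]

lemma weight_mono_of_nonneg {s s' : ℝ} (hs : 0 ≤ s) (h : s ≤ s') (k : ℤ) :
    weight s k ≤ weight s' k := by
  rw [weight_of_nonneg hs, weight_of_nonneg (hs.trans h)]
  refine Real.sqrt_le_sqrt (Real.cosh_le_cosh.2 ?_)
  rw [abs_mul, abs_mul _ s', abs_of_nonneg hs, abs_of_nonneg (hs.trans h)]
  gcongr

lemma one_le_weight {s : ℝ} (hs : 0 ≤ s) (k : ℤ) : 1 ≤ weight s k := by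
  rw [← weight_zero k]
  exact weight_mono_of_nonneg le_rfl hs k

lemma weight_mono {s s' : ℝ} (h : s ≤ s') (k : ℤ) : weight s k ≤ weight s' k := by
  rcases le_total 0 s with hs | hs
  · exact weight_mono_of_nonneg hs h k
  · rcases le_total 0 s' with hs' | hs'
    · have h1 : weight s k ≤ 1 := by
        rw [← neg_neg s, weight_neg (-s)]
        exact inv_le_one_of_one_le₀ (one_le_weight (by linarith) k)
      exact h1.trans (one_le_weight hs' k)
    · rw [← neg_neg s, ← neg_neg s', weight_neg (-s), weight_neg (-s')]
      exact inv_anti₀ (weight_pos _ _)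
        (weight_mono_of_nonneg (by linarith) (by linarith) k)

namespace Hardy

variable {s s' : ℝ}

lemma coeff_injective : Function.Injective (Hardy.coeff : Hardy s → ℤ → ℂ) :=
  Subtype.val_injective

@[simp] lemma coeff_mk (c : ℤ → ℂ) (hc : c ∈ hardySubmodule s) : (mk c hc).coeff = c := rfl

@[simp] lemma coeff_add (a b : Hardy s) : (a + b).coeff = a.coeff + b.coeff := rfl

@[simp] lemma coeff_smul (r : ℂ) (a : Hardy s) : (r • a).coeff = r • a.coeff := rfl

@[simp] lemma coeff_sub (a b : Hardy s) : (a - b).coeff = a.coeff - b.coeff := rfl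

lemma norm_toEll2 (a : Hardy s) : ‖toEll2 s a‖ = ‖a‖ := rfl

lemma norm_toEll2_apply (a : Hardy s) (k : ℤ) : ‖toEll2 s a k‖ = weight s k * ‖a.coeff k‖ := by
  change ‖(weight s k : ℂ) * a.coeff k‖ = _
  rw [norm_mul, Complex.norm_of_nonneg (weight_pos s k).le]

lemma sum_le_norm_sq (a : Hardy s) (S : Finset ℤ) :
    ∑ k ∈ S, (weight s k * ‖a.coeff k‖) ^ 2 ≤ ‖a‖ ^ 2 := by
  have := lp.sum_rpow_le_norm_rpow (p := 2) (by norm_num) (toEll2 s a) S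
  simpa [norm_toEll2_apply, norm_toEll2] using this

lemma hasSum_norm_sq (a : Hardy s) :
    HasSum (fun k => (weight s k * ‖a.coeff k‖) ^ 2) (‖a‖ ^ 2) := by
  have := lp.hasSum_norm (p := 2) (by norm_num) (toEll2 s a)
  simpa [norm_toEll2_apply, norm_toEll2] using this

lemma weight_mul_norm_coeff_le (a : Hardy s) (k : ℤ) : weight s k * ‖a.coeff k‖ ≤ ‖a‖ := by
  have := a.sum_le_norm_sq {k}
  rw [Finset.sum_singleton] at this
  exact le_of_sq_le_sq this (norm_nonneg _)

lemma mem_of_sum_le {c : ℤ → ℂ} {C : ℝ}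
    (h : ∀ S : Finset ℤ, ∑ k ∈ S, (weight s k * ‖c k‖) ^ 2 ≤ C) : c ∈ hardySubmodule s := by
  refine memℓp_gen' (C := C) fun S => ?_
  have := h S
  simpa [abs_of_pos (weight_pos s _)] using this

lemma norm_le_of_sum_le {a : Hardy s} {C : ℝ} (hC : 0 ≤ C)
    (h : ∀ S : Finset ℤ, ∑ k ∈ S, (weight s k * ‖a.coeff k‖) ^ 2 ≤ C ^ 2) : ‖a‖ ≤ C := by
  rw [← norm_toEll2]
  refine lp.norm_le_of_forall_sum_le (p := 2) (by norm_num) hC fun S => ?_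
  simpa [norm_toEll2_apply] using h S

lemma sum_le_of_le (a : Hardy s) {c : ℤ → ℂ} {C : ℝ}
    (h : ∀ k, weight s' k * ‖c k‖ ≤ C * (weight s k * ‖a.coeff k‖)) (S : Finset ℤ) :
    ∑ k ∈ S, (weight s' k * ‖c k‖) ^ 2 ≤ (C * ‖a‖) ^ 2 := by
  calc ∑ k ∈ S, (weight s' k * ‖c k‖) ^ 2
      ≤ ∑ k ∈ S, C ^ 2 * (weight s k * ‖a.coeff k‖) ^ 2 := by
        refine Finset.sum_le_sum fun k _ => ?_
        rw [← mul_pow]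
        exact pow_le_pow_left₀ (mul_nonneg (weight_pos _ _).le (norm_nonneg _)) (h k) 2
    _ ≤ _ := by
        rw [← Finset.mul_sum, mul_pow]
        exact mul_le_mul_of_nonneg_left (a.sum_le_norm_sq S) (sq_nonneg C)

lemma mem_of_le (a : Hardy s) {c : ℤ → ℂ} {C : ℝ}
    (h : ∀ k, weight s' k * ‖c k‖ ≤ C * (weight s k * ‖a.coeff k‖)) : c ∈ hardySubmodule s' :=
  mem_of_sum_le (sum_le_of_le a h)

lemma norm_le_of_le {a : Hardy s} {b : Hardy s'} {C : ℝ} (hC : 0 ≤ C)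
    (h : ∀ k, weight s' k * ‖b.coeff k‖ ≤ C * (weight s k * ‖a.coeff k‖)) : ‖b‖ ≤ C * ‖a‖ :=
  norm_le_of_sum_le (mul_nonneg hC (norm_nonneg _)) (sum_le_of_le a h)

/-- `φ ↦ σ_s φ̂` as an isometric isomorphism. -/
def isoEll2 (s : ℝ) : Hardy s ≃ₗᵢ[ℂ] lp (fun _ : ℤ => ℂ) 2 :=
  LinearIsometryEquiv.ofSurjective ⟨toEll2 s, fun _ => rfl⟩ fun d => by
    have hd : (fun k => ((weight s k : ℂ))⁻¹ * d k) ∈ hardySubmodule s := by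
      change Memℓp (fun k => (weight s k : ℂ) * ((weight s k : ℂ)⁻¹ * d k)) 2
      have : (fun k => (weight s k : ℂ) * ((weight s k : ℂ)⁻¹ * d k)) = d := by
        funext k
        rw [mul_inv_cancel_left₀]
        exact_mod_cast (weight_pos s k).ne'
      rw [this]
      exact lp.memℓp d
    refine ⟨mk _ hd, ?_⟩
    ext k
    change (weight s k : ℂ) * ((weight s k : ℂ)⁻¹ * d k) = d k
    rw [mul_inv_cancel_left₀]
    exact_mod_cast (weight_pos s k).ne'

lemma isoEll2_apply (a : Hardy s) (k : ℤ) : isoEll2 s a k = (weight s k : ℂ) * a.coeff k := rfl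

instance : CompleteSpace (Hardy s) :=
  (isoEll2 s).symm.toIsometryEquiv.completeSpace_iff.1 inferInstance

/-- The bounded operator `H²_s → H²_{s'}` given by its action on the Fourier coefficients. -/
def mkCLM (c : Hardy s → ℤ → ℂ) (hadd : ∀ a b, c (a + b) = c a + c b)
    (hsmul : ∀ (r : ℂ) a, c (r • a) = r • c a) (C : ℝ) (hC : 0 ≤ C)
    (hb : ∀ a (S : Finset ℤ), ∑ k ∈ S, (weight s' k * ‖c a k‖) ^ 2 ≤ (C * ‖a‖) ^ 2) :
    Hardy s →L[ℂ] Hardy s' :=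
  let L : Hardy s →ₗ[ℂ] Hardy s' :=
    { toFun := fun a => mk (c a) (mem_of_sum_le (hb a))
      map_add' := fun a b => coeff_injective (hadd a b)
      map_smul' := fun r a => coeff_injective (hsmul r a) }
  L.mkContinuous C fun a => norm_le_of_sum_le (mul_nonneg hC (norm_nonneg a)) (hb a)

lemma coeff_mkCLM {c : Hardy s → ℤ → ℂ} {hadd hsmul} {C : ℝ} {hC hb} (a : Hardy s) :
    (mkCLM (s' := s') c hadd hsmul C hC hb a).coeff = c a := rfl

lemma norm_mkCLM_le {c : Hardy s → ℤ → ℂ} {hadd hsmul} {C : ℝ} {hC hb} :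
    ‖mkCLM (s' := s') c hadd hsmul C hC hb‖ ≤ C :=
  ContinuousLinearMap.opNorm_le_bound _ hC fun a =>
    norm_le_of_sum_le (mul_nonneg hC (norm_nonneg a)) fun S => by
      rw [coeff_mkCLM]
      exact hb a S

/-- The inclusion `H²_s ⊆ H²_{s'}`, `s' ≤ s`. -/
def incl (h : s' ≤ s) : Hardy s →L[ℂ] Hardy s' :=
  mkCLM Hardy.coeff coeff_add coeff_smul 1 zero_le_one fun a => sum_le_of_le a fun k => by
    rw [one_mul]
    exact mul_le_mul_of_nonneg_right (weight_mono h k) (norm_nonneg _)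

@[simp] lemma coeff_incl (h : s' ≤ s) (a : Hardy s) : (incl h a).coeff = a.coeff :=
  coeff_mkCLM a

lemma incl_injective (h : s' ≤ s) : Function.Injective (incl h) := fun a b hab =>
  coeff_injective (by rw [← coeff_incl h, hab, coeff_incl])

/-- The `k`th Fourier coefficient as a continuous functional. -/
def coeffCLM (s : ℝ) (k : ℤ) : Hardy s →L[ℂ] ℂ :=
  LinearMap.mkContinuous
    { toFun := fun a => a.coeff k
      map_add' := fun _ _ => rfl
      map_smul' := fun _ _ => rfl } (weight s k)⁻¹ fun a => by
    rw [inv_mul_eq_div, le_div_iff₀' (weight_pos s k)]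
    exact a.weight_mul_norm_coeff_le k

/-- Trigonometric polynomials as elements of `H²_s`. -/
def ofFinsupp (s : ℝ) : (ℤ →₀ ℂ) →ₗ[ℂ] Hardy s where
  toFun p := mk p (mem_of_sum_le (C := ∑ k ∈ p.support, (weight s k * ‖p k‖) ^ 2) fun S => by
    calc _ ≤ ∑ k ∈ S ∪ p.support, (weight s k * ‖p k‖) ^ 2 :=
          Finset.sum_le_sum_of_subset_of_nonneg Finset.subset_union_left fun _ _ _ => sq_nonneg _
      _ = _ := by
          refine (Finset.sum_subset Finset.subset_union_right fun k _ hk => ?_).symm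
          rw [Finsupp.notMem_support_iff.1 hk, norm_zero, mul_zero, zero_pow two_ne_zero])
  map_add' _ _ := rfl
  map_smul' _ _ := rfl

@[simp] lemma coeff_ofFinsupp (p : ℤ →₀ ℂ) : (ofFinsupp s p).coeff = p := rfl

lemma norm_sq_ofFinsupp (p : ℤ →₀ ℂ) {S : Finset ℤ} (hS : p.support ⊆ S) :
    ‖ofFinsupp s p‖ ^ 2 = ∑ k ∈ S, (weight s k * ‖p k‖) ^ 2 := by
  rw [← (hasSum_norm_sq (ofFinsupp s p)).tsum_eq]
  refine tsum_eq_sum fun k hk => ?_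
  rw [coeff_ofFinsupp, Finsupp.notMem_support_iff.1 (fun h => hk (hS h)), norm_zero, mul_zero,
    zero_pow two_ne_zero]

lemma incl_ofFinsupp (h : s' ≤ s) (p : ℤ →₀ ℂ) : incl h (ofFinsupp s p) = ofFinsupp s' p :=
  coeff_injective (by rw [coeff_incl, coeff_ofFinsupp, coeff_ofFinsupp])

lemma isoEll2_ofFinsupp_single (k : ℤ) (z : ℂ) :
    isoEll2 s (ofFinsupp s (Finsupp.single k z)) = lp.single 2 k ((weight s k : ℂ) * z) := by
  ext j
  rw [isoEll2_apply, coeff_ofFinsupp]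
  rcases eq_or_ne j k with rfl | hjk
  · rw [Finsupp.single_eq_same, lp.single_apply_self]
  · rw [Finsupp.single_eq_of_ne hjk, mul_zero, lp.single_apply_ne _ _ _ hjk]

lemma denseRange_ofFinsupp (s : ℝ) : DenseRange (ofFinsupp s) := by
  intro a
  have h1 := lp.hasSum_single (E := fun _ : ℤ => ℂ) (p := 2) (by norm_num) (isoEll2 s a)
  have h2 : Tendsto (fun S : Finset ℤ => ∑ k ∈ S, ofFinsupp s (Finsupp.single k (a.coeff k)))
      atTop (𝓝 a) := by
    rw [(isoEll2 s).isometry.isEmbedding.tendsto_nhds_iff]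
    refine Tendsto.congr (fun S => ?_) h1
    rw [Function.comp_apply, map_sum]
    exact Finset.sum_congr rfl fun k _ => by rw [isoEll2_ofFinsupp_single]; rfl
  refine mem_closure_of_tendsto h2 (Eventually.of_forall fun S => ?_)
  exact ⟨∑ k ∈ S, Finsupp.single k (a.coeff k), map_sum _ _ _⟩

lemma denseRange_incl (h : s' ≤ s) : DenseRange (incl h) := by
  refine (denseRange_ofFinsupp s').mono ?_
  rintro _ ⟨p, rfl⟩
  exact ⟨ofFinsupp s p, incl_ofFinsupp h p⟩

/-! #### The duality of `H²_s` and `H²_{-s}` -/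

lemma weight_mul_weight_neg (s : ℝ) (k : ℤ) : weight s k * weight (-s) (-k) = 1 := by
  rw [weight_neg_int, weight_neg, mul_inv_cancel₀ (weight_pos s k).ne']

lemma norm_mul_coeff (a : Hardy s) (b : Hardy (-s)) (k : ℤ) : ‖a.coeff k * b.coeff (-k)‖ =
    (weight s k * ‖a.coeff k‖) * (weight (-s) (-k) * ‖b.coeff (-k)‖) := by
  rw [norm_mul]
  linear_combination (-(‖a.coeff k‖ * ‖b.coeff (-k)‖)) * weight_mul_weight_neg s k

lemma sum_neg_le_norm_sq (b : Hardy s) (S : Finset ℤ) :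
    ∑ k ∈ S, (weight s (-k) * ‖b.coeff (-k)‖) ^ 2 ≤ ‖b‖ ^ 2 := by
  have := b.sum_le_norm_sq (S.map (Equiv.neg ℤ).toEmbedding)
  simpa using this

lemma sum_norm_mul_le (a : Hardy s) (b : Hardy (-s)) (S : Finset ℤ) :
    ∑ k ∈ S, ‖a.coeff k * b.coeff (-k)‖ ≤ ‖a‖ * ‖b‖ := by
  simp_rw [norm_mul_coeff]
  refine (Real.sum_mul_le_sqrt_mul_sqrt _ _ _).trans ?_
  refine mul_le_mul ?_ ?_ (Real.sqrt_nonneg _) (norm_nonneg _)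
  · exact Real.sqrt_le_iff.2 ⟨norm_nonneg _, a.sum_le_norm_sq S⟩
  · exact Real.sqrt_le_iff.2 ⟨norm_nonneg _, b.sum_neg_le_norm_sq S⟩

lemma summable_norm_mul (a : Hardy s) (b : Hardy (-s)) :
    Summable fun k => ‖a.coeff k * b.coeff (-k)‖ :=
  summable_of_sum_le (fun _ => norm_nonneg _) (sum_norm_mul_le a b)

lemma summable_mul (a : Hardy s) (b : Hardy (-s)) :
    Summable fun k => a.coeff k * b.coeff (-k) := (summable_norm_mul a b).of_norm

/-- The bilinear pairing `(1/2π) ∫ a b dx` of `H²_s` and `H²_{-s}`. -/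
def pair (s : ℝ) : Hardy s →L[ℂ] Hardy (-s) →L[ℂ] ℂ :=
  LinearMap.mkContinuous₂
    (LinearMap.mk₂ ℂ (fun a b => ∑' k, a.coeff k * b.coeff (-k))
      (fun a a' b => by
        simp only [coeff_add, Pi.add_apply, add_mul]
        exact (summable_mul a b).tsum_add (summable_mul a' b))
      (fun r a b => by
        simp only [coeff_smul, Pi.smul_apply, smul_eq_mul, mul_assoc]
        exact tsum_mul_left)
      (fun a b b' => by
        simp only [coeff_add, Pi.add_apply, mul_add]
        exact (summable_mul a b).tsum_add (summable_mul a b'))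
      (fun r a b => by
        simp only [coeff_smul, Pi.smul_apply, smul_eq_mul, mul_left_comm _ r]
        exact tsum_mul_left)) 1 fun a b => by
    rw [one_mul]
    refine (norm_tsum_le_tsum_norm (summable_norm_mul a b)).trans ?_
    exact (summable_norm_mul a b).tsum_le_of_sum_le (sum_norm_mul_le a b)

lemma pair_apply (a : Hardy s) (b : Hardy (-s)) :
    pair s a b = ∑' k, a.coeff k * b.coeff (-k) := rfl

lemma norm_pair_le (a : Hardy s) (b : Hardy (-s)) : ‖pair s a b‖ ≤ ‖a‖ * ‖b‖ := by
  refine (norm_tsum_le_tsum_norm (summable_norm_mul a b)).trans ?_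
  exact (summable_norm_mul a b).tsum_le_of_sum_le (sum_norm_mul_le a b)

lemma pair_ofFinsupp_right (a : Hardy s) (p : ℤ →₀ ℂ) :
    pair s a (ofFinsupp (-s) p) = p.sum fun k z => z * a.coeff (-k) := by
  rw [pair_apply, ← (Equiv.neg ℤ).tsum_eq]
  simp only [Equiv.neg_apply, coeff_ofFinsupp, neg_neg]
  rw [tsum_eq_sum (s := p.support) fun k hk => by simp [Finsupp.notMem_support_iff.1 hk]]
  exact Finset.sum_congr rfl fun k _ => mul_comm _ _

lemma pair_single_right (a : Hardy s) (k : ℤ) :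
    pair s a (ofFinsupp (-s) (Finsupp.single k 1)) = a.coeff (-k) := by
  rw [pair_ofFinsupp_right, Finsupp.sum_single_index] <;> simp

/-- A sequence which acts boundedly on the trigonometric polynomials in `H²_{s'}` is in the dual
`H²_s`, `s' = -s`. -/
lemma sum_le_of_pairing {c : ℤ → ℂ} {C : ℝ} (hss : s' = -s)
    (h : ∀ p : ℤ →₀ ℂ, ‖p.sum fun k z => z * c (-k)‖ ≤ C * ‖ofFinsupp s' p‖) (S : Finset ℤ) :
    ∑ k ∈ S, (weight s k * ‖c k‖) ^ 2 ≤ C ^ 2 := by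
  classical
  set T := S.map (Equiv.neg ℤ).toEmbedding with hT
  -- The extremal test polynomial for the dual norm: its pairing with c and its squared norm both
  -- equal N₀, so the hypothesis becomes N₀ ≤ C √N₀. The reflection T of S accounts for the pairing
  -- of k with −k.
  let p : ℤ →₀ ℂ := Finsupp.onFinset T
    (fun k => if k ∈ T then ((weight s (-k) ^ 2 : ℝ) : ℂ) * (starRingEnd ℂ) (c (-k)) else 0)
    fun k hk => by by_contra h0; simp [h0] at hk
  have hp : ∀ k ∈ T, p k = ((weight s (-k) ^ 2 : ℝ) : ℂ) * (starRingEnd ℂ) (c (-k)) :=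
    fun k hk => by simp [p, hk]
  have hsupp : p.support ⊆ T := Finsupp.support_onFinset_subset
  set N₀ := ∑ k ∈ S, (weight s k * ‖c k‖) ^ 2 with hN
  have hNT : N₀ = ∑ k ∈ T, (weight s (-k) * ‖c (-k)‖) ^ 2 := by simp [hN, hT]
  have h0 : 0 ≤ N₀ := Finset.sum_nonneg fun _ _ => sq_nonneg _
  have h1 : (p.sum fun k z => z * c (-k)) = (N₀ : ℂ) := by
    rw [Finsupp.sum_of_support_subset _ hsupp _ (by simp), hNT]
    push_cast
    refine Finset.sum_congr rfl fun k hk => ?_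
    rw [hp k hk, mul_assoc, mul_comm ((starRingEnd ℂ) _), Complex.mul_conj, Complex.normSq_eq_norm_sq]
    push_cast
    ring
  have h2 : ‖ofFinsupp s' p‖ ^ 2 = N₀ := by
    rw [norm_sq_ofFinsupp p hsupp, hNT]
    refine Finset.sum_congr rfl fun k hk => ?_
    rw [hp k hk, norm_mul, RCLike.norm_conj, Complex.norm_of_nonneg (sq_nonneg _), hss, weight_neg,
      weight_neg_int s k]
    have := (weight_pos s k).ne'
    field_simp
  have h3 := h p
  rw [h1, Complex.norm_of_nonneg h0, ← h2] at h3
  rw [← h2]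
  rcases eq_or_lt_of_le (norm_nonneg (ofFinsupp s' p)) with h4 | h4
  · rw [← h4]; simpa using sq_nonneg C
  · rw [sq] at h3
    exact pow_le_pow_left₀ h4.le (le_of_mul_le_mul_right h3 h4) 2

lemma norm_le_of_pairing {a : Hardy s} {C : ℝ} (hC : 0 ≤ C) (hss : s' = -s)
    (h : ∀ p : ℤ →₀ ℂ, ‖p.sum fun k z => z * a.coeff (-k)‖ ≤ C * ‖ofFinsupp s' p‖) : ‖a‖ ≤ C :=
  norm_le_of_sum_le hC (sum_le_of_pairing hss h)

lemma pair_left_injective {a a' : Hardy s} (h : ∀ b, pair s a b = pair s a' b) : a = a' := by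
  refine coeff_injective (funext fun k => ?_)
  have := h (ofFinsupp _ (Finsupp.single (-k) 1))
  rwa [pair_single_right, pair_single_right, neg_neg] at this

/-- The transpose of a bounded operator for the duality of `H²_s` and `H²_{-s}`. -/
lemma exists_transpose (A : Hardy (-s) →L[ℂ] Hardy (-s')) :
    ∃ B : Hardy s' →L[ℂ] Hardy s, ‖B‖ ≤ ‖A‖ ∧ ∀ a φ, pair s (B a) φ = pair s' a (A φ) := by
  -- The k-th coefficient of the transposed element is read off by pairing with e^{-ikx}.
  let c (a : Hardy s') (k : ℤ) : ℂ := pair s' a (A (ofFinsupp (-s) (Finsupp.single (-k) 1)))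
  have hsum : ∀ a (p : ℤ →₀ ℂ), (p.sum fun k z => z * c a (-k)) =
      pair s' a (A (ofFinsupp (-s) p)) := by
    intro a p
    induction p using Finsupp.induction_linear with
    | zero => simp
    | add p q hp hq =>
      rw [Finsupp.sum_add_index' (by simp) (by intros; ring), hp, hq, map_add, map_add, map_add]
    | single k z =>
      rw [Finsupp.sum_single_index (by simp)]
      have : (Finsupp.single k z : ℤ →₀ ℂ) = z • Finsupp.single k 1 := by simp
      rw [this, map_smul, map_smul, map_smul]
      simp [c]
  have hb : ∀ a (p : ℤ →₀ ℂ), ‖p.sum fun k z => z * c a (-k)‖ ≤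
      (‖A‖ * ‖a‖) * ‖ofFinsupp (-s) p‖ := by
    intro a p
    rw [hsum]
    calc _ ≤ ‖a‖ * ‖A (ofFinsupp (-s) p)‖ := norm_pair_le _ _
      _ ≤ ‖a‖ * (‖A‖ * ‖ofFinsupp (-s) p‖) := by gcongr; exact A.le_opNorm _
      _ = _ := by ring
  let B : Hardy s' →L[ℂ] Hardy s := mkCLM c (fun a a' => funext fun k => by simp [c])
    (fun r a => funext fun k => by simp [c]) ‖A‖ (norm_nonneg _)
    fun a => sum_le_of_pairing rfl (hb a)
  refine ⟨B, norm_mkCLM_le, fun a φ => ?_⟩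
  have h1 : Continuous fun φ => pair s (B a) φ := (pair s (B a)).continuous
  have h2 : Continuous fun φ => pair s' a (A φ) := (pair s' a).continuous.comp A.continuous
  refine congrFun ((denseRange_ofFinsupp (-s)).equalizer h1 h2 (funext fun p => ?_)) φ
  change pair s (B a) (ofFinsupp (-s) p) = _
  rw [pair_ofFinsupp_right, coeff_mkCLM]
  exact hsum a p

/-- An operator on `L² = H²_0` extends to a bounded operator `H²_{-s} → H²_{-s'}` if its transpose
maps the trigonometric polynomials boundedly from `H²_{s'}` to `H²_s`. -/
lemma exists_extension (hs : 0 ≤ s) (hs' : 0 ≤ s') (T : Hardy 0 →L[ℂ] Hardy 0) {C : ℝ}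
    (hC : 0 ≤ C)
    (h : ∀ p : ℤ →₀ ℂ, ∃ q : Hardy s, ‖q‖ ≤ C * ‖ofFinsupp s' p‖ ∧ ∀ φ : Hardy 0,
      (p.sum fun k z => z * (T φ).coeff (-k)) = pair s q (incl (by linarith) φ)) :
    ∃ A : Hardy (-s) →L[ℂ] Hardy (-s'), ‖A‖ ≤ C ∧ ∀ φ : Hardy 0,
      (A (incl (by linarith) φ)).coeff = (T φ).coeff := by
  let e : Hardy 0 →L[ℂ] Hardy (-s) := incl (by linarith)
  let f : Hardy 0 →L[ℂ] Hardy (-s') := (incl (by linarith)) ∘L T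
  have hd : DenseRange e := denseRange_incl _
  -- The norm of the image is tested on polynomials p, where the hypothesis moves T onto p. The
  -- resulting bound involves only the weak norm of φ, which is what extension by density requires.
  have hb : ∀ φ, ‖f φ‖ ≤ C * ‖e φ‖ := by
    intro φ
    refine norm_le_of_pairing (s' := s') (by positivity) (by ring) fun p => ?_
    obtain ⟨q, hq, hpq⟩ := h p
    have hf : (f φ).coeff = (T φ).coeff := coeff_incl (by linarith) _
    rw [hf, hpq]
    calc _ ≤ ‖q‖ * ‖e φ‖ := norm_pair_le _ _
      _ ≤ (C * ‖ofFinsupp s' p‖) * ‖e φ‖ := by gcongr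
      _ = _ := by ring
  refine ⟨LinearMap.extendOfNorm (f : Hardy 0 →ₗ[ℂ] Hardy (-s')) (e : Hardy 0 →ₗ[ℂ] Hardy (-s)),
    ?_, fun φ => ?_⟩
  · exact ContinuousLinearMap.opNorm_le_bound _ hC fun x =>
      LinearMap.norm_extendOfNorm_apply_le hd C hb x
  · have := LinearMap.extendOfNorm_eq (f := (f : Hardy 0 →ₗ[ℂ] Hardy (-s')))
      (e := (e : Hardy 0 →ₗ[ℂ] Hardy (-s))) hd ⟨C, hb⟩ φ
    exact (congrArg Hardy.coeff this).trans (coeff_incl (by linarith) _)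

/-- An operator on `L² = H²_0` restricts to a bounded operator `H²_s → H²_{s'}` if it maps the
trigonometric polynomials boundedly from `H²_s` to `H²_{s'}`. -/
lemma exists_restriction (hs : 0 ≤ s) (T : Hardy 0 →L[ℂ] Hardy 0) {C : ℝ}
    (hC : 0 ≤ C)
    (h : ∀ (p : ℤ →₀ ℂ) (S : Finset ℤ), ∑ k ∈ S, (weight s' k * ‖(T (ofFinsupp 0 p)).coeff k‖) ^ 2 ≤
      (C * ‖ofFinsupp s p‖) ^ 2) :
    ∃ A : Hardy s →L[ℂ] Hardy s', ‖A‖ ≤ C ∧ ∀ a : Hardy s,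
      (A a).coeff = (T (incl hs a)).coeff := by
  have hb : ∀ (a : Hardy s) (S : Finset ℤ),
      ∑ k ∈ S, (weight s' k * ‖(T (incl hs a)).coeff k‖) ^ 2 ≤ (C * ‖a‖) ^ 2 := by
    intro a S
    -- For a fixed finite S only finitely many coefficients enter, each continuous in a, so the
    -- bound passes from polynomials to their closure.
    have hclosed : IsClosed {a : Hardy s |
        ∑ k ∈ S, (weight s' k * ‖(T (incl hs a)).coeff k‖) ^ 2 ≤ (C * ‖a‖) ^ 2} := by
      refine isClosed_le ?_ (by fun_prop)
      refine continuous_finsetSum _ fun k _ => ?_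
      have : Continuous fun a => coeffCLM 0 k (T (incl hs a)) :=
        (coeffCLM 0 k ∘L T ∘L incl hs).continuous
      exact (continuous_const.mul this.norm).pow 2
    refine hclosed.closure_subset_iff.2 ?_ (denseRange_ofFinsupp s a)
    rintro _ ⟨p, rfl⟩
    have := h p S
    rw [← incl_ofFinsupp hs] at this
    exact this
  exact ⟨mkCLM (fun a => (T (incl hs a)).coeff) (fun a a' => by simp) (fun r a => by simp) C hC hb,
    norm_mkCLM_le, fun a => coeff_mkCLM a⟩

end Hardy

end

section

/-! ### `L²(μ)` and Fourier coefficients -/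

section CompLp

variable {α β : Type*} [MeasurableSpace α] [MeasurableSpace β] {μ : Measure α} {ν : Measure β}

lemma memLp_comp_of_map_le {g : α → β} (hg : Measurable g) {c : ℝ≥0∞} (hc : c ≠ ∞)
    (h : μ.map g ≤ c • ν) {φ : β → ℂ} (hφ : MemLp φ 2 ν) : MemLp (φ ∘ g) 2 μ :=
  (hφ.of_measure_le_smul hc h).comp_of_map hg.aemeasurable

lemma ae_comp_of_map_le {g : α → β} (hg : Measurable g) {c : ℝ≥0∞}
    (h : μ.map g ≤ c • ν) {p : β → Prop} (hp : ∀ᵐ y ∂ν, p y) : ∀ᵐ x ∂μ, p (g x) :=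
  ae_of_ae_map hg.aemeasurable ((Measure.absolutelyContinuous_of_le_smul h).ae_le hp)

/-- Composition with a map `g` with `g_* μ ≤ c ν`, as an operator `L²(ν) → L²(μ)`. -/
lemma exists_comp_clm {g : α → β} (hg : Measurable g) {c : ℝ≥0∞} (hc : c ≠ ∞)
    (h : μ.map g ≤ c • ν) :
    ∃ T : Lp ℂ 2 ν →L[ℂ] Lp ℂ 2 μ, ∀ φ : Lp ℂ 2 ν, T φ =ᵐ[μ] fun x => φ (g x) := by
  let L : Lp ℂ 2 ν →ₗ[ℂ] Lp ℂ 2 μ :=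
    { toFun := fun φ => (memLp_comp_of_map_le hg hc h (Lp.memLp φ)).toLp
      map_add' := fun φ ψ => by
        ext1
        filter_upwards [MemLp.coeFn_toLp (memLp_comp_of_map_le hg hc h (Lp.memLp (φ + ψ))),
          MemLp.coeFn_toLp (memLp_comp_of_map_le hg hc h (Lp.memLp φ)),
          MemLp.coeFn_toLp (memLp_comp_of_map_le hg hc h (Lp.memLp ψ)),
          Lp.coeFn_add (MemLp.toLp _ (memLp_comp_of_map_le hg hc h (Lp.memLp φ)))
            (MemLp.toLp _ (memLp_comp_of_map_le hg hc h (Lp.memLp ψ))),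
          ae_comp_of_map_le hg h (Lp.coeFn_add φ ψ)] with x h1 h2 h3 h4 h5
        rw [h1, h4, Pi.add_apply, h2, h3]
        exact h5
      map_smul' := fun r φ => by
        ext1
        filter_upwards [MemLp.coeFn_toLp (memLp_comp_of_map_le hg hc h (Lp.memLp (r • φ))),
          MemLp.coeFn_toLp (memLp_comp_of_map_le hg hc h (Lp.memLp φ)),
          Lp.coeFn_smul r (MemLp.toLp _ (memLp_comp_of_map_le hg hc h (Lp.memLp φ))),
          ae_comp_of_map_le hg h (Lp.coeFn_smul r φ)] with x h1 h2 h4 h5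
        rw [h1, RingHom.id_apply, h4, Pi.smul_apply, h2]
        exact h5 }
  refine ⟨L.mkContinuous (c.toReal ^ (1 / 2 : ℝ≥0∞).toReal) fun φ => ?_, fun φ =>
    MemLp.coeFn_toLp (memLp_comp_of_map_le hg hc h (Lp.memLp φ))⟩
  have h1 : eLpNorm (φ ∘ g) 2 μ ≤ c ^ (1 / 2 : ℝ≥0∞).toReal * eLpNorm φ 2 ν := by
    have hae : AEStronglyMeasurable φ (μ.map g) :=
      (Lp.memLp φ).1.mono_ac (Measure.absolutelyContinuous_of_le_smul h)
    rw [← eLpNorm_map_measure hae hg.aemeasurable]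
    exact eLpNorm_le_of_measure_le_smul h
  change ‖MemLp.toLp _ (memLp_comp_of_map_le hg hc h (Lp.memLp φ))‖ ≤ _
  rw [Lp.norm_toLp, Lp.norm_def, ENNReal.toReal_rpow, ← ENNReal.toReal_mul]
  refine ENNReal.toReal_mono (ENNReal.mul_ne_top ?_ (Lp.eLpNorm_ne_top φ)) h1
  exact ENNReal.rpow_ne_top_of_nonneg ENNReal.toReal_nonneg hc

end CompLp

open AddCircle

variable {h : C(Torus, ℝ)}

lemma exists_sampling_le (h : C(Torus, ℝ)) :
    ∃ c : ℝ≥0∞, c ≠ ∞ ∧ sampling h ≤ c • (volume : Measure Torus) := by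
  obtain ⟨C, hC⟩ := isCompact_univ.exists_bound_of_continuousOn h.continuous.continuousOn
  refine ⟨ENNReal.ofReal C, ENNReal.ofReal_ne_top, ?_⟩
  rw [sampling, ← withDensity_const]
  refine withDensity_mono (Eventually.of_forall fun x => ENNReal.ofReal_le_ofReal ?_)
  exact (le_abs_self _).trans (hC x trivial)

lemma exists_le_sampling (hpos : ∀ x, 0 < h x) :
    ∃ c : ℝ≥0∞, c ≠ ∞ ∧ (volume : Measure Torus) ≤ c • sampling h := by
  obtain ⟨x₀, -, hx₀⟩ := isCompact_univ.exists_isMinOn Set.univ_nonempty h.continuous.continuousOn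
  refine ⟨ENNReal.ofReal (h x₀)⁻¹, ENNReal.ofReal_ne_top, ?_⟩
  rw [sampling, ← withDensity_smul' _ _ ENNReal.ofReal_ne_top]
  conv_lhs => rw [← withDensity_one (μ := (volume : Measure Torus))]
  refine withDensity_mono (Eventually.of_forall fun x => ?_)
  change 1 ≤ ENNReal.ofReal _ * ENNReal.ofReal _
  rw [← ENNReal.ofReal_mul (inv_nonneg.2 (hpos x₀).le), ← ENNReal.ofReal_one]
  refine ENNReal.ofReal_le_ofReal ?_
  rw [inv_mul_eq_div, one_le_div (hpos x₀)]
  exact hx₀ (Set.mem_univ x)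

lemma exists_volume_le_haar :
    ∃ c : ℝ≥0∞, c ≠ ∞ ∧ (volume : Measure Torus) ≤ c • haarAddCircle :=
  ⟨_, ENNReal.ofReal_ne_top, le_of_eq volume_eq_smul_haarAddCircle⟩

lemma exists_haar_le_volume :
    ∃ c : ℝ≥0∞, c ≠ ∞ ∧ (haarAddCircle : Measure Torus) ≤ c • volume := by
  refine ⟨(ENNReal.ofReal (2 * Real.pi))⁻¹,
    ENNReal.inv_ne_top.2 (by simp [Real.pi_pos]), le_of_eq ?_⟩
  rw [volume_eq_smul_haarAddCircle, smul_smul, ENNReal.inv_mul_cancel (by simp [Real.pi_pos])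
    ENNReal.ofReal_ne_top, one_smul]

lemma exists_le_trans {α : Type*} [MeasurableSpace α] {μ ν ρ : Measure α}
    (h1 : ∃ c : ℝ≥0∞, c ≠ ∞ ∧ μ ≤ c • ν) (h2 : ∃ c : ℝ≥0∞, c ≠ ∞ ∧ ν ≤ c • ρ) :
    ∃ c : ℝ≥0∞, c ≠ ∞ ∧ μ ≤ c • ρ := by
  obtain ⟨c, hc, h1⟩ := h1
  obtain ⟨d, hd, h2⟩ := h2
  refine ⟨c * d, ENNReal.mul_ne_top hc hd, h1.trans ?_⟩
  rw [mul_smul]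
  refine Measure.le_iff.2 fun s hs => ?_
  rw [Measure.smul_apply, Measure.smul_apply (μ := d • ρ)]
  exact mul_le_mul_right (h2 s) c

lemma exists_haar_le_sampling (hpos : ∀ x, 0 < h x) :
    ∃ c : ℝ≥0∞, c ≠ ∞ ∧ (haarAddCircle : Measure Torus) ≤ c • sampling h :=
  exists_le_trans exists_haar_le_volume (exists_le_sampling hpos)

lemma exists_sampling_le_haar (h : C(Torus, ℝ)) :
    ∃ c : ℝ≥0∞, c ≠ ∞ ∧ sampling h ≤ c • (haarAddCircle : Measure Torus) :=
  exists_le_trans (exists_sampling_le h) exists_volume_le_haar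

lemma ae_haar_iff (hpos : ∀ x, 0 < h x) {p : Torus → Prop} :
    (∀ᵐ x ∂(haarAddCircle : Measure Torus), p x) ↔ ∀ᵐ x ∂(sampling h), p x := by
  obtain ⟨c, -, h1⟩ := exists_haar_le_sampling hpos
  obtain ⟨d, -, h2⟩ := exists_sampling_le_haar h
  exact ⟨fun hp => (Measure.absolutelyContinuous_of_le_smul h2).ae_le hp,
    fun hp => (Measure.absolutelyContinuous_of_le_smul h1).ae_le hp⟩

lemma memLp_haar (hpos : ∀ x, 0 < h x) (φ : L2 h) :
    MemLp φ 2 (haarAddCircle : Measure Torus) := by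
  obtain ⟨c, hc, h1⟩ := exists_haar_le_sampling hpos
  exact (Lp.memLp φ).of_measure_le_smul hc h1

/-- The identification of the elements of `L²(μ)` with their Fourier coefficients. -/
lemma exists_fourierEquiv (hpos : ∀ x, 0 < h x) :
    ∃ F : L2 h ≃L[ℂ] Hardy 0, ∀ φ : L2 h, (F φ).coeff = fourierCoeff (φ : Torus → ℂ) := by
  obtain ⟨c, hc, h1⟩ := exists_haar_le_sampling hpos
  obtain ⟨d, hd, h2⟩ := exists_sampling_le_haar h
  obtain ⟨T, hT⟩ := exists_comp_clm (μ := (haarAddCircle : Measure Torus)) (ν := sampling h)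
    measurable_id hc (by rwa [Measure.map_id])
  obtain ⟨T', hT'⟩ := exists_comp_clm (ν := (haarAddCircle : Measure Torus)) (μ := sampling h)
    measurable_id hd (by rwa [Measure.map_id])
  let e : L2 h ≃L[ℂ] Lp ℂ 2 (haarAddCircle : Measure Torus) :=
    ContinuousLinearEquiv.equivOfInverse T T'
      (fun φ => by
        ext1
        filter_upwards [hT' (T φ), (ae_haar_iff hpos).1 (hT φ)] with x h3 h4
        rw [h3]; exact h4)
      (fun φ => by
        ext1
        filter_upwards [hT (T' φ), (ae_haar_iff hpos).2 (hT' φ)] with x h3 h4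
        rw [h3]; exact h4)
  refine ⟨(e.trans (fourierBasis.repr.toContinuousLinearEquiv)).trans
    (Hardy.isoEll2 0).symm.toContinuousLinearEquiv, fun φ => ?_⟩
  set a := (Hardy.isoEll2 0).symm (fourierBasis.repr (e φ)) with ha
  change a.coeff = _
  funext k
  have h3 : Hardy.isoEll2 0 a k = fourierBasis.repr (e φ) k := by
    rw [ha, LinearIsometryEquiv.apply_symm_apply]
  rw [Hardy.isoEll2_apply, weight_zero, Complex.ofReal_one, one_mul, fourierBasis_repr] at h3
  rw [h3]
  exact congrFun (fourierCoeff_congr_ae (hT φ)) k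

/-- The map from `L²(μ)` to sequences of Fourier coefficients. -/
def fourierEquiv (hpos : ∀ x, 0 < h x) : L2 h ≃L[ℂ] Hardy 0 := (exists_fourierEquiv hpos).choose

lemma coeff_fourierEquiv (hpos : ∀ x, 0 < h x) (φ : L2 h) :
    (fourierEquiv hpos φ).coeff = fourierCoeff (φ : Torus → ℂ) :=
  (exists_fourierEquiv hpos).choose_spec φ

/-- Parseval's formula for the bilinear pairing. -/
lemma hasSum_fourierCoeff_mul {φ ψ : Torus → ℂ}
    (hφ : MemLp φ 2 (haarAddCircle : Measure Torus))
    (hψ : MemLp ψ 2 (haarAddCircle : Measure Torus)) :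
    HasSum (fun k => fourierCoeff φ k * fourierCoeff ψ (-k)) (∫ x, φ x * ψ x ∂haarAddCircle) := by
  have h1 := (fourierBasis (T := 2 * Real.pi)).hasSum_inner_mul_inner (star (hψ.toLp)) hφ.toLp
  have h2 : inner ℂ (star hψ.toLp) hφ.toLp = ∫ x, φ x * ψ x ∂haarAddCircle := by
    rw [L2.inner_def]
    refine integral_congr_ae ?_
    filter_upwards [hφ.coeFn_toLp, hψ.coeFn_toLp, Lp.coeFn_star hψ.toLp] with x h3 h4 h5
    rw [h3, h5, Pi.star_apply, h4]
    simp
  rw [← h2]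
  have h3 : ∀ k, inner ℂ (fourierBasis (T := 2 * Real.pi) k) hφ.toLp = fourierCoeff φ k := by
    intro k
    rw [← HilbertBasis.repr_apply_apply, fourierBasis_repr]
    exact congrFun (fourierCoeff_congr_ae hφ.coeFn_toLp) k
  have h4 : ∀ k, inner ℂ (star hψ.toLp) (fourierBasis (T := 2 * Real.pi) k) =
      fourierCoeff ψ (-k) := by
    intro k
    rw [coe_fourierBasis, L2.inner_def, fourierCoeff]
    refine integral_congr_ae ?_
    filter_upwards [hψ.coeFn_toLp, Lp.coeFn_star hψ.toLp, coeFn_fourierLp 2 k] with x h5 h6 h7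
    rw [h6, h7, Pi.star_apply, h5]
    simp [mul_comm]
  simp only [h3, h4] at h1
  simpa only [mul_comm] using h1

end

section

/-! ### Analytic functions on a strip -/

open Complex

lemma isOpen_openStrip (ζ : ℝ) : IsOpen (openStrip ζ) :=
  isOpen_lt (continuous_abs.comp continuous_im) continuous_const

lemma mem_openStrip {ζ x s : ℝ} (hs : |s| < ζ) : (x + s * I : ℂ) ∈ openStrip ζ := by
  simpa [openStrip] using hs

lemma ofReal_mem_openStrip {ζ : ℝ} (hζ : 0 < ζ) (x : ℝ) : (x : ℂ) ∈ openStrip ζ := by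
  simpa [openStrip] using hζ

/-- Shift of the path of integration for a periodic analytic function. -/
lemma integral_shift {G : ℂ → ℂ} {ζ T s : ℝ} (hG : DifferentiableOn ℂ G (openStrip ζ))
    (hper : ∀ z ∈ openStrip ζ, G (z + T) = G z) (hs : |s| < ζ) :
    ∫ x in (0 : ℝ)..T, G (x + s * I) = ∫ x in (0 : ℝ)..T, G x := by
  have h := integral_boundary_rect_eq_zero_of_differentiableOn G 0 (T + s * I)
    (hG.mono fun z hz => ?_)
  · simp only [zero_re, zero_im, add_re, ofReal_re, mul_re, I_re, mul_zero, ofReal_im, I_im,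
      mul_one, sub_zero, add_zero, add_im, mul_im, zero_add, ofReal_zero, zero_mul] at h
    -- By periodicity the two vertical sides of the rectangle cancel.
    have h2 : ∫ y in (0 : ℝ)..s, G (T + y * I) = ∫ y in (0 : ℝ)..s, G (y * I) := by
      refine intervalIntegral.integral_congr fun y hy => ?_
      have hy' : |y| ≤ |s| := by
        rcases Set.mem_uIcc.1 hy with h | h
        · rw [abs_of_nonneg h.1, abs_of_nonneg (h.1.trans h.2)]; exact h.2
        · rw [abs_of_nonpos h.2, abs_of_nonpos (h.1.trans h.2)]; linarith
      have := hper (y * I) (by simpa [openStrip] using hy'.trans_lt hs)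
      rw [← this, add_comm]
    rw [h2] at h
    linear_combination -h
  · have him := (mem_reProdIm.1 hz).2
    simp only [zero_im, add_im, ofReal_im, mul_im, ofReal_re, I_im, mul_one, I_re, mul_zero,
      add_zero, zero_add] at him
    refine lt_of_le_of_lt ?_ hs
    rcases Set.mem_uIcc.1 him with h | h
    · rw [abs_of_nonneg h.1, abs_of_nonneg (h.1.trans h.2)]; exact h.2
    · rw [abs_of_nonpos h.2, abs_of_nonpos (h.1.trans h.2)]; linarith

/-- Bessel's inequality for the exponentials of period `2π` on an interval of length `2πN`. -/
lemma bessel {N : ℕ} (hN : 0 < N) {w : ℝ → ℂ} (hw : Continuous w) (S : Finset ℤ) :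
    ∑ k ∈ S, ‖∫ y in (0 : ℝ)..2 * Real.pi * N, exp (-(I * k * y)) * w y‖ ^ 2 ≤
      2 * Real.pi * N * ∫ y in (0 : ℝ)..2 * Real.pi * N, ‖w y‖ ^ 2 := by
  have hN' : (0 : ℝ) < N := by exact_mod_cast hN
  set T := 2 * Real.pi * N with hT
  have hT0 : 0 < T := by positivity
  have h1 := hasSum_sq_fourierCoeffOn (f := w) hT0
    ((memLp_two_iff_integrable_sq_norm hw.aestronglyMeasurable).2
      (by
        have : IntervalIntegrable (fun x => ‖w x‖ ^ 2) volume 0 T :=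
          (hw.norm.pow 2).intervalIntegrable _ _
        rwa [intervalIntegrable_iff_integrableOn_Ioc_of_le hT0.le] at this))
  -- Relative to the period 2πN, the exponential e^{iky} has frequency kN, so the integrals in
  -- question are a subfamily of all the Fourier coefficients.
  have hinj : Function.Injective fun k : ℤ => k * (N : ℤ) := fun a b hab =>
    mul_right_cancel₀ (by exact_mod_cast hN.ne') hab
  have h2 := (h1.summable.sum_le_tsum (S.map ⟨_, hinj⟩) fun _ _ => sq_nonneg _)
  rw [h1.tsum_eq, Finset.sum_map] at h2
  have h3 : ∀ k : ℤ, fourierCoeffOn hT0 w (k * N) =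
      (T : ℂ)⁻¹ * ∫ y in (0 : ℝ)..T, exp (-(I * k * y)) * w y := by
    intro k
    rw [fourierCoeffOn_eq_integral, sub_zero, one_div, real_smul, ofReal_inv]
    congr 1
    refine intervalIntegral.integral_congr fun y _ => ?_
    simp only [smul_eq_mul, fourier_coe_apply]
    congr 2
    rw [hT]
    push_cast
    have : (N : ℂ) ≠ 0 := by exact_mod_cast hN.ne'
    have : (Real.pi : ℂ) ≠ 0 := by exact_mod_cast Real.pi_ne_zero
    field_simp
  simp only [Function.Embedding.coeFn_mk, h3, norm_mul, norm_inv, norm_real, mul_pow,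
    ← Finset.mul_sum, Real.norm_of_nonneg hT0.le, sub_zero, smul_eq_mul] at h2
  rw [inv_pow, inv_mul_le_iff₀ (by positivity)] at h2
  refine h2.trans (le_of_eq ?_)
  field_simp

lemma continuous_comp_strip {u : ℂ → ℂ} {ζ s : ℝ} (hu : ContinuousOn u (openStrip ζ))
    (hs : |s| < ζ) : Continuous fun y : ℝ => u (y + s * I) :=
  hu.comp_continuous (by fun_prop) fun _ => mem_openStrip hs

lemma exp_periodic_int (k : ℤ) (N : ℕ) (z : ℂ) :
    exp (-(I * k * (z + (2 * Real.pi * N : ℝ)))) = exp (-(I * k * z)) := by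
  have : -(I * k * (z + (2 * Real.pi * N : ℝ))) =
      -(I * k * z) - ((k * N : ℤ) : ℂ) * (2 * Real.pi * I) := by
    push_cast; ring
  rw [this, exp_sub, exp_int_mul_two_pi_mul_I, div_one]

/-- The Fourier coefficients of an analytic function on a strip, up to normalisation, folded from
the period `2πN`. -/
lemma sum_weight_le_of_strip {u : ℂ → ℂ} {ζ t B : ℝ} {N : ℕ} (hN : 0 < N)
    (hu : DifferentiableOn ℂ u (openStrip ζ))
    (hper : ∀ z ∈ openStrip ζ, u (z + (2 * Real.pi * N : ℝ)) = u z) (ht : 0 < t) (htζ : t ≤ ζ)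
    (hB : ∀ s : ℝ, |s| < t → ∫ y in (0 : ℝ)..2 * Real.pi * N, ‖u (y + s * I)‖ ^ 2 ≤ B)
    (S : Finset ℤ) :
    ∑ k ∈ S, (weight t k * ‖∫ y in (0 : ℝ)..2 * Real.pi * N, exp (-(I * k * y)) * u y‖) ^ 2 ≤
      2 * Real.pi * N * B := by
  set c : ℤ → ℂ := fun k => ∫ y in (0 : ℝ)..2 * Real.pi * N, exp (-(I * k * y)) * u y with hc
  -- Moving the path to Im z = s shows that the k-th coefficient of u(· + is) is e^{-ks} c k;
  -- Bessel's inequality on that line bounds the weighted sum.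
  have h1 : ∀ s : ℝ, |s| < t → ∑ k ∈ S, Real.exp (-(2 * k * s)) * ‖c k‖ ^ 2 ≤
      2 * Real.pi * N * B := by
    intro s hs
    have h2 := bessel hN (continuous_comp_strip hu.continuousOn (hs.trans_le htζ)) S
    refine le_trans (le_of_eq (Finset.sum_congr rfl fun k _ => ?_))
      (h2.trans (mul_le_mul_of_nonneg_left (hB s hs) (by positivity)))
    have h3 := integral_shift (G := fun z => exp (-(I * k * z)) * u z) (T := 2 * Real.pi * N)
      (DifferentiableOn.mul (by fun_prop) hu) (fun z hz => by rw [hper z hz, exp_periodic_int])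
      (hs.trans_le htζ)
    have h4 : ∀ y : ℝ, exp (-(I * k * (y + s * I))) * u (y + s * I) =
        (Real.exp (k * s) : ℂ) * (exp (-(I * k * y)) * u (y + s * I)) := by
      intro y
      rw [← mul_assoc, ofReal_exp, ← exp_add]
      congr 2
      push_cast
      linear_combination (-(k * s : ℂ)) * I_sq
    simp only [h4] at h3
    rw [intervalIntegral.integral_const_mul] at h3
    simp only [hc]
    rw [← h3, norm_mul, norm_real, Real.norm_eq_abs, Real.abs_exp, mul_pow, ← mul_assoc,
      ← Real.exp_nat_mul, ← Real.exp_add]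
    have : -(2 * k * s) + ((2 : ℕ) : ℝ) * (k * s) = 0 := by push_cast; ring
    rw [this, Real.exp_zero, one_mul]
  -- The lines at heights s and −s together turn the exponential weight into the hyperbolic cosine.
  have h5 : ∀ s : ℝ, |s| < t → ∑ k ∈ S, Real.cosh (2 * k * s) * ‖c k‖ ^ 2 ≤
      2 * Real.pi * N * B := by
    intro s hs
    have h6 := h1 s hs
    have h7 := h1 (-s) (by rwa [abs_neg])
    calc _ = (∑ k ∈ S, Real.exp (-(2 * k * s)) * ‖c k‖ ^ 2 +
          ∑ k ∈ S, Real.exp (-(2 * k * -s)) * ‖c k‖ ^ 2) / 2 := by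
          rw [← Finset.sum_add_distrib, Finset.sum_div]
          refine Finset.sum_congr rfl fun k _ => ?_
          rw [Real.cosh_eq, mul_neg, neg_neg]
          ring
      _ ≤ _ := by linarith
  -- For t = ζ nothing is assumed on the boundary lines, so s = t is reached only as a limit; the
  -- finite sum is continuous in s.
  have h8 : Tendsto (fun s : ℝ => ∑ k ∈ S, Real.cosh (2 * k * s) * ‖c k‖ ^ 2) (𝓝[<] t)
      (𝓝 (∑ k ∈ S, Real.cosh (2 * k * t) * ‖c k‖ ^ 2)) :=
    (Continuous.tendsto (by fun_prop) t).mono_left nhdsWithin_le_nhds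
  have h9 := le_of_tendsto h8 (b := 2 * Real.pi * N * B) (by
    filter_upwards [Ioo_mem_nhdsLT ht] with s hs
    exact h5 s (by rw [abs_of_pos hs.1]; exact hs.2))
  refine le_trans (le_of_eq (Finset.sum_congr rfl fun k _ => ?_)) h9
  rw [mul_pow, weight_sq_of_nonneg ht.le]

/-! ### Subordination -/

/-- The square of a polynomial on the unit disc is majorised by a harmonic function with the right
value at `0`. -/
lemma exists_majorant (n : ℕ) (b : ℕ → ℂ) : ∃ G : Polynomial ℂ,
    G.coeff 0 = ((∑ k ∈ Finset.range n, ‖b k‖ ^ 2 : ℝ) : ℂ) ∧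
    ∀ q : ℂ, ‖q‖ ≤ 1 → ‖∑ k ∈ Finset.range n, b k * q ^ k‖ ^ 2 ≤ (G.eval q).re := by
  induction n generalizing b with
  | zero => exact ⟨0, by simp, by simp⟩
  | succ n ih =>
    obtain ⟨G, hG0, hG⟩ := ih fun k => b (k + 1)
    -- Split the sum as b₀ + qw. Its square is |b₀|² + 2 Re(b̄₀qw) + |qw|²: the middle term is the
    -- real part of a polynomial vanishing at 0, and |qw|² ≤ |w|² is handled by the induction
    -- hypothesis.
    let f : Polynomial ℂ := ∑ k ∈ Finset.range n, Polynomial.C (b (k + 1)) * Polynomial.X ^ k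
    refine ⟨Polynomial.C ((‖b 0‖ ^ 2 : ℝ) : ℂ) +
      Polynomial.X * (Polynomial.C (2 * (starRingEnd ℂ) (b 0)) * f) + G, ?_, fun q hq => ?_⟩
    · rw [Polynomial.coeff_add, Polynomial.coeff_add, Polynomial.coeff_X_mul_zero,
        Polynomial.coeff_C_zero, hG0, Finset.sum_range_succ']
      push_cast
      ring
    · have h1 := hG q hq
      set w := ∑ k ∈ Finset.range n, b (k + 1) * q ^ k with hw
      have hf : f.eval q = w := by
        simp [f, hw, Polynomial.eval_finsetSum]
      have h2 : ∑ k ∈ Finset.range (n + 1), b k * q ^ k = b 0 + q * w := by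
        rw [Finset.sum_range_succ', pow_zero, mul_one, add_comm, hw, Finset.mul_sum]
        congr 1
        exact Finset.sum_congr rfl fun k _ => by ring
      rw [h2, Polynomial.eval_add, Polynomial.eval_add, Polynomial.eval_mul, Polynomial.eval_mul,
        Polynomial.eval_C, Polynomial.eval_C, Polynomial.eval_X, hf, add_re, add_re, ofReal_re]
      have h3 : ‖b 0 + q * w‖ ^ 2 = ‖b 0‖ ^ 2 + ‖q * w‖ ^ 2 +
          (q * (2 * (starRingEnd ℂ) (b 0) * w)).re := by
        rw [← normSq_eq_norm_sq, ← normSq_eq_norm_sq, ← normSq_eq_norm_sq, normSq_add]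
        congr 1
        rw [← conj_re]
        simp only [mul_re, mul_im, conj_re, conj_im, map_mul, re_ofNat, im_ofNat]
        ring
      have h4 : ‖q * w‖ ^ 2 ≤ ‖w‖ ^ 2 := by
        rw [norm_mul]
        gcongr
        exact mul_le_of_le_one_left (norm_nonneg _) hq
      linarith

/-- The values of a trigonometric polynomial in the complex plane. -/
def trig (p : ℤ →₀ ℂ) (z : ℂ) : ℂ := p.sum fun k c => c * exp (I * k * z)

/-- The inverse `v` of the lift of an analytic circle covering of degree `σN`, `σ = ±1`,
on a strip. -/
structure IsStripLift (v : ℂ → ℂ) (ζ κ δ σ : ℝ) (N : ℕ) : Prop where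
  analytic : AnalyticOnNhd ℂ v (openStrip ζ)
  pos : 0 < ζ
  nonneg : 0 ≤ κ
  im_le : ∀ z ∈ openStrip ζ, |(v z).im| ≤ κ * |z.im|
  period : ∀ z ∈ openStrip ζ, v (z + (2 * Real.pi * N : ℝ)) = v z + (2 * Real.pi * σ : ℝ)
  lower_pos : 0 < δ
  deriv_real : ∀ x : ℝ, ∃ d : ℝ, δ ≤ σ * d ∧ deriv v x = d
  sign : σ = 1 ∨ σ = -1
  deg_pos : 0 < N

namespace IsStripLift

variable {v : ℂ → ℂ} {ζ κ δ σ : ℝ} {N : ℕ}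

lemma sign_mul_self (hv : IsStripLift v ζ κ δ σ N) : σ * σ = 1 := by
  rcases hv.sign with h | h <;> simp [h]

lemma continuousOn (hv : IsStripLift v ζ κ δ σ N) : ContinuousOn v (openStrip ζ) :=
  hv.analytic.continuousOn

lemma continuousOn_deriv (hv : IsStripLift v ζ κ δ σ N) : ContinuousOn (deriv v) (openStrip ζ) :=
  hv.analytic.deriv.continuousOn

lemma continuous_ofReal (hv : IsStripLift v ζ κ δ σ N) : Continuous fun y : ℝ => v y :=
  hv.continuousOn.comp_continuous Complex.continuous_ofReal fun y => ofReal_mem_openStrip hv.pos y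

lemma continuous_deriv_ofReal (hv : IsStripLift v ζ κ δ σ N) :
    Continuous fun y : ℝ => deriv v y :=
  hv.continuousOn_deriv.comp_continuous Complex.continuous_ofReal
    fun y => ofReal_mem_openStrip hv.pos y

lemma hasDerivAt (hv : IsStripLift v ζ κ δ σ N) (y : ℝ) :
    HasDerivAt (fun y : ℝ => v y) (deriv v y) y :=
  (hv.analytic y (ofReal_mem_openStrip hv.pos y)).differentiableAt.hasDerivAt.comp_ofReal

lemma continuous_exp_comp {w : ℝ → ℂ} (hw : Continuous w) (ε a : ℝ) :
    Continuous fun y => exp (ε * I * w y - a) := by fun_prop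

lemma integral_deriv (hv : IsStripLift v ζ κ δ σ N) :
    ∫ y in (0 : ℝ)..2 * Real.pi * N, deriv v y = (2 * Real.pi * σ : ℝ) := by
  rw [intervalIntegral.integral_eq_sub_of_hasDerivAt (fun y _ => hv.hasDerivAt y)
    (hv.continuous_deriv_ofReal.intervalIntegrable _ _)]
  have := hv.period 0 (by simpa [openStrip] using hv.pos)
  rw [zero_add] at this
  rw [this, ofReal_zero]
  ring

/-- The integrand is the derivative of q^k/(kεi) with q = exp(εiv − a), and q has period 2πN because
v changes by ±2π over that length. -/
lemma integral_exp_pow (hv : IsStripLift v ζ κ δ σ N) {ε : ℝ} (hε : ε = 1 ∨ ε = -1) (a : ℝ)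
    {k : ℕ} (hk : k ≠ 0) :
    ∫ y in (0 : ℝ)..2 * Real.pi * N, exp (ε * I * v y - a) ^ k * deriv v y = 0 := by
  have hk' : (k : ℂ) ≠ 0 := by exact_mod_cast hk
  have hε' : (ε : ℂ) ≠ 0 := by rcases hε with h | h <;> simp [h]
  have hd : ∀ y : ℝ, HasDerivAt (fun y : ℝ => (k * ε * I : ℂ)⁻¹ * exp (ε * I * v y - a) ^ k)
      (exp (ε * I * v y - a) ^ k * deriv v y) y := by
    intro y
    have h1 := ((((hv.hasDerivAt y).const_mul (ε * I : ℂ)).sub_const (a : ℂ)).cexp.pow k).const_mul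
      (k * ε * I : ℂ)⁻¹
    refine h1.congr_deriv ?_
    obtain ⟨j, rfl⟩ := Nat.exists_eq_succ_of_ne_zero hk
    rw [Nat.succ_sub_one, pow_succ]
    have := I_ne_zero
    field_simp
  rw [intervalIntegral.integral_eq_sub_of_hasDerivAt (fun y _ => hd y)]
  · have := hv.period 0 (by simpa [openStrip] using hv.pos)
    rw [zero_add] at this
    rw [this, ofReal_zero]
    have h2 : exp (ε * I * (v 0 + (2 * Real.pi * σ : ℝ)) - a) = exp (ε * I * v 0 - a) := by
      have hεσ : ∃ j : ℤ, ε * σ = j := by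
        rcases hε with h | h <;> rcases hv.sign with h' | h'
        · exact ⟨1, by simp [h, h']⟩
        · exact ⟨-1, by simp [h, h']⟩
        · exact ⟨-1, by simp [h, h']⟩
        · exact ⟨1, by simp [h, h']⟩
      obtain ⟨j, hj⟩ := hεσ
      have hj' : (ε * σ : ℂ) = j := by exact_mod_cast hj
      have : (ε * I * (v 0 + (2 * Real.pi * σ : ℝ)) - a : ℂ) =
          (ε * I * v 0 - a) + j * (2 * Real.pi * I) := by
        rw [← hj']
        push_cast
        ring
      rw [this, exp_add, exp_int_mul_two_pi_mul_I, mul_one]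
    rw [h2, sub_self]
  · exact (((continuous_exp_comp hv.continuous_ofReal ε a).pow k).mul
      hv.continuous_deriv_ofReal).intervalIntegrable _ _

/-- Only the constant term survives. This is the mean value property at the centre of the disc,
pulled back by v. -/
lemma integral_polynomial (hv : IsStripLift v ζ κ δ σ N) {ε : ℝ} (hε : ε = 1 ∨ ε = -1) (a : ℝ)
    (G : Polynomial ℂ) :
    ∫ y in (0 : ℝ)..2 * Real.pi * N, G.eval (exp (ε * I * v y - a)) * deriv v y =
      G.coeff 0 * (2 * Real.pi * σ : ℝ) := by
  have h1 : ∀ k : ℕ, Continuous fun y : ℝ =>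
      G.coeff k * exp (ε * I * v y - a) ^ k * deriv v y := fun k =>
    (continuous_const.mul ((continuous_exp_comp hv.continuous_ofReal ε a).pow k)).mul
      hv.continuous_deriv_ofReal
  simp only [Polynomial.eval_eq_sum_range, Finset.sum_mul]
  rw [intervalIntegral.integral_finsetSum fun k _ => (h1 k).intervalIntegrable _ _]
  simp only [mul_assoc (G.coeff _), intervalIntegral.integral_const_mul]
  rw [Finset.sum_range_succ', Finset.sum_eq_zero fun k _ => ?_]
  · simp only [pow_zero, one_mul, zero_add]
    rw [hv.integral_deriv]
  · rw [hv.integral_exp_pow hε a (Nat.succ_ne_zero k), mul_zero]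

/-- Since |Im v| ≤ κ|s| ≤ a, subtracting a in the exponent normalises e^{±iv} to the closed unit
disc, where the majorant is available. -/
lemma norm_exp_le (hv : IsStripLift v ζ κ δ σ N) {ε : ℝ} (hε : ε = 1 ∨ ε = -1) {a s : ℝ}
    (hs : |s| < ζ) (hsa : κ * |s| ≤ a) (y : ℝ) : ‖exp (ε * I * v (y + s * I) - a)‖ ≤ 1 := by
  rw [norm_exp, Real.exp_le_one_iff]
  have h1 := (abs_le.1 (hv.im_le _ (mem_openStrip (x := y) hs)))
  have h2 : (y + s * I : ℂ).im = s := by simp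
  rw [h2] at h1
  simp only [sub_re, mul_re, ofReal_re, I_re, mul_zero, ofReal_im, I_im, mul_one, sub_self, zero_mul,
    mul_im, add_zero, zero_sub]
  rcases hε with rfl | rfl <;> linarith

/-- Subordination for the polynomials in `e^{±iz}`. -/
lemma integral_sq_le_aux (hv : IsStripLift v ζ κ δ σ N) {ε : ℝ} (hε : ε = 1 ∨ ε = -1) {a s : ℝ}
    (hs : |s| < ζ) (hsa : κ * |s| ≤ a) (n : ℕ) (b : ℕ → ℂ) :
    ∫ y in (0 : ℝ)..2 * Real.pi * N,
      ‖∑ k ∈ Finset.range n, b k * exp (ε * I * v (y + s * I) - a) ^ k‖ ^ 2 ≤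
        2 * Real.pi * δ⁻¹ * ∑ k ∈ Finset.range n, ‖b k‖ ^ 2 := by
  obtain ⟨G, hG0, hG⟩ := exists_majorant n b
  have hT : (0 : ℝ) ≤ 2 * Real.pi * N := by positivity
  have hvs := continuous_comp_strip hv.continuousOn hs
  have hv0 := hv.continuous_ofReal
  have hvd := hv.continuous_deriv_ofReal
  let g : ℂ → ℂ := fun z => G.eval (exp (ε * I * v z - a))
  have hgs : Continuous fun y : ℝ => g (y + s * I) :=
    G.continuous.comp (continuous_exp_comp hvs ε a)
  have hg0 : Continuous fun y : ℝ => g y := G.continuous.comp (continuous_exp_comp hv0 ε a)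
  have hnn : ∀ y : ℝ, 0 ≤ (g y).re := by
    intro y
    have h1 := hv.norm_exp_le hε (s := 0) (a := a) (by rw [abs_zero]; exact hv.pos)
      (by rw [abs_zero, mul_zero]; exact (mul_nonneg hv.nonneg (abs_nonneg s)).trans hsa) y
    rw [ofReal_zero, zero_mul, add_zero] at h1
    exact (sq_nonneg _).trans (hG _ h1)
  have hre : ∀ w : ℝ → ℂ, Continuous w →
      ∫ y in (0 : ℝ)..2 * Real.pi * N, (w y).re = (∫ y in (0 : ℝ)..2 * Real.pi * N, w y).re := by
    intro w hw
    exact reCLM.intervalIntegral_comp_comm (hw.intervalIntegrable _ _)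
  -- The majorant is the real part of an analytic periodic function, so its mean over the line at
  -- height s equals its mean over the real axis; the square of the absolute value has no such
  -- invariance.
  have hshift : ∫ y in (0 : ℝ)..2 * Real.pi * N, g (y + s * I) =
      ∫ y in (0 : ℝ)..2 * Real.pi * N, g y := by
    refine integral_shift (ζ := ζ) ?_ (fun z hz => ?_) hs
    · have := hv.analytic.differentiableOn
      exact G.differentiable.comp_differentiableOn (by fun_prop)
    · simp only [g]
      rw [hv.period z hz]
      congr 1
      obtain ⟨j, hj⟩ : ∃ j : ℤ, ε * σ = j := by
        rcases hε with h | h <;> rcases hv.sign with h' | h'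
        · exact ⟨1, by simp [h, h']⟩
        · exact ⟨-1, by simp [h, h']⟩
        · exact ⟨-1, by simp [h, h']⟩
        · exact ⟨1, by simp [h, h']⟩
      have hj' : (ε * σ : ℂ) = j := by exact_mod_cast hj
      have : (ε * I * (v z + (2 * Real.pi * σ : ℝ)) - a : ℂ) =
          (ε * I * v z - a) + j * (2 * Real.pi * I) := by
        rw [← hj']
        push_cast
        ring
      rw [this, exp_add, exp_int_mul_two_pi_mul_I, mul_one]
  have hint : ∫ y in (0 : ℝ)..2 * Real.pi * N, (g y).re * (σ * (deriv v y).re) =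
      2 * Real.pi * ∑ k ∈ Finset.range n, ‖b k‖ ^ 2 := by
    have h1 : ∀ y : ℝ, (g y).re * (σ * (deriv v y).re) = (σ * (g y * deriv v y)).re := by
      intro y
      obtain ⟨d, -, hd⟩ := hv.deriv_real y
      rw [hd]
      simp
      ring
    simp only [h1]
    rw [hre (fun y => σ * (g y * deriv v y)) (continuous_const.mul (hg0.mul hvd)), intervalIntegral.integral_const_mul, hv.integral_polynomial hε, hG0]
    have h2 : (σ : ℂ) * σ = 1 := by exact_mod_cast hv.sign_mul_self
    have h3 : (σ * ((∑ k ∈ Finset.range n, ‖b k‖ ^ 2 : ℝ) * (2 * Real.pi * σ : ℝ)) : ℂ) =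
        (2 * Real.pi * ∑ k ∈ Finset.range n, ‖b k‖ ^ 2 : ℝ) := by
      push_cast
      linear_combination (2 * Real.pi * ∑ k ∈ Finset.range n, (‖b k‖ : ℂ) ^ 2) * h2
    rw [h3, ofReal_re]
  calc _ ≤ ∫ y in (0 : ℝ)..2 * Real.pi * N, (g (y + s * I)).re := by
        refine intervalIntegral.integral_mono_on hT ?_ ?_ fun y _ =>
          hG _ (hv.norm_exp_le hε hs hsa y)
        · exact ((continuous_finsetSum _ fun k _ => continuous_const.mul
            ((continuous_exp_comp hvs ε a).pow k)).norm.pow 2).intervalIntegrable _ _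
        · exact (continuous_re.comp hgs).intervalIntegrable _ _
    _ = ∫ y in (0 : ℝ)..2 * Real.pi * N, (g y).re := by rw [hre _ hgs, hshift, hre _ hg0]
    -- On the real axis the majorant is nonnegative and σv' ≥ δ, so the Jacobian of x = v(y) may be
    -- inserted at the price of δ⁻¹.
    _ ≤ ∫ y in (0 : ℝ)..2 * Real.pi * N, δ⁻¹ * ((g y).re * (σ * (deriv v y).re)) := by
        refine intervalIntegral.integral_mono_on hT ?_ ?_ fun y _ => ?_
        · exact (continuous_re.comp hg0).intervalIntegrable _ _
        · exact (continuous_const.mul ((continuous_re.comp hg0).mul (continuous_const.mul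
            (continuous_re.comp hvd)))).intervalIntegrable _ _
        · obtain ⟨d, hd, hd'⟩ := hv.deriv_real y
          rw [hd', ofReal_re, ← div_eq_inv_mul, le_div_iff₀ hv.lower_pos]
          exact mul_le_mul_of_nonneg_left hd (hnn y)
    _ = _ := by rw [intervalIntegral.integral_const_mul, hint]; ring

end IsStripLift

lemma exp_sq_le_weight_sq {t : ℝ} (ht : 0 ≤ t) (k : ℤ) :
    Real.exp (k * t) ^ 2 ≤ 2 * weight t k ^ 2 := by
  rw [weight_sq_of_nonneg ht, Real.cosh_eq, ← Real.exp_nat_mul]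
  have : ((2 : ℕ) : ℝ) * (k * t) = 2 * k * t := by push_cast; ring
  rw [this]
  linarith [Real.exp_pos (-(2 * k * t))]

/-- Subordination: composition with `v` maps `H²_{κt}` to functions which are square integrable on
the lines `Im z = s`, `|s| < t`. -/
lemma IsStripLift.integral_sq_le {v : ℂ → ℂ} {ζ κ δ σ : ℝ} {N : ℕ}
    (hv : IsStripLift v ζ κ δ σ N) {t s : ℝ} (ht : t ≤ ζ) (hs : |s| < t) (p : ℤ →₀ ℂ) :
    ∫ y in (0 : ℝ)..2 * Real.pi * N, ‖trig p (v (y + s * I))‖ ^ 2 ≤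
      8 * Real.pi * δ⁻¹ * ‖Hardy.ofFinsupp (κ * t) p‖ ^ 2 := by
  have ht0 : 0 < t := (abs_nonneg s).trans_lt hs
  set a := κ * t with ha
  have ha0 : 0 ≤ a := mul_nonneg hv.nonneg ht0.le
  have hsζ : |s| < ζ := hs.trans_le ht
  have hsa : κ * |s| ≤ a := mul_le_mul_of_nonneg_left hs.le hv.nonneg
  obtain ⟨n, hn⟩ : ∃ n : ℕ, ∀ k ∈ p.support, k.natAbs < n :=
    ⟨p.support.sup Int.natAbs + 1, fun k hk => Nat.lt_succ_of_le (Finset.le_sup hk)⟩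
  have hp : ∀ k : ℤ, n ≤ k.natAbs → p k = 0 := fun k hk => by
    by_contra h
    exact absurd (hn k (Finsupp.mem_support_iff.2 h)) (not_lt.2 hk)
  have hsplit : ∀ {M : Type} [NormedAddCommGroup M] (g : ℤ → M), (∀ k, p k = 0 → g k = 0) →
      ∑ k ∈ p.support, g k = ∑ k ∈ Finset.range n, g k +
        ∑ k ∈ Finset.range n, g (-(k + 1)) := by
    intro M _ g hg
    refine (hasSum_sum_of_ne_finset_zero fun k hk => hg k (Finsupp.notMem_support_iff.1 hk)).unique
      (HasSum.of_nat_of_neg_add_one ?_ ?_)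
    · exact hasSum_sum_of_ne_finset_zero fun k hk => hg _ (hp _ (by simpa using hk))
    · exact hasSum_sum_of_ne_finset_zero fun k hk => hg _ (hp _ (by
        have : n ≤ k := by simpa using hk
        omega))
  -- The polynomial is expanded in powers of e^{iz − a} and e^{-iz − a}, and the factor e^{|k|a}
  -- moves into the coefficients. Negative frequencies start at −1, hence the shift by one and the
  -- extra factor e^{-iz − a} in `hfg`.
  let b : ℕ → ℂ := fun k => p k * Real.exp ((k : ℤ) * a)
  let c : ℕ → ℂ := fun k => p (-(k + 1)) * Real.exp (((k + 1 : ℤ)) * a)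
  let f : ℂ → ℂ := fun z => ∑ k ∈ Finset.range n, b k * exp ((1 : ℝ) * I * z - a) ^ k
  let g : ℂ → ℂ := fun z => ∑ k ∈ Finset.range n, c k * exp ((-1 : ℝ) * I * z - a) ^ k
  have hfg : ∀ z, trig p z = f z + exp ((-1 : ℝ) * I * z - a) * g z := by
    intro z
    rw [trig, Finsupp.sum, hsplit _ fun k hk => by rw [hk, zero_mul]]
    congr 1
    · refine Finset.sum_congr rfl fun k _ => ?_
      simp only [b]
      rw [← exp_nat_mul, mul_assoc (p _), ofReal_exp, ← exp_add]
      congr 2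
      push_cast
      ring
    · rw [Finset.mul_sum]
      refine Finset.sum_congr rfl fun k _ => ?_
      simp only [c]
      rw [mul_left_comm, ← pow_succ', ← exp_nat_mul, mul_assoc (p _), ofReal_exp, ← exp_add]
      congr 2
      push_cast
      ring
  have hvs := continuous_comp_strip hv.continuousOn hsζ
  have hf : Continuous fun y : ℝ => f (v (y + s * I)) :=
    (show Continuous f by fun_prop).comp hvs
  have hg : Continuous fun y : ℝ => g (v (y + s * I)) :=
    (show Continuous g by fun_prop).comp hvs
  have hpt : ∀ y : ℝ, ‖trig p (v (y + s * I))‖ ^ 2 ≤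
      2 * (‖f (v (y + s * I))‖ ^ 2 + ‖g (v (y + s * I))‖ ^ 2) := by
    intro y
    have h1 := hv.norm_exp_le (ε := -1) (Or.inr rfl) hsζ hsa y
    have h2 : ‖trig p (v (y + s * I))‖ ≤ ‖f (v (y + s * I))‖ + ‖g (v (y + s * I))‖ := by
      rw [hfg]
      refine (norm_add_le _ _).trans ?_
      gcongr
      rw [norm_mul]
      exact mul_le_of_le_one_left (norm_nonneg _) h1
    calc _ ≤ (‖f (v (y + s * I))‖ + ‖g (v (y + s * I))‖) ^ 2 := by gcongr
      _ ≤ _ := by nlinarith [sq_nonneg (‖f (v (y + s * I))‖ - ‖g (v (y + s * I))‖)]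
  have htrig : Continuous fun y : ℝ => trig p (v (y + s * I)) := by
    simp only [hfg]
    exact hf.add ((continuous_exp_comp hvs _ _).mul hg)
  have hcoef : ∑ k ∈ Finset.range n, ‖b k‖ ^ 2 + ∑ k ∈ Finset.range n, ‖c k‖ ^ 2 ≤
      2 * ‖Hardy.ofFinsupp a p‖ ^ 2 := by
    rw [Hardy.norm_sq_ofFinsupp p le_rfl, hsplit _ fun k hk => by simp [hk], mul_add,
      Finset.mul_sum, Finset.mul_sum]
    have h3 : ∀ (k : ℤ) (z : ℂ), ‖z * Real.exp (k * a)‖ ^ 2 ≤ 2 * (weight a k * ‖z‖) ^ 2 := by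
      intro k z
      rw [norm_mul, norm_real, Real.norm_eq_abs, Real.abs_exp, mul_pow, mul_pow]
      nlinarith [exp_sq_le_weight_sq ha0 k, sq_nonneg ‖z‖]
    gcongr with k _ k _
    · exact h3 k (p k)
    · rw [weight_neg_int]
      have := h3 (k + 1) (p (-(k + 1)))
      simpa [c] using this
  calc _ ≤ ∫ y in (0 : ℝ)..2 * Real.pi * N,
        2 * (‖f (v (y + s * I))‖ ^ 2 + ‖g (v (y + s * I))‖ ^ 2) :=
        intervalIntegral.integral_mono_on (by positivity)
          ((htrig.norm.pow 2).intervalIntegrable _ _)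
          ((continuous_const.mul ((hf.norm.pow 2).add (hg.norm.pow 2))).intervalIntegrable _ _) fun y _ => hpt y
    _ = 2 * (∫ y in (0 : ℝ)..2 * Real.pi * N, ‖f (v (y + s * I))‖ ^ 2) +
        2 * ∫ y in (0 : ℝ)..2 * Real.pi * N, ‖g (v (y + s * I))‖ ^ 2 := by
        rw [intervalIntegral.integral_const_mul, intervalIntegral.integral_add, mul_add]
        · exact (hf.norm.pow 2).intervalIntegrable _ _
        · exact (hg.norm.pow 2).intervalIntegrable _ _
    _ ≤ 2 * (2 * Real.pi * δ⁻¹ * ∑ k ∈ Finset.range n, ‖b k‖ ^ 2) +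
        2 * (2 * Real.pi * δ⁻¹ * ∑ k ∈ Finset.range n, ‖c k‖ ^ 2) := by
        gcongr
        · exact hv.integral_sq_le_aux (Or.inl rfl) hsζ hsa n b
        · exact hv.integral_sq_le_aux (Or.inr rfl) hsζ hsa n c
    _ = 4 * Real.pi * δ⁻¹ *
        (∑ k ∈ Finset.range n, ‖b k‖ ^ 2 + ∑ k ∈ Finset.range n, ‖c k‖ ^ 2) := by ring
    _ ≤ 4 * Real.pi * δ⁻¹ * (2 * ‖Hardy.ofFinsupp a p‖ ^ 2) := by
        have := hv.lower_pos
        gcongr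
    _ = _ := by ring

end

section

/-! ### The lift of the circle map -/

open Complex

variable {f : Torus → Torus} {F : ℝ ≃ₜ ℝ}

/-- The increment of F over one turn, divided by 2π, is continuous and integer-valued, hence
constant. It is not zero because F is injective. -/
lemma exists_degree (hF : ∀ x : ℝ, ((F x : ℝ) : Torus) = f (x : Torus)) :
    ∃ d : ℤ, d ≠ 0 ∧ ∀ x, F (x + 2 * Real.pi) = F x + 2 * Real.pi * d := by
  let g : ℝ → ℝ := fun x => (F (x + 2 * Real.pi) - F x) / (2 * Real.pi)
  have hg : Continuous g := by
    have := F.continuous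
    fun_prop
  have hpi : 2 * Real.pi ≠ 0 := Real.two_pi_pos.ne'
  have hm : ∀ x, ∃ n : ℤ, g x = n := by
    intro x
    have h1 : ((F (x + 2 * Real.pi) - F x : ℝ) : Torus) = 0 := by
      rw [AddCircle.coe_sub, hF, hF, AddCircle.coe_add_period, sub_self]
    obtain ⟨n, hn⟩ := (AddCircle.coe_eq_zero_iff _).1 h1
    refine ⟨n, ?_⟩
    simp only [g]
    rw [← hn, zsmul_eq_mul, mul_div_cancel_right₀ _ hpi]
  have hconst : ∀ x, g x = g 0 := fun x =>
    isPreconnected_univ.constant_of_mapsTo (T := Set.range ((↑) : ℤ → ℝ))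
      (isDiscrete_iff_discreteTopology.2
        (Int.isClosedEmbedding_coe_real.isEmbedding.toHomeomorph.symm.isEmbedding.discreteTopology))
      hg.continuousOn (fun y _ => by obtain ⟨n, hn⟩ := hm y; exact ⟨n, hn.symm⟩) trivial trivial
  obtain ⟨d, hd⟩ := hm 0
  have h2 : ∀ x, F (x + 2 * Real.pi) = F x + 2 * Real.pi * d := by
    intro x
    have h3 := hconst x
    rw [hd, div_eq_iff hpi] at h3
    linarith
  refine ⟨d, ?_, h2⟩
  rintro rfl
  have h4 := h2 0
  rw [Int.cast_zero, mul_zero, add_zero] at h4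
  exact hpi (by simpa using F.injective h4)

lemma symm_add_degree {d : ℤ} (hd : ∀ x, F (x + 2 * Real.pi) = F x + 2 * Real.pi * d) (y : ℝ) :
    F.symm (y + 2 * Real.pi * d) = F.symm y + 2 * Real.pi := by
  rw [Homeomorph.symm_apply_eq, hd, Homeomorph.apply_symm_apply]

/-- One turn of F advances by 2πd, so the inverse advances by one turn over 2πd. For negative d the
positive period 2π|d| is used instead, and the advance changes sign. -/
lemma exists_symm_period (hF : ∀ x : ℝ, ((F x : ℝ) : Torus) = f (x : Torus)) :
    ∃ (N : ℕ) (σ : ℝ), 0 < N ∧ (σ = 1 ∨ σ = -1) ∧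
      ∀ y, F.symm (y + 2 * Real.pi * N) = F.symm y + 2 * Real.pi * σ := by
  obtain ⟨d, hd0, hd⟩ := exists_degree hF
  refine ⟨d.natAbs, if 0 < d then 1 else -1, Int.natAbs_pos.2 hd0, by split_ifs <;> simp,
    fun y => ?_⟩
  split_ifs with h
  · have h1 : (d.natAbs : ℝ) = d := by
      rw [Nat.cast_natAbs, abs_of_pos h]
    rw [h1, symm_add_degree hd, mul_one]
  · have h1 : (d.natAbs : ℝ) = -d := by
      rw [Nat.cast_natAbs, abs_of_nonpos (not_lt.1 h), Int.cast_neg]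
    have h2 := symm_add_degree hd (y + 2 * Real.pi * d.natAbs)
    rw [h1] at h2 ⊢
    rw [add_assoc, ← mul_add, neg_add_cancel, mul_zero, add_zero] at h2
    rw [h2]
    ring

lemma convex_closedStrip (ζ : ℝ) : Convex ℝ (closedStrip ζ) := by
  have : closedStrip ζ = Complex.imLm ⁻¹' Set.Icc (-ζ) ζ := by
    ext z
    simp [closedStrip, abs_le]
  rw [this]
  exact (convex_Icc _ _).linear_preimage _

lemma convex_openStrip (ζ : ℝ) : Convex ℝ (openStrip ζ) := by
  have : openStrip ζ = Complex.imLm ⁻¹' Set.Ioo (-ζ) ζ := by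
    ext z
    simp [openStrip, abs_lt]
  rw [this]
  exact (convex_Ioo _ _).linear_preimage _

lemma openStrip_subset_closedStrip (ζ : ℝ) : openStrip ζ ⊆ closedStrip ζ := fun z hz =>
  (show |z.im| < ζ from hz).le

/-- Analytic functions on a strip which agree on the real axis agree. -/
lemma eqOn_openStrip {u w : ℂ → ℂ} {ζ : ℝ} (hζ : 0 < ζ) (hu : AnalyticOnNhd ℂ u (openStrip ζ))
    (hw : AnalyticOnNhd ℂ w (openStrip ζ)) (h : ∀ x : ℝ, u x = w x) :
    Set.EqOn u w (openStrip ζ) := by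
  refine hu.eqOn_of_preconnected_of_frequently_eq hw (convex_openStrip ζ).isPreconnected
    (ofReal_mem_openStrip hζ 0) ?_
  have h1 : Tendsto (fun n : ℕ => (((1 : ℝ) / (n + 1) : ℝ) : ℂ)) atTop (𝓝[≠] ((0 : ℝ) : ℂ)) := by
    rw [tendsto_nhdsWithin_iff]
    refine ⟨(continuous_ofReal.tendsto 0).comp tendsto_one_div_add_atTop_nhds_zero_nat,
      Eventually.of_forall fun n => ?_⟩
    have : (1 : ℝ) / (n + 1) ≠ 0 := by positivity
    rw [Set.mem_compl_singleton_iff]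
    exact_mod_cast this
  exact h1.frequently (Frequently.of_forall fun n => h _)

lemma add_mem_openStrip {ζ : ℝ} {z : ℂ} (hz : z ∈ openStrip ζ) (c : ℝ) :
    z + c ∈ openStrip ζ := by
  simpa [openStrip] using hz

/-- The inverse of the lift of an analytic expanding circle map. -/
lemma IsAnalyticExpanding.exists_lift {ζ κ α D : ℝ} (hζ : 0 < ζ)
    (hf : IsAnalyticExpanding f ζ κ α D) :
    ∃ (F : ℝ ≃ₜ ℝ) (v : ℂ → ℂ) (δ σ : ℝ) (N : ℕ),
      (∀ x : ℝ, ((F x : ℝ) : Torus) = f (x : Torus)) ∧ (∀ x : ℝ, v x = (F.symm x : ℝ)) ∧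
      IsStripLift v ζ κ δ σ N ∧ (∀ z ∈ openStrip ζ, ‖deriv v z‖ ≤ κ) ∧ 0 < κ := by
  obtain ⟨F, v, hF, hvF, hv, hvκ, g, hg, -⟩ := hf
  obtain ⟨N, σ, hN, hσ, hper⟩ := exists_symm_period hF
  have hsub := openStrip_subset_closedStrip ζ
  have hmem : ∀ x : ℝ, (x : ℂ) ∈ closedStrip ζ := fun x => hsub (ofReal_mem_openStrip hζ x)
  -- The derivative is an exponential, so it has no zero and its bound is positive.
  have hκ : 0 < κ := by
    refine lt_of_lt_of_le ?_ (hvκ _ (hmem 0))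
    rw [← hg _ (hmem 0), norm_pos_iff]
    exact exp_ne_zero _
  have hd : ∀ x : ℝ, HasDerivAt v (deriv v x) (x : ℂ) := fun x =>
    (hv x (hmem x)).differentiableAt.hasDerivAt
  have hre : ∀ x : ℝ, HasDerivAt (fun y : ℝ => F.symm y) (deriv v x).re x := by
    intro x
    have := (hd x).real_of_complex
    simpa only [hvF, ofReal_re] using this
  have him : ∀ x : ℝ, (deriv v x).im = 0 := by
    intro x
    have h1 : HasDerivAt (fun y : ℝ => imCLM (v y)) (imCLM (deriv v x)) x :=
      imCLM.hasFDerivAt.comp_hasDerivAt x (hd x).comp_ofReal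
    have h2 : (fun y : ℝ => imCLM (v y)) = fun _ => 0 := by
      funext y
      rw [hvF]
      simp
    rw [h2] at h1
    exact (h1.unique (hasDerivAt_const x (0 : ℝ)))
  set w : ℝ → ℝ := deriv F.symm with hw
  have hwv : ∀ x : ℝ, deriv v x = (w x : ℂ) := by
    intro x
    rw [hw, (hre x).deriv]
    exact Complex.ext (ofReal_re _).symm (by rw [him, ofReal_im])
  have hw0 : ∀ x, w x ≠ 0 := by
    intro x h0
    have := hwv x
    rw [← hg _ (hmem x), h0, ofReal_zero] at this
    exact exp_ne_zero _ this
  have hwc : Continuous w := by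
    have h1 : Continuous fun x : ℝ => (deriv v x).re :=
      continuous_re.comp (hv.deriv.continuousOn.comp_continuous continuous_ofReal hmem)
    simpa only [hwv, ofReal_re] using h1
  have hwper : Function.Periodic w (2 * Real.pi * N) := by
    intro x
    rw [hw, ← deriv_comp_add_const]
    simp only [hper]
    rw [deriv_add_const]
  have hT : 0 < 2 * Real.pi * N := by
    have : (0 : ℝ) < N := by exact_mod_cast hN
    positivity
  -- The inverse lift is strictly monotone, and its increment 2πσ over a period decides the
  -- direction; that the derivative has no zero makes the sign strict.
  have hσw : ∀ x, 0 < σ * w x := by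
    have hσpos : ∀ x, 0 ≤ σ * w x := by
      intro x
      have h0 := hper 0
      rw [zero_add] at h0
      rcases F.symm.continuous.strictMono_of_inj F.symm.injective with hm | hm
      · have h1 := hm hT
        rw [h0] at h1
        have h2 : σ = 1 := by
          rcases hσ with h | h
          · exact h
          · rw [h] at h1; linarith [Real.pi_pos]
        rw [h2, one_mul, hw, ← derivWithin_univ]
        exact (hm.monotone.monotoneOn _).derivWithin_nonneg
      · have h1 := hm hT
        rw [h0] at h1
        have h2 : σ = -1 := by
          rcases hσ with h | h
          · rw [h] at h1; linarith [Real.pi_pos]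
          · exact h
        rw [h2, neg_one_mul, neg_nonneg, hw, ← derivWithin_univ]
        exact (hm.antitone.antitoneOn _).derivWithin_nonpos
    intro x
    refine lt_of_le_of_ne (hσpos x) (Ne.symm (mul_ne_zero ?_ (hw0 x)))
    rcases hσ with h | h <;> simp [h]
  -- The minimum over one closed period serves as δ; periodicity makes it a lower bound on the whole
  -- line.
  obtain ⟨x₀, -, hx₀⟩ := isCompact_Icc.exists_isMinOn (Set.nonempty_Icc.2 hT.le)
    (continuous_const.mul hwc : Continuous fun x => σ * w x).continuousOn
  refine ⟨F, v, σ * w x₀, σ, N, hF, hvF, ⟨hv.mono hsub, hζ, hκ.le, fun z hz => ?_, ?_, hσw x₀,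
    fun x => ⟨w x, ?_, hwv x⟩, hσ, hN⟩, fun z hz => hvκ z (hsub hz), hκ⟩
  -- Compare z with its real part, where v is real: the mean value inequality bounds |Im v(z)| by
  -- κ|z − Re z| = κ|Im z|.
  · have h1 := (convex_closedStrip ζ).norm_image_sub_le_of_norm_deriv_le
      (fun x hx => (hv x hx).differentiableAt) hvκ (hmem z.re) (hsub hz)
    have h2 : z - z.re = z.im * I := by
      rw [sub_eq_iff_eq_add, add_comm]
      exact (re_add_im z).symm
    rw [h2, norm_mul, norm_I, mul_one, norm_real] at h1
    refine le_trans ?_ h1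
    have h3 : (v z).im = (v z - v z.re).im := by
      rw [sub_im, hvF, ofReal_im, sub_zero]
    rw [h3]
    exact abs_im_le_norm _
  · refine eqOn_openStrip hζ ?_ ((hv.mono hsub).add analyticOnNhd_const) fun x => ?_
    · intro z hz
      exact (hv _ (hsub (add_mem_openStrip hz _))).comp_of_eq
        (analyticAt_id.add analyticAt_const) rfl
    · rw [← ofReal_add, hvF, hper, hvF]
      push_cast
      ring
  · obtain ⟨y, hy, hxy⟩ := hwper.exists_mem_Ico₀ hT x
    rw [hxy]
    exact hx₀ (Set.Ico_subset_Icc_self hy)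

/-! ### Composition with the circle map -/

lemma lintegral_Ioc_le (g : Torus → ℝ≥0∞) (a : ℝ) (n : ℕ) :
    ∫⁻ x in Set.Ioc a (a + 2 * Real.pi * n), g x ≤ n * ∫⁻ x, g x := by
  induction n with
  | zero => simp
  | succ n ih =>
    have h1 : Set.Ioc a (a + 2 * Real.pi * (n + 1 : ℕ)) ⊆ Set.Ioc a (a + 2 * Real.pi * n) ∪
        Set.Ioc (a + 2 * Real.pi * n) (a + 2 * Real.pi * n + 2 * Real.pi) := by
      rw [Set.Ioc_union_Ioc_eq_Ioc]
      · refine Set.Ioc_subset_Ioc_right (le_of_eq ?_)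
        push_cast
        ring
      · have := Real.pi_pos
        have : 0 ≤ 2 * Real.pi * n := by positivity
        linarith
      · linarith [Real.pi_pos]
    refine (lintegral_mono_set h1).trans ((lintegral_union_le _ _ _).trans ?_)
    rw [AddCircle.lintegral_preimage]
    push_cast
    rw [add_mul, one_mul]
    gcongr

/-- The circle map distorts the Lebesgue measure boundedly. -/
lemma exists_map_volume_le {w : ℝ → ℝ} {κ : ℝ}
    (hF : ∀ x : ℝ, ((F x : ℝ) : Torus) = f (x : Torus))
    (hd : ∀ y, HasDerivAt F.symm (w y) y) (hw : ∀ y, |w y| ≤ κ) (hf : Measurable f) :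
    ∃ c : ℝ≥0∞, c ≠ ∞ ∧ (volume : Measure Torus).map f ≤ c • volume := by
  -- The lift sends a fundamental domain to a bounded set, which is covered by 2n periods, n on
  -- either side of 0. Each point of the circle is then counted at most 2n times in the change of
  -- variables.
  obtain ⟨R, hR⟩ := ((isCompact_Icc (a := (0 : ℝ)) (b := 0 + 2 * Real.pi)).image
    F.continuous).isBounded.subset_ball 0
  obtain ⟨n, hn⟩ := exists_nat_gt R
  refine ⟨ENNReal.ofReal κ * (n + n : ℕ), ENNReal.mul_ne_top ENNReal.ofReal_ne_top
    (ENNReal.natCast_ne_top _), Measure.le_iff.2 fun E hE => ?_⟩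
  set s := F '' Set.Ioc 0 (0 + 2 * Real.pi) with hs
  have hsm : MeasurableSet s := F.measurableEmbedding.measurableSet_image.2 measurableSet_Ioc
  have himg : F.symm '' s = Set.Ioc 0 (0 + 2 * Real.pi) := by
    rw [hs, ← Set.image_comp]
    simp
  let g : Torus → ℝ≥0∞ := E.indicator 1
  have hsub : s ⊆ Set.Ioc (-(2 * Real.pi * n)) (-(2 * Real.pi * n) + 2 * Real.pi * (n + n : ℕ)) := by
    intro y hy
    have h1 := hR (Set.image_mono Set.Ioc_subset_Icc_self hy)
    rw [mem_ball_zero_iff, Real.norm_eq_abs, abs_lt] at h1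
    have h2 : (n : ℝ) ≤ 2 * Real.pi * n := by
      have := Real.pi_gt_three
      have : (0 : ℝ) ≤ n := Nat.cast_nonneg n
      nlinarith
    push_cast
    constructor <;> linarith
  calc (volume : Measure Torus).map f E = ∫⁻ x, g (f x) := by
        rw [Measure.map_apply hf hE, ← lintegral_indicator_one (hf hE)]
        rfl
    _ = ∫⁻ x in F.symm '' s, g (F x : ℝ) := by
        rw [← AddCircle.lintegral_preimage _ 0, himg]
        simp only [hF]
    _ = ∫⁻ y in s, ENNReal.ofReal |w y| * g (y : ℝ) := by
        rw [lintegral_image_eq_lintegral_abs_deriv_mul hsm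
          (fun y _ => (hd y).hasDerivWithinAt) F.symm.injective.injOn]
        simp
    _ ≤ ∫⁻ y in s, ENNReal.ofReal κ * g (y : ℝ) := by
        refine lintegral_mono fun y => ?_
        gcongr
        exact hw y
    _ = ENNReal.ofReal κ * ∫⁻ y in s, g (y : ℝ) := lintegral_const_mul' _ _ ENNReal.ofReal_ne_top
    _ ≤ ENNReal.ofReal κ * ((n + n : ℕ) * ∫⁻ x, g x) := by
        gcongr
        exact (lintegral_mono_set hsub).trans (lintegral_Ioc_le g _ _)
    _ = _ := by
        rw [lintegral_indicator_one hE, Measure.smul_apply, smul_eq_mul, mul_assoc]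

lemma continuous_of_lift (hF : ∀ x : ℝ, ((F x : ℝ) : Torus) = f (x : Torus)) : Continuous f := by
  have : Continuous (f ∘ ((↑) : ℝ → Torus)) := by
    have h1 : f ∘ ((↑) : ℝ → Torus) = fun x => ((F x : ℝ) : Torus) := by
      funext x
      exact (hF x).symm
    rw [h1]
    exact (AddCircle.continuous_mk' _).comp F.continuous
  exact (QuotientAddGroup.isQuotientMap_mk _).continuous_iff.2 this

end

section

/-! ### Multiplication and composition operators on `H²_s` -/

open Complex AddCircle

lemma Hardy.clm_ext {s : ℝ} {E : Type*} [NormedAddCommGroup E] [NormedSpace ℂ E]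
    {L L' : Hardy s →L[ℂ] E}
    (h : ∀ k, L (ofFinsupp s (Finsupp.single k 1)) = L' (ofFinsupp s (Finsupp.single k 1))) :
    L = L' := by
  have h1 : (L : Hardy s →ₗ[ℂ] E) ∘ₗ ofFinsupp s = (L' : Hardy s →ₗ[ℂ] E) ∘ₗ ofFinsupp s := by
    refine Finsupp.lhom_ext fun k z => ?_
    have h2 : Finsupp.single k z = z • Finsupp.single k (1 : ℂ) := by simp
    rw [h2, map_smul, map_smul]
    exact congrArg _ (h k)
  have h3 := (denseRange_ofFinsupp s).equalizer L.continuous L'.continuous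
    (funext fun p => LinearMap.congr_fun h1 p)
  exact ContinuousLinearMap.ext fun a => congrFun h3 a

/-- Trigonometric polynomials as functions on the circle. -/
def trigC (p : ℤ →₀ ℂ) : C(Torus, ℂ) := p.sum fun k c => c • fourier k

lemma fourier_coe (k : ℤ) (x : ℝ) : fourier k (x : Torus) = exp (I * k * x) := by
  rw [fourier_coe_apply]
  congr 1
  have : (Real.pi : ℂ) ≠ 0 := by exact_mod_cast Real.pi_ne_zero
  push_cast
  field_simp

lemma trigC_apply (p : ℤ →₀ ℂ) (x : Torus) : trigC p x = p.sum fun k c => c * fourier k x := by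
  rw [trigC, Finsupp.sum, ContinuousMap.sum_apply]
  rfl

lemma trigC_coe (p : ℤ →₀ ℂ) (x : ℝ) : trigC p (x : Torus) = trig p x := by
  rw [trigC_apply, trig]
  simp only [fourier_coe]

lemma trigC_single (k : ℤ) : trigC (Finsupp.single k 1) = fourier k := by
  rw [trigC, Finsupp.sum_single_index (by simp), one_smul]

lemma fourierCoeff_eq (φ : Torus → ℂ) (k : ℤ) : fourierCoeff φ k =
    (2 * Real.pi : ℂ)⁻¹ * ∫ y in (0 : ℝ)..2 * Real.pi, exp (-(I * k * y)) * φ (y : Torus) := by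
  rw [fourierCoeff_eq_intervalIntegral _ _ 0, zero_add, real_smul]
  congr 1
  · push_cast
    rw [one_div]
  · refine intervalIntegral.integral_congr fun y _ => ?_
    simp only [smul_eq_mul, fourier_coe]
    congr 2
    push_cast
    ring

lemma integrable_haar (g : C(Torus, ℂ)) : Integrable g (haarAddCircle : Measure Torus) :=
  g.continuous.integrable_of_hasCompactSupport (HasCompactSupport.of_compactSpace _)

lemma fourierCoeff_trigC (p : ℤ →₀ ℂ) : fourierCoeff (trigC p) = p := by
  induction p using Finsupp.induction_linear with
  | zero =>
    funext k
    simp [trigC, fourierCoeff]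
  | add p q hp hq =>
    have h1 : trigC (p + q) = trigC p + trigC q :=
      Finsupp.sum_add_index' (by simp) (by simp [add_smul])
    rw [h1, ContinuousMap.coe_add, fourierCoeff.add (integrable_haar _) (integrable_haar _), hp, hq]
    rfl
  | single k z =>
    have h1 : trigC (Finsupp.single k z) = z • fourier k := Finsupp.sum_single_index (by simp)
    funext j
    rw [h1, ContinuousMap.coe_smul, fourierCoeff.const_smul, fourierCoeff_fourier]
    rcases eq_or_ne j k with rfl | hj
    · simp
    · simp [hj, Finsupp.single_eq_of_ne hj]

section L2

variable {h : C(Torus, ℝ)} (hpos : ∀ x, 0 < h x)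

lemma coeff_fourierEquiv_toLp (g : C(Torus, ℂ)) :
    (fourierEquiv hpos (ContinuousMap.toLp 2 (sampling h) ℂ g)).coeff = fourierCoeff g := by
  rw [coeff_fourierEquiv]
  exact fourierCoeff_congr_ae ((ae_haar_iff hpos).2 (ContinuousMap.coeFn_toLp _ g))

lemma fourierEquiv_trigC (p : ℤ →₀ ℂ) :
    fourierEquiv hpos (ContinuousMap.toLp 2 (sampling h) ℂ (trigC p)) = Hardy.ofFinsupp 0 p :=
  Hardy.coeff_injective (by
    rw [coeff_fourierEquiv_toLp, fourierCoeff_trigC, Hardy.coeff_ofFinsupp])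

/-- An operator on `L²(μ)` in terms of Fourier coefficients. -/
def onCoeff (T : L2 h →L[ℂ] L2 h) : Hardy 0 →L[ℂ] Hardy 0 :=
  (fourierEquiv hpos : L2 h →L[ℂ] Hardy 0) ∘L T ∘L ((fourierEquiv hpos).symm : Hardy 0 →L[ℂ] L2 h)

lemma onCoeff_fourierEquiv (T : L2 h →L[ℂ] L2 h) (φ : L2 h) :
    onCoeff hpos T (fourierEquiv hpos φ) = fourierEquiv hpos (T φ) := by
  simp [onCoeff]

lemma onCoeff_ofFinsupp (T : L2 h →L[ℂ] L2 h) (p : ℤ →₀ ℂ) :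
    onCoeff hpos T (Hardy.ofFinsupp 0 p) =
      fourierEquiv hpos (T (ContinuousMap.toLp 2 (sampling h) ℂ (trigC p))) := by
  rw [← fourierEquiv_trigC hpos, onCoeff_fourierEquiv]

/-- Multiplication by a continuous function. -/
lemma exists_mulL2 (h : C(Torus, ℝ)) (g : C(Torus, ℂ)) : ∃ T : L2 h →L[ℂ] L2 h,
    ∀ φ : L2 h, T φ =ᵐ[sampling h] fun x => g x * φ x := by
  have hb : ∀ (φ : L2 h) x, ‖g x * φ x‖ ≤ ‖g‖ * ‖φ x‖ := fun φ x => by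
    rw [norm_mul]
    gcongr
    exact g.norm_coe_le_norm x
  have hm : ∀ φ : L2 h, MemLp (fun x => g x * φ x) 2 (sampling h) := fun φ =>
    (Lp.memLp φ).of_le_mul (g.continuous.aestronglyMeasurable.mul (Lp.aestronglyMeasurable φ))
      (Eventually.of_forall (hb φ))
  let L : L2 h →ₗ[ℂ] L2 h :=
    { toFun := fun φ => MemLp.toLp (fun x => g x * φ x) (hm φ)
      map_add' := fun φ ψ => by
        ext1
        filter_upwards [(hm (φ + ψ)).coeFn_toLp, (hm φ).coeFn_toLp, (hm ψ).coeFn_toLp,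
          Lp.coeFn_add (MemLp.toLp _ (hm φ)) (MemLp.toLp _ (hm ψ)), Lp.coeFn_add φ ψ] with x h1 h2 h3 h4 h5
        rw [h1, h4, Pi.add_apply, h2, h3, h5, Pi.add_apply, mul_add]
      map_smul' := fun r φ => by
        ext1
        filter_upwards [(hm (r • φ)).coeFn_toLp, (hm φ).coeFn_toLp,
          Lp.coeFn_smul r (MemLp.toLp _ (hm φ)), Lp.coeFn_smul r φ] with x h1 h2 h3 h4
        rw [h1, RingHom.id_apply, h3, Pi.smul_apply, h2, h4, Pi.smul_apply, smul_eq_mul,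
          smul_eq_mul, mul_left_comm] }
  refine ⟨L.mkContinuous ‖g‖ fun φ => Lp.norm_le_mul_norm_of_ae_le_mul ?_,
    fun φ => (hm φ).coeFn_toLp⟩
  filter_upwards [(hm φ).coeFn_toLp] with x hx
  change ‖MemLp.toLp _ (hm φ) x‖ ≤ _
  rw [hx]
  exact hb φ x

/-- Multiplication by a continuous function, as an operator on `L²(μ)`. -/
def mulL2 (h : C(Torus, ℝ)) (g : C(Torus, ℂ)) : L2 h →L[ℂ] L2 h := (exists_mulL2 h g).choose

lemma coeFn_mulL2 (g : C(Torus, ℂ)) (φ : L2 h) :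
    mulL2 h g φ =ᵐ[sampling h] fun x => g x * φ x := (exists_mulL2 h g).choose_spec φ

lemma coeff_mulL2 (g : C(Torus, ℂ)) (φ : L2 h) :
    (onCoeff hpos (mulL2 h g) (fourierEquiv hpos φ)).coeff =
      fourierCoeff fun x => g x * φ x := by
  rw [onCoeff_fourierEquiv, coeff_fourierEquiv]
  exact fourierCoeff_congr_ae ((ae_haar_iff hpos).2 (coeFn_mulL2 g φ))

lemma coeff_mulL2_ofFinsupp (g : C(Torus, ℂ)) (p : ℤ →₀ ℂ) :
    (onCoeff hpos (mulL2 h g) (Hardy.ofFinsupp 0 p)).coeff =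
      fourierCoeff fun x => g x * trigC p x := by
  rw [← fourierEquiv_trigC hpos, coeff_mulL2]
  refine fourierCoeff_congr_ae ((ae_haar_iff hpos).2 ?_)
  filter_upwards [ContinuousMap.coeFn_toLp (𝕜 := ℂ) (p := 2) (sampling h) (trigC p)] with x hx
  rw [hx]

end L2

/-- Boundedness of weighted composition operators from `H²_{κt}` to `H²_t`. -/
lemma IsStripLift.sum_weight_le {v : ℂ → ℂ} {ζ κ δ σ : ℝ} {N : ℕ}
    (hv : IsStripLift v ζ κ δ σ N) {W : ℂ → ℂ} {M : ℝ} (hW : DifferentiableOn ℂ W (openStrip ζ))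
    (hper : ∀ z ∈ openStrip ζ, W (z + (2 * Real.pi * N : ℝ)) = W z)
    (hM : ∀ z ∈ openStrip ζ, ‖W z‖ ≤ M) :
    ∃ C : ℝ, 0 ≤ C ∧ ∀ t, 0 < t → t ≤ ζ → ∀ (p : ℤ →₀ ℂ) (S : Finset ℤ),
      ∑ k ∈ S, (weight t k * ‖(2 * Real.pi : ℂ)⁻¹ * ∫ y in (0 : ℝ)..2 * Real.pi * N,
        exp (-(I * k * y)) * (W y * trig p (v y))‖) ^ 2 ≤
        (C * ‖Hardy.ofFinsupp (κ * t) p‖) ^ 2 := by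
  have hM0 : 0 ≤ M := (norm_nonneg _).trans (hM _ (ofReal_mem_openStrip hv.pos 0))
  have hδ := hv.lower_pos
  -- The constant 4NM²/δ collects (2π)⁻² from the normalisation, 2πN from Bessel's inequality, M²
  -- from the weight and 8π/δ from subordination. It does not depend on t.
  refine ⟨√(4 * N * M ^ 2 * δ⁻¹), Real.sqrt_nonneg _, fun t ht htζ p S => ?_⟩
  have hT : Differentiable ℂ (trig p) := by
    unfold trig Finsupp.sum
    fun_prop
  have hvT : ∀ s : ℝ, |s| < ζ → Continuous fun y : ℝ => trig p (v (y + s * I)) := fun s hs =>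
    hT.continuous.comp (continuous_comp_strip hv.continuousOn hs)
  have h1 := sum_weight_le_of_strip (u := fun z => W z * trig p (v z))
    (B := M ^ 2 * (8 * Real.pi * δ⁻¹ * ‖Hardy.ofFinsupp (κ * t) p‖ ^ 2)) hv.deg_pos
    (hW.mul (hT.comp_differentiableOn hv.analytic.differentiableOn)) (fun z hz => ?_) ht htζ
    (fun s hs => ?_) S
  · calc _ = ((2 * Real.pi)⁻¹) ^ 2 * ∑ k ∈ S, (weight t k * ‖∫ y in (0 : ℝ)..2 * Real.pi * N,
          exp (-(I * k * y)) * (W y * trig p (v y))‖) ^ 2 := by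
          rw [Finset.mul_sum]
          refine Finset.sum_congr rfl fun k _ => ?_
          have : ‖(2 * Real.pi : ℂ)⁻¹‖ = (2 * Real.pi)⁻¹ := by
            rw [norm_inv, norm_mul, norm_real, Real.norm_of_nonneg Real.pi_pos.le]
            norm_num
          rw [norm_mul, this]
          ring
      _ ≤ ((2 * Real.pi)⁻¹) ^ 2 * (2 * Real.pi * N *
          (M ^ 2 * (8 * Real.pi * δ⁻¹ * ‖Hardy.ofFinsupp (κ * t) p‖ ^ 2))) := by gcongr
      _ = _ := by
          rw [mul_pow, Real.sq_sqrt (by positivity)]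
          have := Real.pi_ne_zero
          field_simp
          ring
  · rw [hper z hz, hv.period z hz]
    congr 1
    unfold trig
    refine Finsupp.sum_congr fun k _ => ?_
    have h2 : ∃ j : ℤ, k * σ = j := by
      rcases hv.sign with h | h
      · exact ⟨k, by simp [h]⟩
      · exact ⟨-k, by simp [h]⟩
    obtain ⟨j, hj⟩ := h2
    have hj' : (k * σ : ℂ) = j := by exact_mod_cast hj
    have : (I * k * (v z + (2 * Real.pi * σ : ℝ)) : ℂ) = I * k * v z + j * (2 * Real.pi * I) := by
      rw [← hj']
      push_cast
      ring
    rw [this, exp_add, exp_int_mul_two_pi_mul_I, mul_one]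
  · have hs' := hs.trans_le htζ
    calc _ ≤ ∫ y in (0 : ℝ)..2 * Real.pi * N, M ^ 2 * ‖trig p (v (y + s * I))‖ ^ 2 := by
          refine intervalIntegral.integral_mono_on (by positivity) ?_ ?_ fun y _ => ?_
          · exact (((continuous_comp_strip hW.continuousOn hs').mul (hvT s hs')).norm.pow
              2).intervalIntegrable _ _
          · exact (continuous_const.mul ((hvT s hs').norm.pow 2)).intervalIntegrable _ _
          · rw [norm_mul, mul_pow]
            gcongr
            exact hM _ (mem_openStrip hs')
      _ ≤ _ := by
          rw [intervalIntegral.integral_const_mul]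
          gcongr
          exact hv.integral_sq_le htζ hs p

/-- Multiplication operators are weighted compositions with the identity, so the same estimate
covers them, with contraction factor 1. -/
lemma isStripLift_id {ζ : ℝ} (hζ : 0 < ζ) : IsStripLift (fun z => z) ζ 1 1 1 1 where
  analytic := analyticOnNhd_id
  pos := hζ
  nonneg := zero_le_one
  im_le z _ := by rw [one_mul]
  period z _ := by simp
  lower_pos := one_pos
  deriv_real x := ⟨1, by simp, by simp⟩
  sign := Or.inl rfl
  deg_pos := one_pos

/-- Multiplication by a function analytic on a strip is bounded on the Hardy space. -/
lemma exists_mul_restriction {h : C(Torus, ℝ)} (hpos : ∀ x, 0 < h x) {g : C(Torus, ℂ)} {G : ℂ → ℂ}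
    {ζ M : ℝ} (hG : DifferentiableOn ℂ G (openStrip ζ))
    (hper : ∀ z ∈ openStrip ζ, G (z + 2 * Real.pi) = G z)
    (hM : ∀ z ∈ openStrip ζ, ‖G z‖ ≤ M) (hg : ∀ x : ℝ, G x = g (x : Torus)) {s : ℝ} (hs : 0 < s)
    (hsζ : s ≤ ζ) :
    ∃ A : Hardy s →L[ℂ] Hardy s,
      ∀ a, (A a).coeff = (onCoeff hpos (mulL2 h g) (Hardy.incl hs.le a)).coeff := by
  obtain ⟨C, hC, hb⟩ := (isStripLift_id (hs.trans_le hsζ)).sum_weight_le hG (M := M) (fun z hz => by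
    rw [← hper z hz]
    push_cast
    rw [mul_one]) hM
  have hT : ∀ (p : ℤ →₀ ℂ) (S : Finset ℤ), ∑ k ∈ S,
      (weight s k * ‖(onCoeff hpos (mulL2 h g) (Hardy.ofFinsupp 0 p)).coeff k‖) ^ 2 ≤
        (C * ‖Hardy.ofFinsupp s p‖) ^ 2 := by
    intro p S
    have h1 := hb s hs hsζ p S
    rw [one_mul] at h1
    refine le_trans (le_of_eq (Finset.sum_congr rfl fun k _ => ?_)) h1
    rw [coeff_mulL2_ofFinsupp, fourierCoeff_eq]
    simp only [Nat.cast_one, mul_one, trigC_coe, hg]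
  obtain ⟨A, -, hA⟩ := Hardy.exists_restriction (s' := s) hs.le (onCoeff hpos (mulL2 h g)) hC hT
  exact ⟨A, hA⟩

section Koopman

variable {h : C(Torus, ℝ)} {f : Torus → Torus}

lemma exists_koopmanL2 (hpos : ∀ x, 0 < h x) (hf : Measurable f)
    (hc : ∃ c : ℝ≥0∞, c ≠ ∞ ∧ (volume : Measure Torus).map f ≤ c • volume) :
    ∃ T : L2 h →L[ℂ] L2 h, (∀ φ, T φ = koopmanL2 h f φ) ∧
      ∀ φ : L2 h, T φ =ᵐ[sampling h] fun x => φ (f x) := by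
  have h1 : ∃ c : ℝ≥0∞, c ≠ ∞ ∧ (sampling h).map f ≤ c • (volume : Measure Torus).map f := by
    obtain ⟨c, hc, h1⟩ := exists_sampling_le h
    refine ⟨c, hc, (Measure.map_mono h1 hf).trans ?_⟩
    rw [Measure.map_smul]
  obtain ⟨c, hc, h2⟩ := exists_le_trans (exists_le_trans h1 hc) (exists_le_sampling hpos)
  obtain ⟨T, hT⟩ := exists_comp_clm hf hc h2
  refine ⟨T, fun φ => ?_, hT⟩
  have hφ : MemLp (fun x => φ (f x)) 2 (sampling h) := memLp_comp_of_map_le hf hc h2 (Lp.memLp φ)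
  rw [koopmanL2, dif_pos hφ]
  ext1
  exact (hT φ).trans hφ.coeFn_toLp.symm

/-- The transfer operator, applied to a trigonometric polynomial. -/
lemma sum_mul_fourierCoeff_comp {v : ℂ → ℂ} {F : ℝ ≃ₜ ℝ} {ζ κ δ σ : ℝ} {N : ℕ}
    (hv : IsStripLift v ζ κ δ σ N) (hF : ∀ x : ℝ, ((F x : ℝ) : Torus) = f (x : Torus))
    (hvF : ∀ x : ℝ, v x = (F.symm x : ℝ)) (p : ℤ →₀ ℂ) (l : ℤ) :
    (p.sum fun k z => z * fourierCoeff (fun x => fourier l (f x)) (-k)) =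
      σ * ((2 * Real.pi : ℂ)⁻¹ * ∫ y in (0 : ℝ)..2 * Real.pi * N,
        exp (-(I * (-l : ℤ) * y)) * (deriv v y * trig p (v y))) := by
  have hfc := continuous_of_lift hF
  let g : ℝ → ℂ := fun x => trigC p (x : Torus) * fourier l (f (x : Torus))
  have hgc : Continuous g := by
    have h1 : Continuous fun x : ℝ => (x : Torus) := AddCircle.continuous_mk' _
    exact ((trigC p).continuous.comp h1).mul ((fourier l).continuous.comp (hfc.comp h1))
  have hgp : Function.Periodic g (2 * Real.pi) := fun x => by
    simp only [g, AddCircle.coe_add_period]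
  have hL : (p.sum fun k z => z * fourierCoeff (fun x => fourier l (f x)) (-k)) =
      (2 * Real.pi : ℂ)⁻¹ * ∫ y in (0 : ℝ)..2 * Real.pi, g y := by
    have h2 : ∀ y : ℝ, g y = ∑ k ∈ p.support,
        p k * (exp (-(I * (-k : ℤ) * y)) * fourier l (f (y : Torus))) := by
      intro y
      simp only [g]
      rw [trigC_coe, trig, Finsupp.sum, Finset.sum_mul]
      refine Finset.sum_congr rfl fun k _ => ?_
      rw [mul_assoc]
      congr 3
      push_cast
      ring
    simp only [h2]
    rw [intervalIntegral.integral_finsetSum, Finset.mul_sum, Finsupp.sum]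
    · refine Finset.sum_congr rfl fun k _ => ?_
      rw [intervalIntegral.integral_const_mul, fourierCoeff_eq]
      ring
    · intro k _
      have h1 : Continuous fun x : ℝ => (x : Torus) := AddCircle.continuous_mk' _
      have h3 : Continuous fun x : ℝ => fourier l (f (x : Torus)) :=
        (fourier l).continuous.comp (hfc.comp h1)
      exact (continuous_const.mul
        ((by fun_prop : Continuous fun y : ℝ => exp (-(I * (-k : ℤ) * y))).mul
          h3)).intervalIntegrable _ _
  -- The substitution x = v(y) on one full period of v merges the N inverse branches into a single
  -- integral; v undoes F, so the composition with f becomes an exponential in y.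
  have hR : ∫ y in (0 : ℝ)..2 * Real.pi * N,
      exp (-(I * (-l : ℤ) * y)) * (deriv v y * trig p (v y)) =
      ∫ x in F.symm 0..F.symm 0 + 2 * Real.pi * σ, g x := by
    have h0 : F.symm (2 * Real.pi * N) = F.symm 0 + 2 * Real.pi * σ := by
      have h1 := hv.period 0 (by simpa [openStrip] using hv.pos)
      rw [zero_add, hvF] at h1
      have h2 := hvF 0
      rw [ofReal_zero] at h2
      rw [h2] at h1
      exact_mod_cast h1
    have hd : ∀ y : ℝ, HasDerivAt (fun y => F.symm y) (deriv v y).re y := by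
      intro y
      have := (hv.analytic y
        (ofReal_mem_openStrip hv.pos y)).differentiableAt.hasDerivAt.real_of_complex
      simpa only [hvF, ofReal_re] using this
    have h1 := intervalIntegral.integral_deriv_smul_comp (a := 0) (b := 2 * Real.pi * N)
      (fun y _ => hd y) (continuous_re.comp hv.continuous_deriv_ofReal).continuousOn hgc
    rw [h0] at h1
    rw [← h1]
    refine intervalIntegral.integral_congr fun y _ => ?_
    obtain ⟨d, -, hd'⟩ := hv.deriv_real y
    simp only [g, Function.comp_apply]
    rw [← hF, Homeomorph.apply_symm_apply, trigC_coe, fourier_coe, hd', ofReal_re, hvF, real_smul]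
    push_cast
    ring_nf
  -- If f reverses orientation, the substituted interval runs backwards, and the factor σ restores
  -- the sign.
  have hS : (σ : ℂ) * ∫ x in F.symm 0..F.symm 0 + 2 * Real.pi * σ, g x =
      ∫ y in (0 : ℝ)..2 * Real.pi, g y := by
    rcases hv.sign with h | h
    · rw [h, ofReal_one, one_mul, mul_one, hgp.intervalIntegral_add_eq _ 0, zero_add]
    · have h2 := hgp.intervalIntegral_add_eq (F.symm 0 + 2 * Real.pi * -1) 0
      rw [zero_add] at h2
      rw [h, intervalIntegral.integral_symm, ← h2]
      simp
  rw [hL, hR, mul_left_comm, hS]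

/-- The Koopman operator maps `H²_{-t}` boundedly to `H²_{-κt}`. -/
lemma exists_koopman_extension (hpos : ∀ x, 0 < h x) {v : ℂ → ℂ} {F : ℝ ≃ₜ ℝ} {ζ κ δ σ : ℝ} {N : ℕ}
    (hv : IsStripLift v ζ κ δ σ N) (hF : ∀ x : ℝ, ((F x : ℝ) : Torus) = f (x : Torus))
    (hvF : ∀ x : ℝ, v x = (F.symm x : ℝ)) (hvκ : ∀ z ∈ openStrip ζ, ‖deriv v z‖ ≤ κ)
    {T : L2 h →L[ℂ] L2 h} (hT : ∀ φ : L2 h, T φ =ᵐ[sampling h] fun x => φ (f x))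
    (hfm : Measurable f)
    (hc : ∃ c : ℝ≥0∞, c ≠ ∞ ∧ (sampling h).map f ≤ c • sampling h)
    {t : ℝ} (ht : 0 < t) (htζ : t ≤ ζ) (h0 : -t ≤ 0) :
    ∃ A : Hardy (-t) →L[ℂ] Hardy (-(κ * t)),
      ∀ φ : Hardy 0, (A (Hardy.incl h0 φ)).coeff = (onCoeff hpos T φ).coeff := by
  have hper : ∀ z ∈ openStrip ζ, deriv v (z + (2 * Real.pi * N : ℝ)) = deriv v z := by
    intro z hz
    rw [← deriv_comp_add_const, ← deriv_add_const (f := v) (c := ((2 * Real.pi * σ : ℝ) : ℂ))]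
    refine Filter.EventuallyEq.deriv_eq ?_
    filter_upwards [(isOpen_openStrip ζ).mem_nhds hz] with w hw
    exact hv.period w hw
  obtain ⟨C, hC, hb⟩ := hv.sum_weight_le hv.analytic.deriv.differentiableOn hper hvκ
  suffices hT : ∀ p : ℤ →₀ ℂ, ∃ q : Hardy t, ‖q‖ ≤ C * ‖Hardy.ofFinsupp (κ * t) p‖ ∧
      ∀ φ : Hardy 0, (p.sum fun k z => z * (onCoeff hpos T φ).coeff (-k)) =
        Hardy.pair t q (Hardy.incl h0 φ) by
    obtain ⟨A, -, hA⟩ := Hardy.exists_extension (s := t) (s' := κ * t) ht.le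
      (mul_nonneg hv.nonneg ht.le) (onCoeff hpos T) hC hT
    exact ⟨A, hA⟩
  intro p
  -- These are the Fourier coefficients of the transfer operator applied to p; σv' is |v'| on the
  -- real axis.
  let c : ℤ → ℂ := fun k => σ * ((2 * Real.pi : ℂ)⁻¹ * ∫ y in (0 : ℝ)..2 * Real.pi * N,
        exp (-(I * k * y)) * (deriv v y * trig p (v y)))
  have hcs : ∀ S : Finset ℤ, ∑ k ∈ S, (weight t k * ‖c k‖) ^ 2 ≤
      (C * ‖Hardy.ofFinsupp (κ * t) p‖) ^ 2 := by
    intro S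
    refine le_trans (le_of_eq (Finset.sum_congr rfl fun k _ => ?_)) (hb t ht htζ p S)
    have : ‖(σ : ℂ)‖ = 1 := by rcases hv.sign with h | h <;> simp [h]
    simp only [c]
    rw [norm_mul, this, one_mul]
  let q : Hardy t := Hardy.mk c (Hardy.mem_of_sum_le hcs)
  refine ⟨q, Hardy.norm_le_of_sum_le (by positivity) hcs, ?_⟩
  let L : Hardy 0 →L[ℂ] ℂ := (∑ k ∈ p.support, p k • Hardy.coeffCLM 0 (-k)) ∘L onCoeff hpos T
  have hL : ∀ φ, L φ = p.sum fun k z => z * (onCoeff hpos T φ).coeff (-k) := by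
    intro φ
    simp only [L, ContinuousLinearMap.comp_apply, sum_apply,
      smul_apply]
    rfl
  -- Both functionals are continuous on L², so it is enough to check the duality on exponentials.
  have hLq : L = Hardy.pair t q ∘L Hardy.incl h0 := by
    refine Hardy.clm_ext fun l => ?_
    rw [hL, ContinuousLinearMap.comp_apply, Hardy.incl_ofFinsupp, Hardy.pair_single_right]
    have h1 : (onCoeff hpos T (Hardy.ofFinsupp 0 (Finsupp.single l 1))).coeff =
        fourierCoeff fun x => fourier l (f x) := by
      rw [onCoeff_ofFinsupp, coeff_fourierEquiv, trigC_single]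
      refine fourierCoeff_congr_ae ((ae_haar_iff hpos).2 ?_)
      obtain ⟨d, -, hd⟩ := hc
      filter_upwards [hT (ContinuousMap.toLp 2 (sampling h) ℂ (fourier l)),
        ae_comp_of_map_le hfm hd (ContinuousMap.coeFn_toLp (𝕜 := ℂ) (p := 2) (sampling h)
          (fourier l))] with x hx hx'
      rw [hx, hx']
    rw [h1, sum_mul_fourierCoeff_comp hv hF hvF]
    rfl
  intro φ
  rw [← hL, hLq]
  rfl

end Koopman

end

section

/-! ### The bilinear form of `L²(μ)` in terms of Fourier coefficients -/

open Complex AddCircle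

namespace Hardy

/-- The bilinear pairing `(1/2π) ∫ a b dx` of `L²`. -/
def dual (a b : Hardy 0) : ℂ := ∑' k, a.coeff k * b.coeff (-k)

lemma pair_incl_right {s : ℝ} (hs : 0 ≤ s) (h : -s ≤ 0) (a : Hardy s) (φ : Hardy 0) :
    pair s a (incl h φ) = dual (incl hs a) φ := by
  rw [pair_apply, dual, coeff_incl, coeff_incl]

lemma dual_ofFinsupp (p : ℤ →₀ ℂ) (φ : Hardy 0) :
    dual (ofFinsupp 0 p) φ = p.sum fun k z => z * φ.coeff (-k) := by
  rw [dual, coeff_ofFinsupp]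
  exact tsum_eq_sum fun k hk => by simp [Finsupp.notMem_support_iff.1 hk]

lemma dual_left_injective {a a' : Hardy 0} (h : ∀ φ, dual a φ = dual a' φ) : a = a' := by
  refine coeff_injective (funext fun k => ?_)
  have h1 : ∀ c : Hardy 0, dual c (ofFinsupp 0 (Finsupp.single (-k) 1)) = c.coeff k := by
    intro c
    rw [dual, coeff_ofFinsupp, tsum_eq_single k fun j hj => ?_]
    · simp
    · rw [Finsupp.single_eq_of_ne (by simpa using hj), mul_zero]
  rw [← h1, h, h1]

end Hardy

section Form

variable {h : C(Torus, ℝ)} (hpos : ∀ x, 0 < h x)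

lemma dual_fourierEquiv {a : Torus → ℂ} {A : Hardy 0}
    (ha : MemLp a 2 (haarAddCircle : Measure Torus)) (hA : A.coeff = fourierCoeff a) (φ : L2 h) :
    Hardy.dual A (fourierEquiv hpos φ) = ∫ x, a x * φ x ∂haarAddCircle := by
  rw [Hardy.dual, hA, coeff_fourierEquiv]
  exact (hasSum_fourierCoeff_mul ha (memLp_haar hpos φ)).tsum_eq

/-- The density as a complex function. -/
def densityC (h : C(Torus, ℝ)) : C(Torus, ℂ) := ⟨fun x => (h x : ℂ), by fun_prop⟩

/-- The inverse of the density as a complex function. -/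
def invDensityC (hpos : ∀ x, 0 < h x) : C(Torus, ℂ) :=
  ⟨fun x => (h x : ℂ)⁻¹, Continuous.inv₀ (by fun_prop) fun x => by exact_mod_cast (hpos x).ne'⟩

/-- Multiplication by the density. -/
def mulDensity : Hardy 0 →L[ℂ] Hardy 0 := onCoeff hpos (mulL2 h (densityC h))

/-- Division by the density. -/
def divDensity : Hardy 0 →L[ℂ] Hardy 0 := onCoeff hpos (mulL2 h (invDensityC hpos))

lemma mulDensity_divDensity (a : Hardy 0) : mulDensity hpos (divDensity hpos a) = a := by
  obtain ⟨φ, rfl⟩ := (fourierEquiv hpos).surjective a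
  rw [mulDensity, divDensity, onCoeff_fourierEquiv, onCoeff_fourierEquiv]
  congr 1
  ext1
  filter_upwards [coeFn_mulL2 (densityC h) (mulL2 h (invDensityC hpos) φ),
    coeFn_mulL2 (invDensityC hpos) φ] with x h1 h2
  rw [h1, h2]
  have : (h x : ℂ) ≠ 0 := by exact_mod_cast (hpos x).ne'
  exact mul_inv_cancel_left₀ this _

lemma divDensity_mulDensity (a : Hardy 0) : divDensity hpos (mulDensity hpos a) = a := by
  obtain ⟨φ, rfl⟩ := (fourierEquiv hpos).surjective a
  rw [mulDensity, divDensity, onCoeff_fourierEquiv, onCoeff_fourierEquiv]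
  congr 1
  ext1
  filter_upwards [coeFn_mulL2 (densityC h) φ,
    coeFn_mulL2 (invDensityC hpos) (mulL2 h (densityC h) φ)] with x h1 h2
  rw [h2, h1]
  have : (h x : ℂ) ≠ 0 := by exact_mod_cast (hpos x).ne'
  exact inv_mul_cancel_left₀ this _

lemma integral_sampling (hpos : ∀ x, 0 < h x) (g : Torus → ℂ) :
    ∫ x, g x ∂(sampling h) = 2 * Real.pi * ∫ x, h x * g x ∂haarAddCircle := by
  have h1 : sampling h = (volume : Measure Torus).withDensity fun x => ((h x).toNNReal : ℝ≥0∞) := rfl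
  rw [h1, integral_withDensity_eq_integral_smul (by fun_prop), volume_eq_smul_haarAddCircle,
    integral_smul_measure, ENNReal.toReal_ofReal Real.two_pi_pos.le, real_smul]
  push_cast
  congr 1
  refine integral_congr_ae (Eventually.of_forall fun x => ?_)
  simp only [NNReal.smul_def, Real.coe_toNNReal _ (hpos x).le, real_smul]

lemma integral_mul_sampling (a φ : L2 h) : ∫ x, a x * φ x ∂(sampling h) =
    2 * Real.pi * Hardy.dual (mulDensity hpos (fourierEquiv hpos a)) (fourierEquiv hpos φ) := by
  have h1 : MemLp (fun x => densityC h x * a x) 2 (haarAddCircle : Measure Torus) :=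
    (memLp_haar hpos (mulL2 h (densityC h) a)).ae_eq
      ((ae_haar_iff hpos).2 (coeFn_mulL2 (densityC h) a))
  rw [dual_fourierEquiv hpos (A := mulDensity hpos (fourierEquiv hpos a)) h1
    (coeff_mulL2 hpos (densityC h) a), integral_sampling hpos]
  congr 2
  funext x
  rw [← mul_assoc]
  rfl

lemma integral_mul_eq_inner (a φ : L2 h) :
    ∫ x, a x * φ x ∂(sampling h) = inner ℂ (star a) φ := by
  rw [L2.inner_def]
  refine integral_congr_ae ?_
  filter_upwards [Lp.coeFn_star a] with x hx
  rw [hx, Pi.star_apply]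
  simp [mul_comm]

/-! ### The orthogonal projections -/

lemma lp_star_add (φ ψ : L2 h) : star (φ + ψ) = star φ + star ψ := by
  ext1
  filter_upwards [Lp.coeFn_star (φ + ψ), Lp.coeFn_add φ ψ, Lp.coeFn_add (star φ) (star ψ),
    Lp.coeFn_star φ, Lp.coeFn_star ψ] with x h1 h2 h3 h4 h5
  rw [h1, Pi.star_apply, h2, h3, Pi.add_apply, Pi.add_apply, h4, h5, star_add]
  rfl

lemma lp_star_zero : star (0 : L2 h) = 0 := by
  have := lp_star_add (0 : L2 h) 0
  rwa [add_zero, left_eq_add] at this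

lemma lp_star_sub (φ ψ : L2 h) : star (φ - ψ) = star φ - star ψ := by
  rw [eq_sub_iff_add_eq, ← lp_star_add, sub_add_cancel]

lemma star_mem_trigPoly {n : ℕ} {φ : L2 h} (hφ : φ ∈ trigPoly h n) : star φ ∈ trigPoly h n := by
  induction hφ using Submodule.span_induction with
  | mem φ hφ =>
    obtain ⟨k, rfl⟩ := hφ
    have hk := Finset.mem_Ioo.1 k.2
    refine Submodule.subset_span ⟨⟨-k, Finset.mem_Ioo.2 ⟨by omega, by omega⟩⟩, ?_⟩
    ext1
    filter_upwards [ContinuousMap.coeFn_toLp (𝕜 := ℂ) (p := 2) (sampling h)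
      (fourier (-(k : ℤ)) : C(Torus, ℂ)), Lp.coeFn_star (ContinuousMap.toLp 2 (sampling h) ℂ
        (fourier (k : ℤ) : C(Torus, ℂ))), ContinuousMap.coeFn_toLp (𝕜 := ℂ) (p := 2) (sampling h)
      (fourier (k : ℤ) : C(Torus, ℂ))] with x h1 h2 h3
    rw [h2, Pi.star_apply, h3]
    refine h1.trans ?_
    rw [fourier_neg]
    rfl
  | zero =>
    rw [lp_star_zero]
    exact zero_mem _
  | add x y _ _ hx hy =>
    rw [lp_star_add]
    exact add_mem hx hy
  | smul r x _ hx =>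
    have : star (r • x) = star r • star x := by
      ext1
      filter_upwards [Lp.coeFn_star (r • x), Lp.coeFn_smul r x, Lp.coeFn_smul (star r) (star x),
        Lp.coeFn_star x] with y h1 h2 h3 h4
      rw [h1, Pi.star_apply, h2, h3, Pi.smul_apply, Pi.smul_apply, h4, Pi.star_apply, smul_eq_mul,
        smul_eq_mul, star_mul']
    rw [this]
    exact Submodule.smul_mem _ _ hx

lemma inner_star_star (a φ : L2 h) : inner ℂ (star a) (star φ) = inner ℂ φ a := by
  rw [L2.inner_def, L2.inner_def]
  refine integral_congr_ae ?_
  filter_upwards [Lp.coeFn_star a, Lp.coeFn_star φ] with x h1 h2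
  rw [h1, h2, Pi.star_apply, Pi.star_apply]
  simp [mul_comm]

/-- The dictionary contains e^{-ikx} along with e^{ikx}, so it is invariant under conjugation, and
so is its orthogonal complement. -/
lemma starProjection_star (n : ℕ) (a : L2 h) :
    (trigPoly h n).starProjection (star a) = star ((trigPoly h n).starProjection a) := by
  refine (Submodule.eq_starProjection_of_mem_of_inner_eq_zero
    (star_mem_trigPoly (Submodule.starProjection_apply_mem _ _)) fun w hw => ?_)
  have h1 : star a - star ((trigPoly h n).starProjection a) =
      star (a - (trigPoly h n).starProjection a) := (lp_star_sub _ _).symm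
  rw [h1, ← star_star w, inner_star_star]
  exact Submodule.inner_right_of_mem_orthogonal (star_mem_trigPoly hw)
    (Submodule.sub_starProjection_mem_orthogonal _)

/-- The projection `P_n` in terms of Fourier coefficients. -/
def projCoeff (n : ℕ) : Hardy 0 →L[ℂ] Hardy 0 := onCoeff hpos (trigPoly h n).starProjection

/-- Self-adjointness for the sesquilinear form, combined with invariance under conjugation, makes
the projection symmetric for the bilinear form ∫ aφ dμ. This is what yields its transposes. -/
lemma dual_mulDensity_projCoeff (n : ℕ) (a φ : Hardy 0) :
    Hardy.dual (mulDensity hpos (projCoeff hpos n a)) φ =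
      Hardy.dual (mulDensity hpos a) (projCoeff hpos n φ) := by
  obtain ⟨a, rfl⟩ := (fourierEquiv hpos).surjective a
  obtain ⟨φ, rfl⟩ := (fourierEquiv hpos).surjective φ
  have hpi : (2 * Real.pi : ℂ) ≠ 0 := by exact_mod_cast Real.two_pi_pos.ne'
  refine mul_left_cancel₀ hpi ?_
  rw [projCoeff, onCoeff_fourierEquiv, onCoeff_fourierEquiv, ← integral_mul_sampling,
    ← integral_mul_sampling, integral_mul_eq_inner, integral_mul_eq_inner, ← starProjection_star]
  exact Submodule.inner_starProjection_left_eq_right _ _ _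

lemma coeff_eq_zero_of_mem_trigPoly {n : ℕ} {φ : L2 h} (hφ : φ ∈ trigPoly h n) {k : ℤ}
    (hk : n ≤ k.natAbs) : (fourierEquiv hpos φ).coeff k = 0 := by
  let L : L2 h →ₗ[ℂ] ℂ := (Hardy.coeffCLM 0 k : Hardy 0 →ₗ[ℂ] ℂ) ∘ₗ
    ((fourierEquiv hpos : L2 h →L[ℂ] Hardy 0) : L2 h →ₗ[ℂ] Hardy 0)
  have h1 : trigPoly h n ≤ LinearMap.ker L := by
    refine Submodule.span_le.2 ?_
    rintro _ ⟨j, rfl⟩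
    have hj := Finset.mem_Ioo.1 j.2
    change (fourierEquiv hpos _).coeff k = 0
    rw [coeff_fourierEquiv_toLp, fourierCoeff_fourier, Pi.single_eq_of_ne]
    rintro rfl
    omega
  exact h1 hφ

lemma projCoeff_coeff_eq_zero {n : ℕ} (a : Hardy 0) {k : ℤ} (hk : n ≤ k.natAbs) :
    (projCoeff hpos n a).coeff k = 0 := by
  obtain ⟨a, rfl⟩ := (fourierEquiv hpos).surjective a
  rw [projCoeff, onCoeff_fourierEquiv]
  exact coeff_eq_zero_of_mem_trigPoly hpos (Submodule.starProjection_apply_mem _ _) hk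

lemma Hardy.exists_eq_ofFinsupp {s : ℝ} {n : ℕ} {a : Hardy s}
    (ha : ∀ k : ℤ, n ≤ k.natAbs → a.coeff k = 0) :
    ∃ p : ℤ →₀ ℂ, a = Hardy.ofFinsupp s p ∧ ∀ k ∈ p.support, k ∈ Finset.Ioo (-(n : ℤ)) n := by
  have hmem : ∀ k, a.coeff k ≠ 0 → k ∈ Finset.Ioo (-(n : ℤ)) n := by
    intro k hk
    have : ¬ n ≤ k.natAbs := fun h => hk (ha k h)
    rw [Finset.mem_Ioo]
    omega
  refine ⟨Finsupp.onFinset _ a.coeff hmem, Hardy.coeff_injective ?_, fun k hk =>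
    hmem k ((Finsupp.mem_support_onFinset _).1 hk)⟩
  rw [Hardy.coeff_ofFinsupp]
  rfl

lemma projCoeff_eq_self {n : ℕ} {a : Hardy 0} (ha : ∀ k : ℤ, n ≤ k.natAbs → a.coeff k = 0) :
    projCoeff hpos n a = a := by
  obtain ⟨p, rfl, hp⟩ := Hardy.exists_eq_ofFinsupp ha
  rw [projCoeff, onCoeff_ofFinsupp, ← fourierEquiv_trigC hpos]
  congr 1
  refine Submodule.starProjection_eq_self_iff.2 ?_
  rw [trigC, Finsupp.sum, map_sum]
  refine Submodule.sum_mem _ fun k hk => ?_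
  rw [map_smul]
  exact Submodule.smul_mem _ _ (Submodule.subset_span ⟨⟨k, hp k hk⟩, rfl⟩)

lemma exists_norm_projCoeff_le : ∃ C : ℝ, 0 ≤ C ∧ ∀ n, ‖projCoeff hpos n‖ ≤ C := by
  refine ⟨‖(fourierEquiv hpos : L2 h →L[ℂ] Hardy 0)‖ *
    (1 * ‖((fourierEquiv hpos).symm : Hardy 0 →L[ℂ] L2 h)‖), by positivity, fun n => ?_⟩
  refine (ContinuousLinearMap.opNorm_comp_le _ _).trans ?_
  gcongr
  refine (ContinuousLinearMap.opNorm_comp_le _ _).trans ?_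
  gcongr
  exact Submodule.starProjection_norm_le _

end Form

/-! ### The projections on `H²_s` -/

namespace Hardy

variable {s s' : ℝ}

/-- The decomposition into low and high frequencies. -/
lemma exists_split (a : Hardy s) (n : ℕ) : ∃ u w : Hardy s, a = u + w ∧
    (∀ k : ℤ, n ≤ k.natAbs → u.coeff k = 0) ∧ (∀ k : ℤ, k.natAbs < n → w.coeff k = 0) ∧
    (∀ k, ‖u.coeff k‖ ≤ ‖a.coeff k‖) ∧ ∀ k, ‖w.coeff k‖ ≤ ‖a.coeff k‖ := by
  let c : ℤ → ℂ := fun k => if k.natAbs < n then a.coeff k else 0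
  have hc : ∀ k, ‖c k‖ ≤ ‖a.coeff k‖ := by
    intro k
    simp only [c]
    split_ifs <;> simp
  let u : Hardy s := mk c (mem_of_le (s := s) a (C := 1) fun k => by
    rw [one_mul]
    exact mul_le_mul_of_nonneg_left (hc k) (weight_pos s k).le)
  have hw : ∀ k, (a - u).coeff k = if k.natAbs < n then 0 else a.coeff k := by
    intro k
    rw [coeff_sub, Pi.sub_apply]
    change a.coeff k - (if k.natAbs < n then a.coeff k else 0) = _
    split_ifs <;> simp
  refine ⟨u, a - u, (add_sub_cancel _ _).symm, fun k hk => if_neg (not_lt.2 hk), fun k hk => ?_, hc,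
    fun k => ?_⟩
  · rw [hw, if_pos hk]
  · rw [hw]
    split_ifs <;> simp

lemma finiteDimensional_of_coeff {E : Submodule ℂ (Hardy s)} {n : ℕ}
    (hE : ∀ a ∈ E, ∀ k : ℤ, n ≤ k.natAbs → a.coeff k = 0) : FiniteDimensional ℂ E := by
  let L : E →ₗ[ℂ] (Finset.Ioo (-(n : ℤ)) n → ℂ) :=
    { toFun := fun a k => a.1.coeff k
      map_add' := fun _ _ => rfl
      map_smul' := fun _ _ => rfl }
  refine Module.Finite.of_injective L fun a b hab => Subtype.ext (coeff_injective (funext fun k => ?_))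
  by_cases hk : n ≤ k.natAbs
  · rw [hE _ a.2 _ hk, hE _ b.2 _ hk]
  · exact congrFun hab ⟨k, by rw [Finset.mem_Ioo]; omega⟩

/-- A projection onto the trigonometric polynomials approximates the embeddings. -/
lemma norm_comp_incl_sub_le {Q : Hardy s →L[ℂ] Hardy s} {n : ℕ} (hss : s ≤ s')
    (hQ : ∀ a : Hardy s, (∀ k : ℤ, n ≤ k.natAbs → a.coeff k = 0) → Q a = a) {ε : ℝ} (hε : 0 ≤ ε)
    (hw : ∀ k : ℤ, n ≤ k.natAbs → weight s k ≤ ε * weight s' k) :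
    ‖Q ∘L incl hss - incl hss‖ ≤ (‖Q‖ + 1) * ε := by
  refine ContinuousLinearMap.opNorm_le_bound _ (by positivity) fun a => ?_
  -- Q fixes the low-frequency part, so Q − 1 sees only the high frequencies, where the ratio of
  -- weights is at most ε.
  obtain ⟨u, w, hauw, hu, hw', -, hwle⟩ := a.exists_split n
  have h1 : ‖incl hss w‖ ≤ ε * ‖a‖ := by
    refine norm_le_of_le hε fun k => ?_
    rw [coeff_incl]
    by_cases hk : n ≤ k.natAbs
    · rw [← mul_assoc]
      exact mul_le_mul (hw k hk) (hwle k) (norm_nonneg _)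
        (mul_nonneg hε (weight_pos _ _).le)
    · rw [hw' k (not_le.1 hk), norm_zero, mul_zero]
      exact mul_nonneg hε (mul_nonneg (weight_pos _ _).le (norm_nonneg _))
  have h2 : (Q ∘L incl hss - incl hss) a = Q (incl hss w) - incl hss w := by
    rw [sub_apply, ContinuousLinearMap.comp_apply, hauw, map_add, map_add,
      hQ (incl hss u) fun k hk => by rw [coeff_incl, hu k hk]]
    abel
  rw [h2]
  calc _ ≤ ‖Q‖ * ‖incl hss w‖ + ‖incl hss w‖ :=
        (norm_sub_le _ _).trans (add_le_add (Q.le_opNorm _) le_rfl)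
    _ = (‖Q‖ + 1) * ‖incl hss w‖ := by ring
    _ ≤ (‖Q‖ + 1) * (ε * ‖a‖) := by gcongr
    _ = _ := by ring

end Hardy

lemma weight_le_of_natAbs_le {s : ℝ} (hs : 0 ≤ s) {j k : ℤ} (h : j.natAbs ≤ k.natAbs) :
    weight s j ≤ weight s k := by
  rw [weight_of_nonneg hs, weight_of_nonneg hs]
  refine Real.sqrt_le_sqrt (Real.cosh_le_cosh.2 ?_)
  have h1 : |(j : ℝ)| ≤ |(k : ℝ)| := by
    rw [← Int.cast_abs, ← Int.cast_abs, Int.abs_eq_natAbs, Int.abs_eq_natAbs]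
    exact_mod_cast h
  rw [abs_mul, abs_mul, abs_mul, abs_mul]
  gcongr

section Proj

variable {h : C(Torus, ℝ)} (hpos : ∀ x, 0 < h x) {s : ℝ}

/-- Low frequencies are fixed. The high-frequency part has L² norm at most σ_s(n)⁻¹ times its H²_s
norm, and its projection involves only frequencies below n, so returning from L² to H²_s costs at
most σ_s(n). The two factors cancel, which gives a bound uniform in n. -/
lemma exists_proj_restriction (hs : 0 ≤ s) : ∃ C : ℝ, ∀ n, ∃ A : Hardy s →L[ℂ] Hardy s, ‖A‖ ≤ C ∧
    ∀ a, (A a).coeff = (projCoeff hpos n (Hardy.incl hs a)).coeff := by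
  obtain ⟨C, hC, hb⟩ := exists_norm_projCoeff_le hpos
  refine ⟨1 + C, fun n => ?_⟩
  have key : ∀ a : Hardy s, ∃ y : Hardy s, ‖y‖ ≤ (1 + C) * ‖a‖ ∧
      y.coeff = (projCoeff hpos n (Hardy.incl hs a)).coeff := by
    intro a
    obtain ⟨u, w, hauw, hu, hw, hule, hwle⟩ := a.exists_split n
    have hn := weight_pos s n
    have h1 : ‖Hardy.incl hs w‖ ≤ (weight s n)⁻¹ * ‖a‖ := by
      refine Hardy.norm_le_of_le (inv_nonneg.2 hn.le) fun k => ?_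
      rw [Hardy.coeff_incl, weight_zero, one_mul]
      by_cases hk : n ≤ k.natAbs
      · rw [inv_mul_eq_div, le_div_iff₀' hn]
        exact mul_le_mul (weight_le_of_natAbs_le hs (by simpa using hk)) (hwle k) (norm_nonneg _)
          (weight_pos _ _).le
      · rw [hw k (not_le.1 hk), norm_zero]
        exact mul_nonneg (inv_nonneg.2 hn.le) (mul_nonneg (weight_pos _ _).le (norm_nonneg _))
    set b := projCoeff hpos n (Hardy.incl hs w) with hb'
    have h2 : ∀ k, weight s k * ‖b.coeff k‖ ≤ weight s n * (weight 0 k * ‖b.coeff k‖) := by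
      intro k
      rw [weight_zero, one_mul]
      by_cases hk : n ≤ k.natAbs
      · rw [hb', projCoeff_coeff_eq_zero hpos _ hk, norm_zero, mul_zero, mul_zero]
      · exact mul_le_mul_of_nonneg_right
          (weight_le_of_natAbs_le hs (by simpa using (not_le.1 hk).le)) (norm_nonneg _)
    obtain ⟨y, hyb⟩ : ∃ y : Hardy s, y.coeff = b.coeff :=
      ⟨Hardy.mk b.coeff (Hardy.mem_of_le b h2), Hardy.coeff_mk _ _⟩
    have hy : ‖y‖ ≤ weight s n * ‖b‖ := Hardy.norm_le_of_le hn.le fun k => by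
      rw [hyb]
      exact h2 k
    refine ⟨u + y, ?_, ?_⟩
    · have h3 : ‖u‖ ≤ 1 * ‖a‖ := Hardy.norm_le_of_le zero_le_one fun k => by
        rw [one_mul]
        exact mul_le_mul_of_nonneg_left (hule k) (weight_pos _ _).le
      have h4 : ‖b‖ ≤ C * ((weight s n)⁻¹ * ‖a‖) :=
        ((projCoeff hpos n).le_opNorm _).trans (mul_le_mul (hb n) h1 (norm_nonneg _) hC)
      calc ‖u + y‖ ≤ ‖u‖ + ‖y‖ := norm_add_le _ _
        _ ≤ 1 * ‖a‖ + weight s n * (C * ((weight s n)⁻¹ * ‖a‖)) := by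
          gcongr
          exact hy.trans (by gcongr)
        _ = _ := by field_simp
    · have h5 : projCoeff hpos n (Hardy.incl hs a) = Hardy.incl hs u + b := by
        rw [hauw, map_add, map_add, projCoeff_eq_self hpos fun k hk => ?_]
        rw [Hardy.coeff_incl, hu k hk]
      rw [h5, Hardy.coeff_add, Hardy.coeff_add, Hardy.coeff_incl, hyb]
  have hsum : ∀ (a : Hardy s) (S : Finset ℤ), ∑ k ∈ S,
      (weight s k * ‖(projCoeff hpos n (Hardy.incl hs a)).coeff k‖) ^ 2 ≤ ((1 + C) * ‖a‖) ^ 2 := by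
    intro a S
    obtain ⟨y, hy, hya⟩ := key a
    rw [← hya]
    refine (y.sum_le_norm_sq S).trans ?_
    gcongr
  exact ⟨Hardy.mkCLM (fun a => (projCoeff hpos n (Hardy.incl hs a)).coeff) (fun a b => by simp)
    (fun r a => by simp) (1 + C) (by positivity) hsum, Hardy.norm_mkCLM_le,
    fun a => Hardy.coeff_mkCLM a⟩

/-- Symmetry of P_n with respect to μ means that its transpose for dx is h P_n h⁻¹. This is bounded
on H²_s uniformly in n, and duality carries the bound to H²_{-s}. -/
lemma exists_proj_extension (hs : 0 ≤ s) (hs' : -s ≤ 0) {A B : Hardy s →L[ℂ] Hardy s}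
    (hA : ∀ a, (A a).coeff = (mulDensity hpos (Hardy.incl hs a)).coeff)
    (hB : ∀ a, (B a).coeff = (divDensity hpos (Hardy.incl hs a)).coeff) :
    ∃ C : ℝ, ∀ n, ∃ Q : Hardy (-s) →L[ℂ] Hardy (-s), ‖Q‖ ≤ C ∧
      ∀ φ, (Q (Hardy.incl hs' φ)).coeff = (projCoeff hpos n φ).coeff := by
  obtain ⟨C, hC⟩ := exists_proj_restriction hpos hs
  have hC0 : 0 ≤ C := by
    obtain ⟨P, hP, -⟩ := hC 0
    exact (norm_nonneg _).trans hP
  refine ⟨‖A‖ * C * ‖B‖, fun n => ?_⟩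
  obtain ⟨P, hP, hPc⟩ := hC n
  have h1 : ∀ p : ℤ →₀ ℂ, ∃ q : Hardy s, ‖q‖ ≤ ‖A‖ * C * ‖B‖ * ‖Hardy.ofFinsupp s p‖ ∧
      ∀ φ : Hardy 0, (p.sum fun k z => z * (projCoeff hpos n φ).coeff (-k)) =
        Hardy.pair s q (Hardy.incl hs' φ) := by
    intro p
    refine ⟨A (P (B (Hardy.ofFinsupp s p))), ?_, fun φ => ?_⟩
    · calc _ ≤ ‖A‖ * (C * (‖B‖ * ‖Hardy.ofFinsupp s p‖)) := by
            refine (A.le_opNorm _).trans ?_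
            gcongr
            refine (P.le_opNorm _).trans ?_
            gcongr
            exact B.le_opNorm _
        _ = _ := by ring
    · rw [Hardy.pair_incl_right hs, ← Hardy.dual_ofFinsupp]
      have h2 : ∀ a, Hardy.incl hs (A a) = mulDensity hpos (Hardy.incl hs a) := fun a =>
        Hardy.coeff_injective (by rw [Hardy.coeff_incl, hA])
      have h3 : ∀ a, Hardy.incl hs (B a) = divDensity hpos (Hardy.incl hs a) := fun a =>
        Hardy.coeff_injective (by rw [Hardy.coeff_incl, hB])
      have h4 : ∀ a, Hardy.incl hs (P a) = projCoeff hpos n (Hardy.incl hs a) := fun a =>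
        Hardy.coeff_injective (by rw [Hardy.coeff_incl, hPc])
      rw [h2, h4, h3, dual_mulDensity_projCoeff, mulDensity_divDensity, Hardy.incl_ofFinsupp]
  obtain ⟨Q, hQ, hQc⟩ := Hardy.exists_extension hs hs (projCoeff hpos n) (by positivity) h1
  exact ⟨Q, hQ, hQc⟩

end Proj

/-! ### Elements of the Hardy space as functions -/

/-- The squares of the inverse weights decay geometrically, and the coefficients are a product of
two square-summable sequences. -/
lemma Hardy.summable_norm_coeff {s : ℝ} (hs : 0 < s) (a : Hardy s) :
    Summable fun k => ‖a.coeff k‖ := by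
  have h1 : Summable fun k : ℤ => ((weight s k)⁻¹) ^ 2 := by
    have h2 : ∀ k : ℤ, ((weight s k)⁻¹) ^ 2 ≤ 2 * Real.exp (-(2 * s)) ^ k.natAbs := by
      intro k
      rw [inv_pow, weight_sq_of_nonneg hs.le, inv_le_comm₀ (Real.cosh_pos _) (by positivity),
        ← Real.cosh_abs, abs_mul, abs_mul, abs_of_pos hs, Real.cosh_eq, mul_inv, ← inv_pow,
        ← Real.exp_neg, neg_neg, ← Real.exp_nat_mul, ← div_eq_inv_mul]
      have h3 : (k.natAbs : ℝ) * (2 * s) = |(2 : ℝ)| * |(k : ℝ)| * s := by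
        rw [Nat.cast_natAbs, Int.cast_abs, abs_two]
        ring
      rw [h3]
      generalize |(2 : ℝ)| * |(k : ℝ)| * s = X
      have := Real.exp_pos (-X)
      linarith
    refine Summable.of_nonneg_of_le (fun _ => sq_nonneg _) h2 (Summable.mul_left _ ?_)
    have h4 : Real.exp (-(2 * s)) < 1 := Real.exp_lt_one_iff.2 (by linarith)
    have h5 := summable_geometric_of_lt_one (Real.exp_pos _).le h4
    exact Summable.of_nat_of_neg (by simpa using h5) (by simpa using h5)
  refine Summable.of_nonneg_of_le (fun _ => norm_nonneg _) (fun k => ?_)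
    (h1.add a.hasSum_norm_sq.summable)
  have hw := weight_pos s k
  have h6 : ‖a.coeff k‖ = (weight s k)⁻¹ * (weight s k * ‖a.coeff k‖) := by
    rw [inv_mul_cancel_left₀ hw.ne']
  have h7 : ∀ x y : ℝ, x * y ≤ x ^ 2 + y ^ 2 := fun x y => by
    nlinarith [sq_nonneg (x - y), sq_nonneg x, sq_nonneg y]
  exact h6.trans_le (h7 _ _)

lemma Hardy.exists_eval_eq {h : C(Torus, ℝ)} (hpos : ∀ x, 0 < h x) {s : ℝ} (hs : 0 < s)
    (a : Hardy s) : ∃ φ : L2 h, fourierEquiv hpos φ = Hardy.incl hs.le a ∧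
      φ =ᵐ[sampling h] a.eval := by
  have h1 : Summable fun k => a.coeff k • (fourier k : C(Torus, ℂ)) := by
    refine Summable.of_norm ?_
    simpa only [norm_smul, fourier_norm, mul_one] using Hardy.summable_norm_coeff hs a
  obtain ⟨g, hg⟩ := h1
  have h2 : ∀ x, g x = a.eval x := by
    intro x
    have h3 := (ContinuousMap.evalCLM ℂ x).hasSum hg
    exact (h3.tsum_eq).symm
  refine ⟨ContinuousMap.toLp 2 (sampling h) ℂ g, Hardy.coeff_injective (funext fun k => ?_), ?_⟩
  · let L : C(Torus, ℂ) →L[ℂ] ℂ := Hardy.coeffCLM 0 k ∘L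
      (fourierEquiv hpos : L2 h →L[ℂ] Hardy 0) ∘L ContinuousMap.toLp 2 (sampling h) ℂ
    have h4 := L.hasSum hg
    have h5 : ∀ j, L (a.coeff j • fourier j) = if j = k then a.coeff k else 0 := by
      intro j
      rw [map_smul]
      have : L (fourier j) = (Pi.single j 1 : ℤ → ℂ) k := by
        rw [← fourierCoeff_fourier (T := 2 * Real.pi), ← coeff_fourierEquiv_toLp hpos]
        rfl
      rw [this]
      split_ifs with hjk
      · rw [hjk]; simp
      · rw [Pi.single_eq_of_ne (Ne.symm hjk), smul_zero]
    simp only [h5] at h4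
    have h6 := h4.unique (hasSum_ite_eq k (a.coeff k))
    rw [Hardy.coeff_incl, ← h6]
    rfl
  · filter_upwards [ContinuousMap.coeFn_toLp (𝕜 := ℂ) (p := 2) (sampling h) g] with x hx
    rw [hx, h2]

lemma Hardy.integral_eval_mul {h : C(Torus, ℝ)} (hpos : ∀ x, 0 < h x) {s : ℝ} (hs : 0 < s)
    (a : Hardy s) (φ : L2 h) : ∫ x, a.eval x * φ x ∂(sampling h) =
      2 * Real.pi * dual (mulDensity hpos (incl hs.le a)) (fourierEquiv hpos φ) := by
  obtain ⟨ψ, hψ, hψa⟩ := a.exists_eval_eq hpos hs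
  rw [← hψ, ← integral_mul_sampling]
  refine integral_congr_ae ?_
  filter_upwards [hψa] with x hx
  rw [hx]

end

section

open Complex Module Module.End

/-! ### Extensions to the spaces of hyperdistributions -/

lemma Hardy.coeff_mem {s : ℝ} (a : Hardy s) : a.coeff ∈ hardySubmodule s := a.2

lemma IsExtension.eq {h : C(Torus, ℝ)} (hpos : ∀ x, 0 < h x) {s : ℝ} (hs : s ≤ 0) {R : L2 h → L2 h}
    {A A' : Hardy s →L[ℂ] Hardy s} (hA : IsExtension h s R A) (hA' : IsExtension h s R A') :
    A = A' := by
  have h1 := (Hardy.denseRange_incl hs).equalizer A.continuous A'.continuous (funext fun a => ?_)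
  · exact ContinuousLinearMap.ext fun a => congrFun h1 a
  · obtain ⟨φ, rfl⟩ := (fourierEquiv hpos).surjective a
    obtain ⟨hφ, h2⟩ := hA φ
    obtain ⟨hφ', h3⟩ := hA' φ
    have h4 : Hardy.incl hs (fourierEquiv hpos φ) = Hardy.mk _ hφ :=
      Hardy.coeff_injective (by rw [Hardy.coeff_incl, coeff_fourierEquiv, Hardy.coeff_mk])
    refine Hardy.coeff_injective ?_
    simp only [Function.comp_apply]
    rw [h4, h2, h3]

lemma IsExtension.extension_eq {h : C(Torus, ℝ)} (hpos : ∀ x, 0 < h x) {s : ℝ} (hs : s ≤ 0)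
    {R : L2 h → L2 h} {A : Hardy s →L[ℂ] Hardy s} (hA : IsExtension h s R A) :
    extension h s R = A := by
  have h1 : ∃ A, IsExtension h s R A := ⟨A, hA⟩
  rw [extension, dif_pos h1]
  exact h1.choose_spec.eq hpos hs hA

lemma isExtension_of_incl {h : C(Torus, ℝ)} (hpos : ∀ x, 0 < h x) {s : ℝ} (hs : s ≤ 0)
    {R : L2 h → L2 h} {T : L2 h →L[ℂ] L2 h} (hT : ∀ φ, T φ = R φ) {A : Hardy s →L[ℂ] Hardy s}
    (hA : ∀ a : Hardy 0, (A (Hardy.incl hs a)).coeff = (onCoeff hpos T a).coeff) :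
    IsExtension h s R A := by
  intro φ
  have h1 : (Hardy.incl hs (fourierEquiv hpos φ)).coeff = fourierCoeff (φ : Torus → ℂ) := by
    rw [Hardy.coeff_incl, coeff_fourierEquiv]
  have h2 : fourierCoeff (φ : Torus → ℂ) ∈ hardySubmodule s := by
    rw [← h1]
    exact Hardy.coeff_mem _
  refine ⟨h2, ?_⟩
  have h3 : Hardy.mk _ h2 = Hardy.incl hs (fourierEquiv hpos φ) :=
    Hardy.coeff_injective (by rw [h1, Hardy.coeff_mk])
  rw [h3, hA, onCoeff_fourierEquiv, coeff_fourierEquiv, hT]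

/-! ### Intertwined operators -/

section Intertwine

variable {X Y : Type*} [NormedAddCommGroup X] [NormedSpace ℂ X] [NormedAddCommGroup Y]
  [NormedSpace ℂ Y] {T : X →L[ℂ] X} {S : Y →L[ℂ] Y} {J : X →L[ℂ] Y} {ν : ℂ}

lemma intertwine_pow (hJ : ∀ x, J (T x) = S (J x)) (ν : ℂ) (j : ℕ) (x : X) :
    J ((((T : End ℂ X) - ν • 1) ^ j) x) = (((S : End ℂ Y) - ν • 1) ^ j) (J x) := by
  induction j generalizing x with
  | zero => simp
  | succ j ih =>
    rw [pow_succ, pow_succ, End.mul_apply, End.mul_apply, ih]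
    congr 1
    simp [hJ]

lemma mem_maxGenEigenspace_iff_of_intertwine (hJ : ∀ x, J (T x) = S (J x))
    (hinj : Function.Injective J) {x : X} :
    J x ∈ maxGenEigenspace (S : End ℂ Y) ν ↔ x ∈ maxGenEigenspace (T : End ℂ X) ν := by
  simp only [mem_maxGenEigenspace, ← intertwine_pow hJ, map_eq_zero_iff J hinj]

lemma finrank_maxGenEigenspace_eq (hJ : ∀ x, J (T x) = S (J x)) (hinj : Function.Injective J)
    (hr : ∀ y ∈ maxGenEigenspace (S : End ℂ Y) ν, ∃ x, J x = y) :
    finrank ℂ (maxGenEigenspace (T : End ℂ X) ν) = finrank ℂ (maxGenEigenspace (S : End ℂ Y) ν) := by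
  have h1 : (maxGenEigenspace (T : End ℂ X) ν).map (J : X →ₗ[ℂ] Y) =
      maxGenEigenspace (S : End ℂ Y) ν := by
    ext y
    constructor
    · rintro ⟨x, hx, rfl⟩
      exact (mem_maxGenEigenspace_iff_of_intertwine hJ hinj).2 hx
    · intro hy
      obtain ⟨x, rfl⟩ := hr y hy
      exact ⟨x, (mem_maxGenEigenspace_iff_of_intertwine hJ hinj).1 hy, rfl⟩
  rw [← h1]
  exact (Submodule.equivMapOfInjective (J : X →ₗ[ℂ] Y) hinj _).finrank_eq

/-- Generalised eigenvectors for nonzero eigenvalues are in the range of a smoothing operator. -/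
lemma exists_preimage_of_mem_maxGenEigenspace {B : Y →L[ℂ] X} (hB : ∀ y, J (B y) = S y)
    (hν : ν ≠ 0) {y : Y} (hy : y ∈ maxGenEigenspace (S : End ℂ Y) ν) : ∃ x, J x = y := by
  obtain ⟨j, hj⟩ := (mem_maxGenEigenspace _ _ _).1 hy
  clear hy
  induction j generalizing y with
  | zero => exact ⟨0, by rw [map_zero]; simpa using hj.symm⟩
  | succ j ih =>
    rw [pow_succ, End.mul_apply] at hj
    obtain ⟨x, hx⟩ := ih hj
    -- With Jx = (S − ν)y one has νy = Sy − Jx = J(By − x).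
    refine ⟨ν⁻¹ • (B y - x), ?_⟩
    rw [map_smul, map_sub, hB, hx]
    simp [hν]

end Intertwine

/-! ### The operators on the scale of spaces -/

/-- The composition operator `K` smooths, and the density acts by multiplication. -/
structure IsSmoothing {h : C(Torus, ℝ)} (hpos : ∀ x, 0 < h x) (f : Torus → Torus) (ζ κ : ℝ)
    (K : L2 h →L[ℂ] L2 h) : Prop where
  pos : 0 < κ
  lt_one : κ < 1
  koopman : ∀ φ, K φ = koopmanL2 h f φ
  smooth : ∀ t, 0 < t → t ≤ ζ → ∀ h0 : -t ≤ 0, ∃ A : Hardy (-t) →L[ℂ] Hardy (-(κ * t)),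
    ∀ φ, (A (Hardy.incl h0 φ)).coeff = (onCoeff hpos K φ).coeff
  mul : ∀ s, 0 < s → s ≤ ζ → ∀ h0 : 0 ≤ s, ∃ A : Hardy s →L[ℂ] Hardy s,
    ∀ a, (A a).coeff = (mulDensity hpos (Hardy.incl h0 a)).coeff
  div : ∀ s, 0 < s → s ≤ ζ → ∀ h0 : 0 ≤ s, ∃ A : Hardy s →L[ℂ] Hardy s,
    ∀ a, (A a).coeff = (divDensity hpos (Hardy.incl h0 a)).coeff

/-- All the analytic input on f and h is condensed here; the spectral argument afterwards uses only
the smoothing of K and the two multiplication operators. -/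
lemma exists_isSmoothing {f : Torus → Torus} {h : C(Torus, ℝ)} {ζ κ α D M : ℝ} {q : ℝ≥0∞}
    (hζ : 0 < ζ) (hκ : κ < 1) (hf : IsAnalyticExpanding f ζ κ α D)
    (hh : IsAnalyticDensity h ζ M q) :
    ∃ K, IsSmoothing hh.1 f ζ κ K := by
  obtain ⟨hpos, ⟨H, hH, hHa, hHper, hHM⟩, -⟩ := hh
  obtain ⟨F, v, δ, σ, N, hF, hvF, hv, hvκ, hκ0⟩ := hf.exists_lift hζ
  have hfm : Measurable f := (continuous_of_lift hF).measurable
  have hd : ∀ y : ℝ, HasDerivAt F.symm (deriv v y).re y := by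
    intro y
    have := (hv.analytic y
      (ofReal_mem_openStrip hζ y)).differentiableAt.hasDerivAt.real_of_complex
    simpa only [hvF, ofReal_re] using this
  have hvol := exists_map_volume_le hF hd (κ := κ)
    (fun y => (abs_re_le_norm _).trans (hvκ _ (ofReal_mem_openStrip hζ y))) hfm
  obtain ⟨K, hK, hKae⟩ := exists_koopmanL2 hpos hfm hvol
  have hsam : ∃ c : ℝ≥0∞, c ≠ ∞ ∧ (sampling h).map f ≤ c • sampling h := by
    obtain ⟨c, hc, h1⟩ := exists_sampling_le h
    have h2 := (Measure.map_mono h1 hfm)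
    rw [Measure.map_smul] at h2
    exact exists_le_trans ⟨c, hc, h2⟩ (exists_le_trans hvol (exists_le_sampling hpos))
  have hM : 0 < M := by
    have h1 := (hHM _ (ofReal_mem_openStrip hζ 0)).2
    refine lt_of_lt_of_le (norm_pos_iff.2 ?_) h1
    rw [hH]
    exact_mod_cast (hpos _).ne'
  have hH0 : ∀ z ∈ openStrip ζ, H z ≠ 0 := fun z hz =>
    norm_pos_iff.1 ((inv_pos.2 hM).trans_le (hHM z hz).1)
  refine ⟨K, hκ0, hκ, hK, fun t ht htζ h0 =>
    exists_koopman_extension hpos hv hF hvF hvκ hKae hfm hsam ht htζ h0, fun s hs hsζ h0 => ?_,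
    fun s hs hsζ h0 => ?_⟩
  · exact exists_mul_restriction hpos hHa.differentiableOn hHper (fun z hz => (hHM z hz).2)
      (fun x => hH x) hs hsζ
  · refine exists_mul_restriction hpos (G := fun z => (H z)⁻¹) (M := M)
      (hHa.differentiableOn.inv hH0) (fun z hz => by rw [hHper z hz]) (fun z hz => ?_)
      (fun x => ?_) hs hsζ
    · rw [norm_inv]
      exact inv_le_of_inv_le₀ hM (hHM z hz).1
    · rw [hH]
      rfl

/-- With y = 2|k|t, cosh κy ≤ e^{κy} ≤ 2e^{-(1−κ)y} cosh y, and y ≥ 2nt. Taking square roots gives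
the rate and the factor √2. -/
lemma weight_mul_le {κ t : ℝ} (hκ : 0 ≤ κ) (hκ1 : κ ≤ 1) (ht : 0 ≤ t) {n : ℕ} {k : ℤ}
    (hk : n ≤ k.natAbs) :
    weight (κ * t) k ≤ √2 * Real.exp (-(1 - κ) * t * n) * weight t k := by
  have hn : (n : ℝ) ≤ |(k : ℝ)| := by
    rw [← Int.cast_abs, Int.abs_eq_natAbs]
    exact_mod_cast hk
  refine le_of_sq_le_sq ?_ (by have := weight_pos t k; positivity)
  rw [mul_pow, mul_pow, Real.sq_sqrt zero_le_two, weight_sq_of_nonneg (mul_nonneg hκ ht),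
    weight_sq_of_nonneg ht, ← Real.exp_nat_mul, ← Real.cosh_abs (2 * k * t),
    ← Real.cosh_abs (2 * k * (κ * t))]
  have h1 : |2 * (k : ℝ) * (κ * t)| = κ * (2 * |(k : ℝ)| * t) := by
    rw [abs_mul, abs_mul, abs_two, abs_of_nonneg (mul_nonneg hκ ht)]
    ring
  have h2 : |2 * (k : ℝ) * t| = 2 * |(k : ℝ)| * t := by
    rw [abs_mul, abs_mul, abs_two, abs_of_nonneg ht]
  rw [h1, h2]
  set y := 2 * |(k : ℝ)| * t with hy
  have hy0 : 0 ≤ y := by positivity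
  have h3 : Real.cosh (κ * y) ≤ Real.exp (κ * y) := by
    rw [Real.cosh_eq]
    have : Real.exp (-(κ * y)) ≤ Real.exp (κ * y) :=
      Real.exp_le_exp.2 (by have := mul_nonneg hκ hy0; linarith)
    linarith
  have h4 : Real.exp (κ * y) ≤ Real.exp ((2 : ℕ) * (-(1 - κ) * t * n)) * Real.exp y := by
    rw [← Real.exp_add]
    refine Real.exp_le_exp.2 ?_
    have : (1 - κ) * t * n ≤ (1 - κ) * t * |(k : ℝ)| :=
      mul_le_mul_of_nonneg_left hn (mul_nonneg (by linarith) ht)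
    push_cast
    rw [hy]
    linarith
  have h5 : Real.exp y ≤ 2 * Real.cosh y := by
    rw [Real.cosh_eq]
    linarith [Real.exp_pos (-y)]
  calc _ ≤ _ := h3
    _ ≤ _ := h4
    _ ≤ Real.exp ((2 : ℕ) * (-(1 - κ) * t * n)) * (2 * Real.cosh y) := by gcongr
    _ = _ := by ring

lemma weight_neg_le {κ t : ℝ} (hκ : 0 ≤ κ) (hκ1 : κ ≤ 1) (ht : 0 ≤ t) {n : ℕ} {k : ℤ}
    (hk : n ≤ k.natAbs) :
    weight (-t) k ≤ √2 * Real.exp (-(1 - κ) * t * n) * weight (-(κ * t)) k := by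
  have h1 := weight_mul_le hκ hκ1 ht hk
  have h2 := weight_pos t k
  have h3 := weight_pos (κ * t) k
  rw [weight_neg, weight_neg, ← div_eq_mul_inv, le_div_iff₀ h3, inv_mul_le_iff₀ h2]
  linarith

lemma tendsto_rate {κ t : ℝ} (hκ : κ < 1) (ht : 0 < t) :
    Tendsto (fun n : ℕ => Real.exp (-(1 - κ) * t * n)) atTop (𝓝 0) := by
  refine Real.tendsto_exp_atBot.comp ?_
  have h1 : -(1 - κ) * t < 0 := by nlinarith
  exact tendsto_natCast_atTop_atTop.const_mul_atTop_of_neg h1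

namespace IsSmoothing

variable {h : C(Torus, ℝ)} {hpos : ∀ x, 0 < h x} {f : Torus → Torus} {ζ κ : ℝ}
  {K : L2 h →L[ℂ] L2 h}

lemma mul_mem (hK : IsSmoothing hpos f ζ κ K) {t : ℝ} (ht : 0 < t) (htζ : t ≤ ζ) :
    0 < κ * t ∧ κ * t ≤ t ∧ κ * t ≤ ζ := by
  have h1 := hK.pos
  have h2 := hK.lt_one
  have h3 : κ * t ≤ t := by nlinarith
  exact ⟨by positivity, h3, h3.trans htζ⟩

lemma exists_factor (hK : IsSmoothing hpos f ζ κ K) {t : ℝ} (ht : 0 < t) (htζ : t ≤ ζ)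
    (h0 : -t ≤ 0) (h1 : -t ≤ -(κ * t)) : ∃ A : Hardy (-t) →L[ℂ] Hardy (-(κ * t)),
    (∀ φ, (A (Hardy.incl h0 φ)).coeff = (onCoeff hpos K φ).coeff) ∧
    IsExtension h (-t) (koopmanL2 h f) (Hardy.incl h1 ∘L A) ∧
    EDMD.koopman h f (-t) = Hardy.incl h1 ∘L A := by
  obtain ⟨A, hA⟩ := hK.smooth t ht htζ h0
  have h2 : IsExtension h (-t) (koopmanL2 h f) (Hardy.incl h1 ∘L A) :=
    isExtension_of_incl hpos h0 hK.koopman fun a => by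
      rw [ContinuousLinearMap.comp_apply, Hardy.coeff_incl, hA]
  exact ⟨A, hA, h2, h2.extension_eq hpos h0⟩

lemma isExtension_koopman (hK : IsSmoothing hpos f ζ κ K) {t : ℝ} (ht : 0 < t) (htζ : t ≤ ζ) :
    IsExtension h (-t) (koopmanL2 h f) (EDMD.koopman h f (-t)) := by
  obtain ⟨A, -, h1, h2⟩ := hK.exists_factor ht htζ (by linarith)
    (by linarith [(hK.mul_mem ht htζ).2.1])
  rwa [h2]

lemma coeff_koopman (hK : IsSmoothing hpos f ζ κ K) {t : ℝ} (ht : 0 < t) (htζ : t ≤ ζ)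
    (h0 : -t ≤ 0) (φ : Hardy 0) : (EDMD.koopman h f (-t) (Hardy.incl h0 φ)).coeff =
      (onCoeff hpos K φ).coeff := by
  obtain ⟨A, h1, -, h2⟩ := hK.exists_factor ht htζ h0 (by linarith [(hK.mul_mem ht htζ).2.1])
  rw [h2, ContinuousLinearMap.comp_apply, Hardy.coeff_incl, h1]

lemma incl_koopman (hK : IsSmoothing hpos f ζ κ K) {t t' : ℝ} (ht : 0 < t) (htζ : t ≤ ζ)
    (ht' : 0 < t') (htt' : -t ≤ -t') (a : Hardy (-t')) :
    Hardy.incl htt' (EDMD.koopman h f (-t') a) = EDMD.koopman h f (-t) (Hardy.incl htt' a) := by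
  have h0 : -t' ≤ 0 := by linarith
  have h0' : -t ≤ 0 := by linarith
  have h1 := (Hardy.denseRange_incl h0).equalizer
    (Hardy.incl htt' ∘L EDMD.koopman h f (-t')).continuous
    (EDMD.koopman h f (-t) ∘L Hardy.incl htt').continuous (funext fun φ => ?_)
  · exact congrFun h1 a
  · refine Hardy.coeff_injective ?_
    have h2 : Hardy.incl htt' (Hardy.incl h0 φ) = Hardy.incl h0' φ :=
      Hardy.coeff_injective (by simp only [Hardy.coeff_incl])
    simp only [Function.comp_apply, ContinuousLinearMap.comp_apply]
    rw [h2, Hardy.coeff_incl, hK.coeff_koopman ht' (by linarith) h0, hK.coeff_koopman ht htζ h0']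

/-- Each use of smoothing replaces t by κt for generalised eigenvectors with nonzero eigenvalue.
Finitely many steps reach any positive t', since κⁿt tends to 0. -/
lemma exists_preimage (hK : IsSmoothing hpos f ζ κ K) {ν : ℂ} (hν : ν ≠ 0) {t t' : ℝ} (ht : 0 < t)
    (htζ : t ≤ ζ) (ht' : 0 < t') (htt' : -t ≤ -t') {a : Hardy (-t)}
    (ha : a ∈ maxGenEigenspace (EDMD.koopman h f (-t) : End ℂ (Hardy (-t))) ν) :
    ∃ b : Hardy (-t'), Hardy.incl htt' b = a := by
  have key : ∀ (n : ℕ) (t : ℝ), 0 < t → t ≤ ζ → ∀ a : Hardy (-t),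
      a ∈ maxGenEigenspace (EDMD.koopman h f (-t) : End ℂ (Hardy (-t))) ν →
      a.coeff ∈ hardySubmodule (-(κ ^ n * t)) := by
    intro n
    induction n with
    | zero =>
      intro t _ _ a _
      rw [pow_zero, one_mul]
      exact a.coeff_mem
    | succ n ih =>
      intro t ht htζ a ha
      obtain ⟨h1, h2, h3⟩ := hK.mul_mem ht htζ
      have h4 : -t ≤ -(κ * t) := by linarith
      obtain ⟨A, -, -, hA⟩ := hK.exists_factor ht htζ (by linarith) h4
      obtain ⟨b, hb⟩ := exists_preimage_of_mem_maxGenEigenspace (J := Hardy.incl h4) (B := A)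
        (fun y => by rw [hA]; rfl) hν ha
      rw [← hb, mem_maxGenEigenspace_iff_of_intertwine (hK.incl_koopman ht htζ h1 h4)
        (Hardy.incl_injective h4)] at ha
      have h5 := ih (κ * t) h1 h3 b ha
      rw [← hb, Hardy.coeff_incl, pow_succ, mul_assoc]
      exact h5
  obtain ⟨n, hn⟩ := exists_pow_lt_of_lt_one (div_pos ht' ht) hK.lt_one
  have h1 := key n t ht htζ a ha
  have h2 : -t' ≤ -(κ ^ n * t) := by
    rw [lt_div_iff₀ ht] at hn
    linarith
  refine ⟨Hardy.incl h2 (Hardy.mk _ h1), Hardy.coeff_injective ?_⟩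
  rw [Hardy.coeff_incl, Hardy.coeff_incl, Hardy.coeff_mk]

/-- The inclusion intertwines the two operators, and the regularity of generalised eigenvectors
makes it onto between the eigenspaces. -/
lemma finrank_genSpace_eq (hK : IsSmoothing hpos f ζ κ K) {ν : ℂ} (hν : ν ≠ 0) {t t' : ℝ}
    (ht : 0 < t) (htζ : t ≤ ζ) (ht' : 0 < t') (htt' : t' ≤ t) :
    finrank ℂ (genSpace (EDMD.koopman h f (-t')) {ν}) =
      finrank ℂ (genSpace (EDMD.koopman h f (-t)) {ν}) := by
  have h1 : -t ≤ -t' := by linarith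
  rw [genSpace_singleton, genSpace_singleton]
  exact finrank_maxGenEigenspace_eq (hK.incl_koopman ht htζ ht' h1) (Hardy.incl_injective h1)
    fun y hy => hK.exists_preimage hν ht htζ ht' h1 hy

/-! #### The projections -/

lemma exists_proj (hK : IsSmoothing hpos f ζ κ K) {t : ℝ} (ht : 0 < t) (htζ : t ≤ ζ)
    (h0 : -t ≤ 0) : ∃ C : ℝ, ∀ n, ‖proj h n (-t)‖ ≤ C ∧
      IsExtension h (-t) (projL2 h n) (proj h n (-t)) ∧
      ∀ φ, (proj h n (-t) (Hardy.incl h0 φ)).coeff = (projCoeff hpos n φ).coeff := by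
  obtain ⟨A, hA⟩ := hK.mul t ht htζ ht.le
  obtain ⟨B, hB⟩ := hK.div t ht htζ ht.le
  obtain ⟨C, hC⟩ := exists_proj_extension hpos ht.le h0 hA hB
  refine ⟨C, fun n => ?_⟩
  obtain ⟨Q, hQ, hQc⟩ := hC n
  have h1 : IsExtension h (-t) (projL2 h n) Q :=
    isExtension_of_incl hpos h0 (T := (trigPoly h n).starProjection) (fun _ => rfl) hQc
  have h2 : proj h n (-t) = Q := h1.extension_eq hpos h0
  rw [h2]
  exact ⟨hQ, h1, hQc⟩

end IsSmoothing

section Properties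

variable {h : C(Torus, ℝ)} (hpos : ∀ x, 0 < h x) {s : ℝ} {n : ℕ}

lemma proj_neg_eq_self (h0 : s ≤ 0) {Q : Hardy s →L[ℂ] Hardy s}
    (hQ : ∀ φ, (Q (Hardy.incl h0 φ)).coeff = (projCoeff hpos n φ).coeff) {a : Hardy s}
    (ha : ∀ k : ℤ, n ≤ k.natAbs → a.coeff k = 0) : Q a = a := by
  obtain ⟨p, rfl, -⟩ := Hardy.exists_eq_ofFinsupp ha
  refine Hardy.coeff_injective ?_
  rw [← Hardy.incl_ofFinsupp h0, hQ, Hardy.coeff_incl, projCoeff_eq_self hpos fun k hk => ?_]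
  have := ha k hk
  rwa [Hardy.coeff_ofFinsupp] at this ⊢

lemma proj_neg_coeff_eq_zero (h0 : s ≤ 0) {Q : Hardy s →L[ℂ] Hardy s}
    (hQ : ∀ φ, (Q (Hardy.incl h0 φ)).coeff = (projCoeff hpos n φ).coeff) (a : Hardy s) {k : ℤ}
    (hk : n ≤ k.natAbs) : (Q a).coeff k = 0 := by
  have h1 := (Hardy.denseRange_incl h0).equalizer (Hardy.coeffCLM s k ∘L Q).continuous
    (0 : Hardy s →L[ℂ] ℂ).continuous (funext fun φ => ?_)
  · exact congrFun h1 a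
  · change (Q (Hardy.incl h0 φ)).coeff k = 0
    rw [hQ, projCoeff_coeff_eq_zero hpos _ hk]

lemma proj_pos_eq_self (h0 : 0 ≤ s) {Q : Hardy s →L[ℂ] Hardy s}
    (hQ : ∀ a, (Q a).coeff = (projCoeff hpos n (Hardy.incl h0 a)).coeff) {a : Hardy s}
    (ha : ∀ k : ℤ, n ≤ k.natAbs → a.coeff k = 0) : Q a = a := by
  refine Hardy.coeff_injective ?_
  rw [hQ, projCoeff_eq_self hpos fun k hk => ?_, Hardy.coeff_incl]
  rw [Hardy.coeff_incl, ha k hk]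

/-- Operators which smooth are approximated by their compressions to trigonometric polynomials. -/
lemma approximates_of_factor {s s' : ℝ} (hss : s ≤ s') {A : Hardy s →L[ℂ] Hardy s'}
    {Q : ℕ → Hardy s →L[ℂ] Hardy s} {ε : ℕ → ℝ} {C D : ℝ} (hC : ∀ n, ‖Q n‖ ≤ C)
    (hQ : ∀ n (a : Hardy s), (∀ k : ℤ, n ≤ k.natAbs → a.coeff k = 0) → Q n a = a)
    (hQ0 : ∀ n (a : Hardy s) (k : ℤ), n ≤ k.natAbs → (Q n a).coeff k = 0) (hD : 0 ≤ D)
    (hε : ∀ n, 0 ≤ ε n)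
    (hw : ∀ n (k : ℤ), n ≤ k.natAbs → weight s k ≤ D * ε n * weight s' k)
    (hε0 : Tendsto ε atTop (𝓝 0)) :
    Approximates (Hardy.incl hss ∘L A) Q ε where
  idem n := ContinuousLinearMap.ext fun a => hQ n _ fun k hk => hQ0 n a k hk
  finite n := Hardy.finiteDimensional_of_coeff (n := n) (by
    rintro _ ⟨a, rfl⟩ k hk
    exact hQ0 n a k hk)
  bound := by
    refine ⟨(C + 1) * D * ‖A‖, fun n => ?_⟩
    -- All the smallness comes from the inclusion; A enters only through its norm.
    have h1 : Q n * (Hardy.incl hss ∘L A) - Hardy.incl hss ∘L A =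
        (Q n ∘L Hardy.incl hss - Hardy.incl hss) ∘L A := by
      ext a
      rfl
    rw [h1]
    calc _ ≤ ‖Q n ∘L Hardy.incl hss - Hardy.incl hss‖ * ‖A‖ :=
          ContinuousLinearMap.opNorm_comp_le _ _
      _ ≤ ((‖Q n‖ + 1) * (D * ε n)) * ‖A‖ := by
          gcongr
          exact Hardy.norm_comp_incl_sub_le hss (hQ n) (mul_nonneg hD (hε n)) (hw n)
      _ ≤ ((C + 1) * (D * ε n)) * ‖A‖ := by
          have := hε n
          gcongr
          exact hC n
      _ = _ := by ring
  tendsto := hε0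

end Properties

end

section

open Complex Module Module.End

/-! ### Left generalised eigenfunctions -/

section Left

variable {h : C(Torus, ℝ)} (hpos : ∀ x, 0 < h x) {s : ℝ}

/-- The form `(1/2π) ∫ a φ dμ`. -/
def form (hs : 0 ≤ s) (a : Hardy s) (φ : Hardy 0) : ℂ :=
  Hardy.dual (mulDensity hpos (Hardy.incl hs a)) φ

lemma integral_eval_mul_eq_form (hs : 0 < s) (a : Hardy s) (φ : L2 h) :
    ∫ x, a.eval x * φ x ∂(sampling h) =
      2 * Real.pi * form hpos hs.le a (fourierEquiv hpos φ) := a.integral_eval_mul hpos hs φ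

lemma form_eq_pair (hs : 0 ≤ s) (h0 : -s ≤ 0) {M : Hardy s →L[ℂ] Hardy s}
    (hM : ∀ a, (M a).coeff = (mulDensity hpos (Hardy.incl hs a)).coeff) (a : Hardy s)
    (φ : Hardy 0) : form hpos hs a φ = Hardy.pair s (M a) (Hardy.incl h0 φ) := by
  have h1 : Hardy.incl hs (M a) = mulDensity hpos (Hardy.incl hs a) :=
    Hardy.coeff_injective (by rw [Hardy.coeff_incl, hM])
  rw [Hardy.pair_incl_right hs, h1, form]

lemma form_injective (hs : 0 ≤ s) {a a' : Hardy s}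
    (haa : ∀ φ, form hpos hs a φ = form hpos hs a' φ) : a = a' := by
  have h1 := Hardy.dual_left_injective haa
  have h2 := congrArg (divDensity hpos) h1
  rw [divDensity_mulDensity, divDensity_mulDensity] at h2
  exact Hardy.incl_injective hs h2

lemma form_fourierEquiv (hs : 0 ≤ s) (a : Hardy s) : ∃ L : Hardy 0 →L[ℂ] ℂ,
    ∀ φ, L φ = form hpos hs a φ := by
  let b := mulDensity hpos (Hardy.incl hs a)
  have h0 : -(0 : ℝ) ≤ 0 := neg_zero.le
  refine ⟨Hardy.pair 0 b ∘L Hardy.incl h0, fun φ => ?_⟩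
  rw [ContinuousLinearMap.comp_apply, Hardy.pair_incl_right le_rfl]
  rfl

lemma form_sub_smul_right (hs : 0 ≤ s) (a : Hardy s) (ν : ℂ) (φ ψ : Hardy 0) :
    form hpos hs a (ψ - ν • φ) = form hpos hs a ψ - ν * form hpos hs a φ := by
  obtain ⟨L, hL⟩ := form_fourierEquiv hpos hs a
  rw [← hL, ← hL, ← hL, map_sub, map_smul, smul_eq_mul]

lemma form_sub_smul_left (hs : 0 ≤ s) (a b : Hardy s) (ν : ℂ) (φ : Hardy 0) :
    form hpos hs (b - ν • a) φ = form hpos hs b φ - ν * form hpos hs a φ := by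
  have h1 : mulDensity hpos (Hardy.incl hs (b - ν • a)) =
      mulDensity hpos (Hardy.incl hs b) - ν • mulDensity hpos (Hardy.incl hs a) := by
    rw [map_sub, map_sub, map_smul, map_smul]
  have h0 : -(0 : ℝ) ≤ 0 := neg_zero.le
  have h2 : ∀ c : Hardy 0, Hardy.dual c φ = Hardy.pair 0 c (Hardy.incl h0 φ) := by
    intro c
    rw [Hardy.pair_incl_right le_rfl]
    congr 1
  rw [form, form, form, h1, h2, h2, h2, map_sub, map_smul]
  rfl

lemma form_zero (hs : 0 ≤ s) (φ : Hardy 0) : form hpos hs 0 φ = 0 := by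
  have h1 := form_sub_smul_left hpos hs 0 0 1 φ
  rwa [smul_zero, sub_zero, one_mul, sub_self] at h1

/-- The left generalised eigenspaces are the generalised eigenspaces of a transpose. -/
lemma leftSpace_eq_genSpace (hs : 0 < s) {R : L2 h → L2 h} {T : L2 h →L[ℂ] L2 h}
    (hT : ∀ φ, T φ = R φ) {S : Hardy s →L[ℂ] Hardy s}
    (hS : ∀ a φ, form hpos hs.le (S a) φ = form hpos hs.le a (onCoeff hpos T φ)) (E : Set ℂ) :
    leftSpace h s R E = genSpace S E := by
  have hpi : (2 * Real.pi : ℂ) ≠ 0 := by exact_mod_cast Real.two_pi_pos.ne'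
  -- Powers of R − ν on φ move through the form to powers of S − ν on a. As the form is
  -- nondegenerate in a, the left condition becomes that of a generalised eigenvector, and the set
  -- being spanned is already a subspace.
  have hiter : ∀ (ν : ℂ) (j : ℕ) (a : Hardy s) (φ : L2 h),
      form hpos hs.le a (fourierEquiv hpos ((fun ψ : L2 h => R ψ - ν • ψ)^[j] φ)) =
        form hpos hs.le ((((S : End ℂ (Hardy s)) - ν • 1) ^ j) a) (fourierEquiv hpos φ) := by
    intro ν j a
    induction j with
    | zero => intro φ; simp
    | succ j ih =>
      intro φ
      rw [Function.iterate_succ_apply, ih, pow_succ', End.mul_apply]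
      set b := (((S : End ℂ (Hardy s)) - ν • 1) ^ j) a
      have h1 : ((S : End ℂ (Hardy s)) - ν • 1) b = S b - ν • b := by simp
      rw [h1, form_sub_smul_left, hS, onCoeff_fourierEquiv, map_sub, map_smul,
        form_sub_smul_right, hT]
  unfold leftSpace genSpace
  congr 1
  funext ν
  congr 1
  funext _
  have h2 : {a : Hardy s | ∃ j : ℕ, ∀ φ : L2 h,
      ∫ x, a.eval x * ((fun ψ : L2 h => R ψ - ν • ψ)^[j] φ : L2 h) x ∂(sampling h) = 0} =
      maxGenEigenspace (S : End ℂ (Hardy s)) ν := by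
    ext a
    simp only [Set.mem_ofPred_eq, SetLike.mem_coe, mem_maxGenEigenspace]
    refine exists_congr fun j => ?_
    simp only [integral_eval_mul_eq_form hpos hs, mul_eq_zero, hpi, false_or, hiter]
    constructor
    · intro h3
      refine form_injective hpos hs.le fun φ => ?_
      obtain ⟨φ, rfl⟩ := (fourierEquiv hpos).surjective φ
      rw [h3, form_zero]
    · intro h3 φ
      rw [h3, form_zero]
  rw [h2, Submodule.span_eq]

end Left

namespace IsSmoothing

variable {h : C(Torus, ℝ)} {hpos : ∀ x, 0 < h x} {f : Torus → Torus} {ζ κ : ℝ}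
  {K : L2 h →L[ℂ] L2 h}

/-- The transpose of the Koopman operator with respect to `μ` on the Hardy spaces. -/
lemma exists_transpose (hK : IsSmoothing hpos f ζ κ K) {t : ℝ} (ht : 0 < t) (htζ : t ≤ ζ)
    (h0 : 0 ≤ κ * t) (h1 : κ * t ≤ t) : ∃ L : Hardy (κ * t) →L[ℂ] Hardy t,
    (∀ a φ, form hpos h0 (Hardy.incl h1 (L a)) φ = form hpos h0 a (onCoeff hpos K φ)) ∧
    ∀ ν, HasEigenvalue ((Hardy.incl h1 ∘L L : Hardy (κ * t) →L[ℂ] Hardy (κ * t)) :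
      End ℂ (Hardy (κ * t))) ν → ν ∈ spectrum ℂ (EDMD.koopman h f (-(κ * t))) := by
  obtain ⟨hs, -, hsζ⟩ := hK.mul_mem ht htζ
  have ht0 : -t ≤ 0 := by linarith
  have hs0 : -(κ * t) ≤ 0 := by linarith
  obtain ⟨A, hA⟩ := hK.smooth t ht htζ ht0
  obtain ⟨B, -, hB⟩ := Hardy.exists_transpose A
  obtain ⟨M, hM⟩ := hK.mul (κ * t) hs hsζ h0
  obtain ⟨D, hD⟩ := hK.div t ht htζ ht.le
  -- The transpose for μ is h⁻¹Bh with B the transpose of K for dx. Multiplication by h takes place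
  -- in H²_{κt}, division in H²_t, after the smoothing.
  have hform : ∀ a φ, form hpos h0 (Hardy.incl h1 (D (B (M a)))) φ =
      form hpos h0 a (onCoeff hpos K φ) := by
    intro a φ
    have h2 : Hardy.incl h0 (Hardy.incl h1 (D (B (M a)))) =
        divDensity hpos (Hardy.incl ht.le (B (M a))) :=
      Hardy.coeff_injective (by rw [Hardy.coeff_incl, Hardy.coeff_incl, hD])
    have h3 : A (Hardy.incl ht0 φ) = Hardy.incl hs0 (onCoeff hpos K φ) :=
      Hardy.coeff_injective (by rw [hA, Hardy.coeff_incl])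
    rw [form_eq_pair hpos h0 hs0 hM a, form, h2, mulDensity_divDensity,
      ← Hardy.pair_incl_right ht.le ht0, hB, h3]
  refine ⟨D ∘L B ∘L M, hform, fun ν hν => ?_⟩
  obtain ⟨a, ha⟩ := hν.exists_hasEigenvector
  have hLa : Hardy.incl h1 (D (B (M a))) = ν • a := ha.apply_eq_smul
  -- For ν outside the spectrum, ν − K is onto. The functional given by ha vanishes on its range, so
  -- it is zero, and so is a.
  by_contra hspec
  have hunit : IsUnit (algebraMap ℂ (Hardy (-(κ * t)) →L[ℂ] Hardy (-(κ * t))) ν -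
      EDMD.koopman h f (-(κ * t))) := by
    rwa [spectrum.mem_iff, not_not] at hspec
  have hzero : ∀ ψ, Hardy.pair (κ * t) (M a) ((algebraMap ℂ (Hardy (-(κ * t)) →L[ℂ]
      Hardy (-(κ * t))) ν - EDMD.koopman h f (-(κ * t))) ψ) = 0 := by
    intro ψ
    have h2 := (Hardy.denseRange_incl hs0).equalizer
      (Hardy.pair (κ * t) (M a) ∘L (algebraMap ℂ (Hardy (-(κ * t)) →L[ℂ]
        Hardy (-(κ * t))) ν - EDMD.koopman h f (-(κ * t)))).continuous
      (0 : Hardy (-(κ * t)) →L[ℂ] ℂ).continuous (funext fun φ => ?_)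
    · exact congrFun h2 ψ
    · have h3 : EDMD.koopman h f (-(κ * t)) (Hardy.incl hs0 φ) =
          Hardy.incl hs0 (onCoeff hpos K φ) :=
        Hardy.coeff_injective (by rw [hK.coeff_koopman hs hsζ hs0, Hardy.coeff_incl])
      have h4 : (algebraMap ℂ (Hardy (-(κ * t)) →L[ℂ] Hardy (-(κ * t))) ν -
          EDMD.koopman h f (-(κ * t))) (Hardy.incl hs0 φ) =
          ν • Hardy.incl hs0 φ - Hardy.incl hs0 (onCoeff hpos K φ) := by
        rw [sub_apply, h3, Algebra.algebraMap_eq_smul_one]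
        rfl
      have h5 := hform a φ
      have h6 := form_sub_smul_left hpos h0 a 0 (-ν) φ
      rw [neg_smul, sub_neg_eq_add, zero_add, form_zero] at h6
      rw [hLa, h6] at h5
      simp only [Function.comp_apply, ContinuousLinearMap.comp_apply]
      rw [h4, map_sub, map_smul, ← form_eq_pair hpos h0 hs0 hM, ← form_eq_pair hpos h0 hs0 hM,
        ← h5, smul_eq_mul, zero_apply]
      ring
  have hMa : M a = 0 := by
    refine Hardy.pair_left_injective fun ψ => ?_
    obtain ⟨u, hu⟩ := hunit
    have h2 : (algebraMap ℂ (Hardy (-(κ * t)) →L[ℂ] Hardy (-(κ * t))) ν -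
        EDMD.koopman h f (-(κ * t))) ((↑u⁻¹ : Hardy (-(κ * t)) →L[ℂ] Hardy (-(κ * t))) ψ) = ψ := by
      rw [← hu]
      exact congrArg (fun T : Hardy (-(κ * t)) →L[ℂ] Hardy (-(κ * t)) => T ψ) u.mul_inv
    rw [← h2, hzero, map_zero, zero_apply]
  refine ha.2 (form_injective hpos h0 fun φ => ?_)
  rw [form_eq_pair hpos h0 hs0 hM, form_eq_pair hpos h0 hs0 hM, hMa, map_zero M]

/-! ### Convergence -/

lemma approximates_koopman (hK : IsSmoothing hpos f ζ κ K) {t : ℝ} (ht : 0 < t) (htζ : t ≤ ζ) :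
    Approximates (EDMD.koopman h f (-t)) (fun n => proj h n (-t))
      (fun n : ℕ => Real.exp (-(1 - κ) * t * n)) := by
  have h0 : -t ≤ 0 := by linarith
  have h1 : -t ≤ -(κ * t) := by linarith [(hK.mul_mem ht htζ).2.1]
  obtain ⟨A, -, -, hA⟩ := hK.exists_factor ht htζ h0 h1
  obtain ⟨C, hC⟩ := hK.exists_proj ht htζ h0
  rw [hA]
  exact approximates_of_factor h1 (fun n => (hC n).1)
    (fun n a ha => proj_neg_eq_self hpos h0 (hC n).2.2 ha)
    (fun n a k hk => proj_neg_coeff_eq_zero hpos h0 (hC n).2.2 a hk) (Real.sqrt_nonneg 2)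
    (fun n => (Real.exp_pos _).le)
    (fun n k hk => weight_neg_le hK.pos.le hK.lt_one.le ht.le hk) (tendsto_rate hK.lt_one ht)

/-- Both operators are compact, so nonzero spectrum consists of eigenvalues, and an eigenvector in
the smaller space is one in the larger. -/
lemma mem_spectrum_of_le (hK : IsSmoothing hpos f ζ κ K) {t t' : ℝ} (ht : 0 < t) (htζ : t ≤ ζ)
    (ht' : 0 < t') (htt' : t' ≤ t) {z : ℂ} (hz : z ≠ 0)
    (hzs : z ∈ spectrum ℂ (EDMD.koopman h f (-t'))) : z ∈ spectrum ℂ (EDMD.koopman h f (-t)) := by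
  have h1 : -t ≤ -t' := by linarith
  have hc' := (hK.approximates_koopman ht' (htt'.trans htζ)).compact
  have hc := (hK.approximates_koopman ht htζ).compact
  rw [← hc'.hasEigenvalue_iff_mem_spectrum hz] at hzs
  rw [← hc.hasEigenvalue_iff_mem_spectrum hz]
  obtain ⟨a, ha⟩ := hzs.exists_hasEigenvector
  have h2 : EDMD.koopman h f (-t') a = z • a := ha.apply_eq_smul
  refine hasEigenvalue_of_hasEigenvector (x := Hardy.incl h1 a)
    ⟨mem_eigenspace_iff.2 ?_, fun h3 => ha.2 (Hardy.incl_injective h1 (by rw [h3, map_zero]))⟩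
  change EDMD.koopman h f (-t) (Hardy.incl h1 a) = _
  rw [← hK.incl_koopman ht htζ ht' h1, h2, map_smul]

/-- The transposes, with their approximations. -/
lemma exists_left_approximation (hK : IsSmoothing hpos f ζ κ K) {t : ℝ} (ht : 0 < t)
    (htζ : t ≤ ζ) :
    ∃ (L : Hardy (κ * t) →L[ℂ] Hardy (κ * t)) (Q : ℕ → Hardy (κ * t) →L[ℂ] Hardy (κ * t)),
      Approximates L Q (fun n : ℕ => Real.exp (-(1 - κ) * t * n)) ∧
      (∀ E, leftSpace h (κ * t) (koopmanL2 h f) E = genSpace L E) ∧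
      (∀ n E, leftSpace h (κ * t) (edmdL2 h f n) E = genSpace (Q n * L * Q n) E) ∧
      ∀ z, z ≠ 0 → z ∈ spectrum ℂ L → z ∈ spectrum ℂ (EDMD.koopman h f (-(κ * t))) := by
  obtain ⟨hs, h1, hsζ⟩ := hK.mul_mem ht htζ
  obtain ⟨L, hL, hLs⟩ := hK.exists_transpose ht htζ hs.le h1
  have hL' : ∀ a φ, form hpos hs.le ((Hardy.incl h1 ∘L L) a) φ =
      form hpos hs.le a (onCoeff hpos K φ) := hL
  obtain ⟨C, hC⟩ := exists_proj_restriction hpos hs.le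
  choose Q hQ hQc using hC
  have happ : Approximates (Hardy.incl h1 ∘L L) Q (fun n : ℕ => Real.exp (-(1 - κ) * t * n)) :=
    approximates_of_factor h1 hQ (fun n a ha => proj_pos_eq_self hpos hs.le (hQc n) ha)
      (fun n a k hk => by rw [hQc, projCoeff_coeff_eq_zero hpos _ hk]) (Real.sqrt_nonneg 2)
      (fun n => (Real.exp_pos _).le)
      (fun n k hk => weight_mul_le hK.pos.le hK.lt_one.le ht.le hk) (tendsto_rate hK.lt_one ht)
  -- P_n is its own transpose for μ, so the transpose of P_n K P_n is the compression Q n * L * Q n.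
  have hQf : ∀ n a φ, form hpos hs.le (Q n a) φ = form hpos hs.le a (projCoeff hpos n φ) := by
    intro n a φ
    have h2 : Hardy.incl hs.le (Q n a) = projCoeff hpos n (Hardy.incl hs.le a) :=
      Hardy.coeff_injective (by rw [Hardy.coeff_incl, hQc])
    rw [form, h2, dual_mulDensity_projCoeff, form]
  generalize Hardy.incl h1 ∘L L = L' at happ hL' hLs
  refine ⟨L', Q, happ,
    fun E => leftSpace_eq_genSpace hpos hs hK.koopman hL' E, fun n E => ?_, fun z hz hzs => ?_⟩
  · let P : L2 h →L[ℂ] L2 h := (trigPoly h n).starProjection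
    refine leftSpace_eq_genSpace hpos hs (T := P ∘L K ∘L P) (fun φ => ?_) (fun a φ => ?_) E
    · rw [ContinuousLinearMap.comp_apply, ContinuousLinearMap.comp_apply, hK.koopman]
      rfl
    · rw [mul_apply_eq_comp, mul_apply_eq_comp, hQf, hL', hQf]
      obtain ⟨φ, rfl⟩ := (fourierEquiv hpos).surjective φ
      rw [projCoeff, onCoeff_fourierEquiv, onCoeff_fourierEquiv, onCoeff_fourierEquiv,
        onCoeff_fourierEquiv, ContinuousLinearMap.comp_apply, ContinuousLinearMap.comp_apply]
  · exact hLs z ((happ.compact.hasEigenvalue_iff_mem_spectrum hz).2 hzs)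

end IsSmoothing

lemma isolates_of_spectrum {X : Type*} [NormedAddCommGroup X] [NormedSpace ℂ X]
    {A : X →L[ℂ] X} {lam : ℂ} {R : ℝ} (hA : IsCompactOperator A) (hR : 0 < R) (hRl : R < ‖lam‖)
    (hs : ∀ z ∈ Metric.closedBall lam R, z ∈ spectrum ℂ A → z = lam) :
    Isolates A lam (R / 2) R where
  compact := hA
  pos := half_pos hR
  lt := half_lt_self hR
  zero_notMem h := by
    rw [Metric.mem_closedBall, dist_zero_left] at h
    linarith
  subset z hz := by
    by_contra h
    have h1 := hs z hz.1 h
    refine hz.2 ?_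
    rw [h1]
    exact Metric.mem_ball_self (half_pos hR)

lemma le_exp_div_of_pow_le {x C b : ℝ} {m : ℕ} (hm : m ≠ 0)
    (h : x ^ m ≤ C * Real.exp b) : x ≤ |C| ^ (1 / (m : ℝ)) * Real.exp (b / m) := by
  have hm' : (m : ℝ) ≠ 0 := by exact_mod_cast hm
  refine le_of_pow_le_pow_left₀ hm (by positivity) (h.trans ?_)
  rw [mul_pow, ← Real.rpow_natCast, ← Real.rpow_mul (abs_nonneg C), one_div_mul_cancel hm',
    Real.rpow_one, ← Real.exp_nat_mul, mul_div_cancel₀ _ hm']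
  gcongr
  exact le_abs_self C

end

end EDMD

end

/-! ### The convergence theorem -/

theorem corollary4 (f : EDMD.Torus → EDMD.Torus) (h : C(EDMD.Torus, ℝ)) (ζ κ α D M : ℝ) (q : ℝ≥0∞)
    (hζ : 0 < ζ) (hκ : κ < 1) (hα : 0 < α) (hD : D ≤ Real.pi / 3 * ζ ^ (-α))
    (hf : EDMD.IsAnalyticExpanding f ζ κ α D)
    (hq : 1 ≤ q) (hq' : q ≠ ∞) (hh : EDMD.IsAnalyticDensity h ζ M q) :
    -- the Koopman operator and the projections do extend to the spaces of hyperdistributions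
    (∀ t ∈ Set.Ioc 0 ζ,
      EDMD.IsExtension h (-t) (EDMD.koopmanL2 h f) (EDMD.koopman h f (-t)) ∧
      ∀ n : ℕ, EDMD.IsExtension h (-t) (EDMD.projL2 h n) (EDMD.proj h n (-t))) ∧
    ∀ (lam : ℂ) (m : ℕ), lam ≠ 0 →
      Module.End.HasEigenvalue (EDMD.koopman h f (-ζ) : Module.End ℂ (EDMD.Hardy (-ζ))) lam →
      m = Module.finrank ℂ (EDMD.rightSpace (EDMD.koopman h f (-ζ)) {lam}) →
      -- the multiplicity is finite, and the eigenvalue is isolated in the spectrum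
      FiniteDimensional ℂ (EDMD.rightSpace (EDMD.koopman h f (-ζ)) {lam}) ∧
      ∃ r > 0, Metric.closedBall lam r ∩ spectrum ℂ (EDMD.koopman h f (-ζ)) = {lam} ∧
        -- exactly `m` eigenvalues, with multiplicity, of the EDMD operator correspond to it
        (∀ᶠ n : ℕ in atTop, Module.finrank ℂ
          (EDMD.rightSpace (EDMD.edmd h f n (-ζ)) (Metric.closedBall lam r)) = m) ∧
        -- the error of these eigenvalues
        (∃ C : ℝ, ∀ᶠ n : ℕ in atTop, ∀ ν ∈ Metric.closedBall lam r,
          Module.End.HasEigenvalue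
            (EDMD.edmd h f n (-ζ) : Module.End ℂ (EDMD.Hardy (-ζ))) ν →
          ‖ν - lam‖ ≤ C * Real.exp (-(1 - κ) * ζ * n / m)) ∧
        ∀ t ∈ Set.Ioc 0 ζ,
          -- the multiplicity does not depend on the space
          Module.finrank ℂ (EDMD.rightSpace (EDMD.koopman h f (-t)) {lam}) = m ∧
          -- the error of the right generalised eigenspaces
          (fun n : ℕ => EDMD.gap (EDMD.rightSpace (EDMD.koopman h f (-t)) {lam})
              (EDMD.rightSpace (EDMD.edmd h f n (-t)) (Metric.closedBall lam r)))
            =O[atTop] (fun n : ℕ => Real.exp (-(1 - κ) * t * n)) ∧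
          -- the error of the left generalised eigenspaces
          (fun n : ℕ => EDMD.gap (EDMD.leftSpace h (κ * t) (EDMD.koopmanL2 h f) {lam})
              (EDMD.leftSpace h (κ * t) (EDMD.edmdL2 h f n) (Metric.closedBall lam r)))
            =O[atTop] (fun n : ℕ => Real.exp (-(1 - κ) * t * n)) := by
  have hpos := hh.1
  obtain ⟨K, hK⟩ := EDMD.exists_isSmoothing hζ hκ hf hh
  refine ⟨fun t ht => ⟨hK.isExtension_koopman ht.1 ht.2, fun n => ?_⟩, ?_⟩
  · obtain ⟨C, hC⟩ := hK.exists_proj ht.1 ht.2 (by linarith [ht.1])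
    exact (hC n).2.1
  intro lam m hlam hev hm
  have happ := fun t (ht : t ∈ Set.Ioc 0 ζ) => hK.approximates_koopman ht.1 ht.2
  have hζ' : ζ ∈ Set.Ioc 0 ζ := ⟨hζ, le_rfl⟩
  obtain ⟨R, hR, hRl, hRs⟩ := EDMD.exists_isolating_radius (happ ζ hζ').compact hlam
  have hball : Metric.closedBall lam (R / 2) ⊆ Metric.closedBall lam R :=
    Metric.closedBall_subset_closedBall (half_le_self hR.le)
  have hmem : lam ∈ Metric.closedBall lam (R / 2) := Metric.mem_closedBall_self (half_pos hR).le
  have hne : ∀ z ∈ Metric.closedBall lam R, z ≠ 0 := by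
    rintro z hz rfl
    rw [Metric.mem_closedBall, dist_zero_left] at hz
    linarith
  -- Nonzero spectrum on H²_{-t} is contained in that on H²_{-ζ}, so one isolating radius serves
  -- every t.
  have hspec : ∀ t ∈ Set.Ioc 0 ζ, ∀ z ∈ Metric.closedBall lam R,
      z ∈ spectrum ℂ (EDMD.koopman h f (-t)) → z = lam := fun t ht z hz hzs =>
    hRs z hz (hK.mem_spectrum_of_le hζ le_rfl ht.1 ht.2 (hne z hz) hzs)
  have hI := fun t (ht : t ∈ Set.Ioc 0 ζ) =>
    EDMD.isolates_of_spectrum (happ t ht).compact hR hRl (hspec t ht)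
  have hgen := fun t (ht : t ∈ Set.Ioc 0 ζ) => EDMD.Approximates.genSpace_eq_singleton
    (A := EDMD.koopman h f (-t)) (fun z hz => hspec t ht z (hball hz)) hmem
  have hedmd : ∀ (t : ℝ) (n : ℕ), EDMD.edmd h f n (-t) =
      EDMD.proj h n (-t) * EDMD.koopman h f (-t) * EDMD.proj h n (-t) := fun t n =>
    (mul_assoc _ _ _).symm
  have hfin : FiniteDimensional ℂ (EDMD.rightSpace (EDMD.koopman h f (-ζ)) {lam}) := by
    change FiniteDimensional ℂ (EDMD.genSpace (EDMD.koopman h f (-ζ)) {lam})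
    rw [← hgen ζ hζ', (hI ζ hζ').genSpace_eq]
    exact (hI ζ hζ').finiteDimensional_range
  -- Needed for extracting the m-th root: an eigenvector rules out the value 0 of `finrank`.
  have hm0 : m ≠ 0 := by
    rintro rfl
    have h1 := Submodule.finrank_eq_zero.1 hm.symm
    obtain ⟨a, ha⟩ := hev.exists_hasEigenvector
    have h2 : a ∈ EDMD.genSpace (EDMD.koopman h f (-ζ)) {lam} := by
      rw [EDMD.genSpace_singleton]
      exact Module.End.eigenspace_le_maxGenEigenspace ha.1
    exact ha.2 ((Submodule.eq_bot_iff _).1 h1 a h2)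
  refine ⟨hfin, R / 2, half_pos hR, ?_, ?_, ?_, fun t ht => ⟨?_, ?_, ?_⟩⟩
  · ext z
    constructor
    · rintro ⟨hz, hzs⟩
      exact hRs z (hball hz) hzs
    · rintro rfl
      exact ⟨hmem, ((happ ζ hζ').compact.hasEigenvalue_iff_mem_spectrum hlam).1 hev⟩
  · filter_upwards [(happ ζ hζ').eventually_finrank_eq (hI ζ hζ')] with n hn
    rw [hm, hedmd]
    refine hn.trans ?_
    rw [hgen ζ hζ']
    rfl
  · obtain ⟨C, hC⟩ := (happ ζ hζ').eigenvalue_bound (hI ζ hζ') (hgen ζ hζ')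
    refine ⟨|C| ^ (1 / (m : ℝ)), ?_⟩
    filter_upwards [hC] with n hn ν hν hνe
    rw [hedmd] at hνe
    refine EDMD.le_exp_div_of_pow_le hm0 ?_
    rw [hm]
    exact hn ν hν hνe
  · rw [hm]
    exact hK.finrank_genSpace_eq hlam hζ le_rfl ht.1 ht.2
  · have h1 := (happ t ht).gap_isBigO (hI t ht)
    rw [hgen t ht] at h1
    simp only [hedmd]
    exact h1
  · obtain ⟨L, Q, hL, hl, hl', hs⟩ := hK.exists_left_approximation ht.1 ht.2
    have hκt := hK.mul_mem ht.1 ht.2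
    -- Nonzero spectrum of the transpose on H²_{κt} lies in the spectrum of K on H²_{-κt}, so the
    -- same disc isolates λ on the left.
    have hLs : ∀ z ∈ Metric.closedBall lam R, z ∈ spectrum ℂ L → z = lam := fun z hz hzs =>
      hspec (κ * t) ⟨hκt.1, hκt.2.2⟩ z hz (hs z (hne z hz) hzs)
    have h1 := hL.gap_isBigO (EDMD.isolates_of_spectrum hL.compact hR hRl hLs)
    rw [EDMD.Approximates.genSpace_eq_singleton (fun z hz => hLs z (hball hz)) hmem] at h1
    simp only [hl, hl']
    exact h1
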